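/- **Theorem (Axiomatizability of $\langle\mathbb{Q};<,\times\rangle$).** A first-order theory $T$ *completely axiomatizes* a structure $\mathfrak M$ if the consequences of $T$ are exactly the sentences true in $\mathfrak M$. The claim "$T$ completely axiomatizes $\langle M;<,\times\rangle$", for a theory $T$ whose language contains further symbols, means: $T$ completely axiomatizes the expansion of $\langle M;<,\times\rangle$ to the language of $T$, and a sentence in the language $\{<,\times\}$ follows from $T$ if and only if it is true in $\langle M;<,\times\rangle$. A structure *admits quantifier elimination* if every first-order formula is equivalent in it to a quantifier-free formula in the same free variables. Here $\mathbb{Q}^+$ is the set of positive rational numbers, $0^{-1}=0$, $x^n=x\cdots x$ ($n$ factors), and for $n>1$ the unary predicate $\Re_n(y)$ means that $y=x^n$ for some element $x$ of the structure. Let $\mathsf{TQ}$ be the theory in the language $\{<,\times,{}^{-1},\mathbf 1\}$ with the axioms * (O$_1$) $\forall x,y\,(x<y\to y\not<x)$; (O$_2$) $\forall x,y,z\,(x<y<z\to x<z)$; (O$_3$) $\forall x,y\,(x<y\vee x=y\vee y<x)$; * (M$_1$) $\forall x,y,z\,(x\cdot(y\cdot z)=(x\cdot y)\cdot z)$; (M$_2$)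 $\forall x\,(x\cdot\mathbf 1=x)$; (M$_3$) $\forall x\,(x\cdot x^{-1}=\mathbf 1)$; (M$_4$) $\forall x,y\,(x\cdot y=y\cdot x)$; (M$_5$) $\forall x,y,z\,(x<y\to x\cdot z<y\cdot z)$; (M$_6$) $\exists y\,(y\ne\mathbf 1)$; * (M$_{10}$) $\forall x,z\,\exists y\,(x<z\to x<y^n<z)$, for each $n\ge 1$; * (M$_{11}$) $\forall x_0,\dots,x_{q-1}\,\exists y\,\forall z\,\bigwedge_{j<q,\ m_j\nmid n}(y^n\cdot x_j\ne z^{m_j})$, for each $n\ge1$, each $q\ge 0$ and all $m_0,\dots,m_{q-1}>1$. Let $\mathsf{TQ}^{\circ}$ be the theory in the language $\{<,\times,{}^{-1},\mathbf{-1},\mathbf 0,\mathbf 1\}$ with the axioms (O$_1$), (O$_2$), (O$_3$), (M$_1$), (M$_4$) and * (M$_2^\circ$) $\forall x\,(x\cdot\mathbf 1=x\wedge x\cdot\mathbf 0=\mathbf 0=\mathbf 0^{-1})$; (M$_3^\circ$) $\forall x\,(x\neq\mathbf 0\to x\cdot x^{-1}=\mathbf 1)$; * (M$_5^\circ$) $\forall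 x,y,z\,(x<y\wedge\mathbf 0<z\to x\cdot z<y\cdot z)$; (M$_5^\bullet$) $\forall x,y,z\,(x<y\wedge z<\mathbf 0\to y\cdot z<x\cdot z)$; (M$_6^\circ$) $\exists y\,(\mathbf{-1}<\mathbf 0<\mathbf 1<y)$; * (M$_8$) $\forall x\,(x^{2n}=\mathbf 1\leftrightarrow x=\mathbf 1\vee x=\mathbf{-1})$, for each $n\ge1$; * (M$_{10}^\circ$) $\forall x,z\,\exists y\,(\mathbf 0<x<z\to x<y^n<z)$, for each $n\ge1$; * (M$_{11}^\circ$) $\forall x_0,\dots,x_{q-1}\,\exists y\,\forall z\,\bigl(\bigwedge_{j<q}x_j\neq\mathbf 0\to\bigwedge_{j<q,\ m_j\nmid n}(y^n\cdot x_j\ne z^{m_j})\bigr)$, for each $n\ge1$, each $q\ge0$ and all $m_0,\dots,m_{q-1}>1$. Then: 1. $\mathsf{TQ}$ completely axiomatizes $\langle\mathbb{Q}^+;<,\times\rangle$, and the structure $\langle\mathbb{Q}^+;<,\times,{}^{-1},\mathbf 1,\{\Re_n\}_{n>1}\rangle$ admits quantifier elimination. 2. $\mathsf{TQ}^{\circ}$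 completely axiomatizes $\langle\mathbb{Q};<,\times\rangle$, and the structure $\langle\mathbb{Q};<,\times,{}^{-1},\mathbf{-1},\mathbf 0,\mathbf 1,\{\Re_n\}_{n>1}\rangle$ admits quantifier elimination. 3. The theory of $\langle\mathbb{Q};<,\times\rangle$ is decidable: there is an algorithm that decides whether a given first-order sentence in the language $\{<,\times\}$ is true in $\langle\mathbb{Q};<,\times\rangle$. -/

import Mathlib

open FirstOrder FirstOrder.Language

namespace OrdMul

/-! ### Signatures -/

/-- The function symbols of the signature `{<, ×}`. -/
inductive MulFunc : ℕ → Type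
  | mul : MulFunc 2

/-- The relation symbol `<`. -/
inductive LtRel : ℕ → Type
  | lt : LtRel 2

/-- The signature `{<, ×}`. -/
def langMul : FirstOrder.Language.{0, 0} := ⟨MulFunc, LtRel⟩

/-- The function symbols of the signature `{<, ×, ⁻¹, 1}`. -/
inductive GroupFunc : ℕ → Type
  | mul : GroupFunc 2
  | inv : GroupFunc 1
  | one : GroupFunc 0

/-- The signature `{<, ×, ⁻¹, 1}`. -/
def langGroup : FirstOrder.Language.{0, 0} := ⟨GroupFunc, LtRel⟩

/-- The function symbols of the signature `{<, ×, ⁻¹, -1, 0, 1}`. -/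
inductive SignedFunc : ℕ → Type
  | mul : SignedFunc 2
  | inv : SignedFunc 1
  | negOne : SignedFunc 0
  | zero : SignedFunc 0
  | one : SignedFunc 0

/-- The signature `{<, ×, ⁻¹, -1, 0, 1}`. -/
def langSigned : FirstOrder.Language.{0, 0} := ⟨SignedFunc, LtRel⟩

/-- The unary relation symbols `ℜ_n` for `n > 1`. -/
inductive PowRel : ℕ → Type
  | isPow (n : ℕ) (hn : 1 < n) : PowRel 1

/-- The signature `{ℜ_n : n > 1}`. -/
def langPow : FirstOrder.Language.{0, 0} := ⟨fun _ => Empty, PowRel⟩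

/-- The inclusion of `{<, ×}` into `{<, ×, ⁻¹, 1}`. -/
def toGroup : langMul →ᴸ langGroup where
  onFunction := fun _ f => match f with
    | MulFunc.mul => GroupFunc.mul
  onRelation := fun _ r => r

/-- The inclusion of `{<, ×}` into `{<, ×, ⁻¹, -1, 0, 1}`. -/
def toSigned : langMul →ᴸ langSigned where
  onFunction := fun _ f => match f with
    | MulFunc.mul => SignedFunc.mul
  onRelation := fun _ r => r

/-! ### Structures -/

/-- The positive rational numbers. -/
abbrev PosRat : Type := {q : ℚ // 0 < q}

/-- `⟨M; <, ×⟩`. -/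
instance mulStructure (M : Type) [LT M] [Mul M] : langMul.Structure M where
  funMap := fun f v => match f with
    | MulFunc.mul => v 0 * v 1
  RelMap := fun r v => match r with
    | LtRel.lt => v 0 < v 1

/-- `⟨ℚ⁺; <, ×, ⁻¹, 1⟩`. -/
instance groupStructurePosRat : langGroup.Structure PosRat where
  funMap := fun f v => match f with
    | GroupFunc.mul => v 0 * v 1
    | GroupFunc.inv => (v 0)⁻¹
    | GroupFunc.one => 1
  RelMap := fun r v => match r with
    | LtRel.lt => v 0 < v 1

/-- `⟨ℚ; <, ×, ⁻¹, -1, 0, 1⟩`, where `0⁻¹ = 0`. -/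
instance signedStructureRat : langSigned.Structure ℚ where
  funMap := fun f v => match f with
    | SignedFunc.mul => v 0 * v 1
    | SignedFunc.inv => (v 0)⁻¹
    | SignedFunc.negOne => -1
    | SignedFunc.zero => 0
    | SignedFunc.one => 1
  RelMap := fun r v => match r with
    | LtRel.lt => v 0 < v 1

/-- `ℜ_n(y)` says that `y` is the `n`-th power of an element of the structure. -/
instance powStructure (M : Type) [Monoid M] : langPow.Structure M where
  funMap := fun f _ => nomatch f
  RelMap := fun r v => match r with
    | PowRel.isPow n _ => ∃ x : M, v 0 = x ^ n

/-! ### Axioms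

The axioms are written for arbitrary symbols of an arbitrary language, so that they can be
used in both signatures. `&i` is the variable bound by the `i`-th quantifier from outside. -/

section Axioms

variable {L : FirstOrder.Language.{0, 0}}

/-- The term `t · t · … · t` with `n ≥ 1` factors. -/
def powTerm {α : Type} (mul : L.Functions 2) (t : L.Term α) (n : ℕ) : L.Term α :=
  (fun s => mul.apply₂ s t)^[n - 1] t

/-- `∀ x y, x < y → ¬ y < x` -/
def axO1 (lt : L.Relations 2) : L.Sentence :=
  ∀' ∀' (lt.boundedFormula₂ (&0) (&1) ⟹ ∼(lt.boundedFormula₂ (&1) (&0)))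

/-- `∀ x y z, x < y ∧ y < z → x < z` -/
def axO2 (lt : L.Relations 2) : L.Sentence :=
  ∀' ∀' ∀' ((lt.boundedFormula₂ (&0) (&1) ⊓ lt.boundedFormula₂ (&1) (&2)) ⟹
    lt.boundedFormula₂ (&0) (&2))

/-- `∀ x y, x < y ∨ x = y ∨ y < x` -/
def axO3 (lt : L.Relations 2) : L.Sentence :=
  ∀' ∀' (lt.boundedFormula₂ (&0) (&1) ⊔ ((&0 =' &1) ⊔ lt.boundedFormula₂ (&1) (&0)))

/-- `∀ x y z, x · (y · z) = (x · y) · z` -/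
def axM1 (mul : L.Functions 2) : L.Sentence :=
  ∀' ∀' ∀' (mul.apply₂ (&0) (mul.apply₂ (&1) (&2)) =' mul.apply₂ (mul.apply₂ (&0) (&1)) (&2))

/-- `∀ x, x · 1 = x` -/
def axM2 (mul : L.Functions 2) (one : L.Constants) : L.Sentence :=
  ∀' (mul.apply₂ (&0) one.term =' &0)

/-- `∀ x, x · x⁻¹ = 1` -/
def axM3 (mul : L.Functions 2) (inv : L.Functions 1) (one : L.Constants) : L.Sentence :=
  ∀' (mul.apply₂ (&0) (inv.apply₁ (&0)) =' one.term)

/-- `∀ x y, x · y = y · x` -/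
def axM4 (mul : L.Functions 2) : L.Sentence :=
  ∀' ∀' (mul.apply₂ (&0) (&1) =' mul.apply₂ (&1) (&0))

/-- `∀ x y z, x < y → x · z < y · z` -/
def axM5 (lt : L.Relations 2) (mul : L.Functions 2) : L.Sentence :=
  ∀' ∀' ∀' (lt.boundedFormula₂ (&0) (&1) ⟹
    lt.boundedFormula₂ (mul.apply₂ (&0) (&2)) (mul.apply₂ (&1) (&2)))

/-- `∃ y, y ≠ 1` -/
def axM6 (one : L.Constants) : L.Sentence :=
  ∃' ∼(&0 =' one.term)

/-- `∀ x z, ∃ y, x < z → x < y ^ n ∧ y ^ n < z` -/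
def axM10 (lt : L.Relations 2) (mul : L.Functions 2) (n : ℕ) : L.Sentence :=
  ∀' ∀' ∃' (lt.boundedFormula₂ (&0) (&1) ⟹
    (lt.boundedFormula₂ (&0) (powTerm mul (&2) n) ⊓
      lt.boundedFormula₂ (powTerm mul (&2) n) (&1)))

/-- The formula `⋀_{j < q, m_j ∤ n} y ^ n · x_j ≠ z ^ m_j` in the variables
`x_0, …, x_{q-1}, y, z`. -/
noncomputable def notPowers (mul : L.Functions 2) (n : ℕ) {q : ℕ} (m : Fin q → ℕ) :
    L.BoundedFormula Empty (q + 2) :=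
  BoundedFormula.iInf fun j : {j : Fin q // ¬ m j ∣ n} =>
    ∼(mul.apply₂ (powTerm mul (&(Fin.natAdd q 0)) n) (&(Fin.castAdd 2 j.1)) ='
      powTerm mul (&(Fin.natAdd q 1)) (m j.1))

/-- `∀ x_0 … x_{q-1}, ∃ y, ∀ z, ⋀_{j < q, m_j ∤ n} y ^ n · x_j ≠ z ^ m_j` -/
noncomputable def axM11 (mul : L.Functions 2) (n : ℕ) {q : ℕ} (m : Fin q → ℕ) : L.Sentence :=
  (notPowers mul n m).all.ex.alls

/-- `∀ x, x · 1 = x ∧ x · 0 = 0 ∧ 0 = 0⁻¹` -/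
def axM2' (mul : L.Functions 2) (inv : L.Functions 1) (zero one : L.Constants) : L.Sentence :=
  ∀' ((mul.apply₂ (&0) one.term =' &0) ⊓
    ((mul.apply₂ (&0) zero.term =' zero.term) ⊓ (zero.term =' inv.apply₁ zero.term)))

/-- `∀ x, x ≠ 0 → x · x⁻¹ = 1` -/
def axM3' (mul : L.Functions 2) (inv : L.Functions 1) (zero one : L.Constants) : L.Sentence :=
  ∀' (∼(&0 =' zero.term) ⟹ (mul.apply₂ (&0) (inv.apply₁ (&0)) =' one.term))

/-- `∀ x y z, x < y ∧ 0 < z → x · z < y · z` -/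
def axM5pos (lt : L.Relations 2) (mul : L.Functions 2) (zero : L.Constants) : L.Sentence :=
  ∀' ∀' ∀' ((lt.boundedFormula₂ (&0) (&1) ⊓ lt.boundedFormula₂ zero.term (&2)) ⟹
    lt.boundedFormula₂ (mul.apply₂ (&0) (&2)) (mul.apply₂ (&1) (&2)))

/-- `∀ x y z, x < y ∧ z < 0 → y · z < x · z` -/
def axM5neg (lt : L.Relations 2) (mul : L.Functions 2) (zero : L.Constants) : L.Sentence :=
  ∀' ∀' ∀' ((lt.boundedFormula₂ (&0) (&1) ⊓ lt.boundedFormula₂ (&2) zero.term) ⟹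
    lt.boundedFormula₂ (mul.apply₂ (&1) (&2)) (mul.apply₂ (&0) (&2)))

/-- `∃ y, -1 < 0 ∧ 0 < 1 ∧ 1 < y` -/
def axM6' (lt : L.Relations 2) (negOne zero one : L.Constants) : L.Sentence :=
  ∃' (lt.boundedFormula₂ negOne.term zero.term ⊓
    (lt.boundedFormula₂ zero.term one.term ⊓ lt.boundedFormula₂ one.term (&0)))

/-- `∀ x, x ^ (2 n) = 1 ↔ x = 1 ∨ x = -1` -/
def axM8 (mul : L.Functions 2) (negOne one : L.Constants) (n : ℕ) : L.Sentence :=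
  ∀' ((powTerm mul (&0) (2 * n) =' one.term) ⇔ ((&0 =' one.term) ⊔ (&0 =' negOne.term)))

/-- `∀ x z, ∃ y, 0 < x ∧ x < z → x < y ^ n ∧ y ^ n < z` -/
def axM10' (lt : L.Relations 2) (mul : L.Functions 2) (zero : L.Constants) (n : ℕ) :
    L.Sentence :=
  ∀' ∀' ∃' ((lt.boundedFormula₂ zero.term (&0) ⊓ lt.boundedFormula₂ (&0) (&1)) ⟹
    (lt.boundedFormula₂ (&0) (powTerm mul (&2) n) ⊓
      lt.boundedFormula₂ (powTerm mul (&2) n) (&1)))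

/-- `∀ x_0 … x_{q-1}, ∃ y, ∀ z, (⋀_{j < q} x_j ≠ 0) → ⋀_{j < q, m_j ∤ n} y ^ n · x_j ≠ z ^ m_j` -/
noncomputable def axM11' (mul : L.Functions 2) (zero : L.Constants) (n : ℕ) {q : ℕ}
    (m : Fin q → ℕ) : L.Sentence :=
  ((BoundedFormula.iInf fun j : Fin q => ∼(&(Fin.castAdd 2 j) =' zero.term)) ⟹
    notPowers mul n m).all.ex.alls

end Axioms

/-! ### Theories -/

/-- The theory `TQ` in the signature `{<, ×, ⁻¹, 1}`. -/
def TQ : langGroup.Theory :=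
  let lt : langGroup.Relations 2 := LtRel.lt
  let mul : langGroup.Functions 2 := GroupFunc.mul
  let inv : langGroup.Functions 1 := GroupFunc.inv
  let one : langGroup.Constants := GroupFunc.one
  {axO1 lt, axO2 lt, axO3 lt, axM1 mul, axM2 mul one, axM3 mul inv one, axM4 mul,
    axM5 lt mul, axM6 one} ∪
  {σ | ∃ n : ℕ, 1 ≤ n ∧ σ = axM10 lt mul n} ∪
  {σ | ∃ n : ℕ, 1 ≤ n ∧ ∃ (q : ℕ) (m : Fin q → ℕ), (∀ j, 1 < m j) ∧ σ = axM11 mul n m}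

/-- The modification of `TQ` for all rational numbers, in the signature
`{<, ×, ⁻¹, -1, 0, 1}`. -/
def TQSigned : langSigned.Theory :=
  let lt : langSigned.Relations 2 := LtRel.lt
  let mul : langSigned.Functions 2 := SignedFunc.mul
  let inv : langSigned.Functions 1 := SignedFunc.inv
  let negOne : langSigned.Constants := SignedFunc.negOne
  let zero : langSigned.Constants := SignedFunc.zero
  let one : langSigned.Constants := SignedFunc.one
  {axO1 lt, axO2 lt, axO3 lt, axM1 mul, axM2' mul inv zero one, axM3' mul inv zero one,
    axM4 mul, axM5pos lt mul zero, axM5neg lt mul zero, axM6' lt negOne zero one} ∪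
  {σ | ∃ n : ℕ, 1 ≤ n ∧ σ = axM8 mul negOne one n} ∪
  {σ | ∃ n : ℕ, 1 ≤ n ∧ σ = axM10' lt mul zero n} ∪
  {σ | ∃ n : ℕ, 1 ≤ n ∧ ∃ (q : ℕ) (m : Fin q → ℕ), (∀ j, 1 < m j) ∧ σ = axM11' mul zero n m}

/-! ### Model-theoretic notions -/

/-- The consequences of `T` are exactly the sentences true in `M`. -/
def CompletelyAxiomatizes {L : FirstOrder.Language.{0, 0}} (T : L.Theory) (M : Type) [L.Structure M] :
    Prop :=
  ∀ φ : L.Sentence, T ⊨ᵇ φ ↔ M ⊨ φ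

/-- `T`, a theory in an extension `L'` of `L`, has exactly those consequences in the
language `L` that are true in the `L`-structure `M`. -/
def CompletelyAxiomatizesVia {L L' : FirstOrder.Language.{0, 0}} (i : L →ᴸ L') (T : L'.Theory) (M : Type)
    [L.Structure M] : Prop :=
  ∀ φ : L.Sentence, T ⊨ᵇ i.onSentence φ ↔ M ⊨ φ

/-- Every formula is equivalent in `M` to a quantifier-free formula in the same variables. -/
def HasQE (L : FirstOrder.Language.{0, 0}) (M : Type) [L.Structure M] : Prop :=
  ∀ (n : ℕ) (φ : L.Formula (Fin n)), ∃ ψ : L.Formula (Fin n),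
    BoundedFormula.IsQF ψ ∧ ∀ v : Fin n → M, φ.Realize v ↔ ψ.Realize v

/-! ### Gödel numbering of the sentences of `{<, ×}` and decidability -/

/-- Gödel number of a term; its variables are `x_0, …, x_{n-1}`. -/
def termCode {n : ℕ} : langMul.Term (Empty ⊕ Fin n) → ℕ
  | .var (Sum.inr i) => 2 * (i : ℕ)
  | .func MulFunc.mul ts => 2 * Nat.pair (termCode (ts 0)) (termCode (ts 1)) + 1

/-- Gödel number of a formula; `∀'` binds the variable `x_n` in a formula with `n + 1`
variables. -/
def formulaCode : {n : ℕ} → langMul.BoundedFormula Empty n → ℕ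
  | _, .falsum => 0
  | _, .equal s t => 4 * Nat.pair (termCode s) (termCode t) + 1
  | _, .rel LtRel.lt ts => 4 * Nat.pair (termCode (ts 0)) (termCode (ts 1)) + 2
  | _, .imp φ ψ => 4 * Nat.pair (formulaCode φ) (formulaCode ψ) + 3
  | _, .all φ => 4 * formulaCode φ + 4

theorem termCode_injective {n : ℕ} : Function.Injective (termCode (n := n)) := by
  intro s
  induction s with
  | var a =>
    rcases a with a | i
    · exact a.elim
    · intro t h
      rcases t with (a | k) | ⟨f, ts⟩
      · exact a.elim
      · simp only [termCode] at h
        have : i = k := Fin.ext (by omega)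
        rw [this]
      · cases f
        simp only [termCode] at h
        omega
  | func f ss ih =>
    cases f
    intro t h
    rcases t with (a | k) | ⟨f, ts⟩
    · exact a.elim
    · simp only [termCode] at h
      omega
    · cases f
      simp only [termCode] at h
      have h' := Nat.pair_eq_pair.1 (by omega :
        Nat.pair (termCode (ss 0)) (termCode (ss 1)) = Nat.pair (termCode (ts 0)) (termCode (ts 1)))
      have : ss = ts := by
        funext k
        fin_cases k
        · exact ih 0 h'.1
        · exact ih 1 h'.2
      rw [this]

theorem formulaCode_injective {n : ℕ} : Function.Injective (formulaCode (n := n)) := by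
  intro φ
  induction φ with
  | falsum =>
    intro ψ h
    rcases ψ with _ | ⟨s', t'⟩ | ⟨r, ts'⟩ | ⟨φ', ψ'⟩ | φ'
    · rfl
    · simp only [formulaCode] at h; omega
    · cases r; simp only [formulaCode] at h; omega
    · simp only [formulaCode] at h; omega
    · simp only [formulaCode] at h; omega
  | equal s t =>
    intro ψ h
    rcases ψ with _ | ⟨s', t'⟩ | ⟨r, ts'⟩ | ⟨φ', ψ'⟩ | φ'
    · simp only [formulaCode] at h; omega
    · simp only [formulaCode] at h
      have h' := Nat.pair_eq_pair.1 (by omega :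
        Nat.pair (termCode s) (termCode t) = Nat.pair (termCode s') (termCode t'))
      rw [termCode_injective h'.1, termCode_injective h'.2]
    · cases r; simp only [formulaCode] at h; omega
    · simp only [formulaCode] at h; omega
    · simp only [formulaCode] at h; omega
  | rel r ts =>
    cases r
    intro ψ h
    rcases ψ with _ | ⟨s', t'⟩ | ⟨r, ts'⟩ | ⟨φ', ψ'⟩ | φ'
    · simp only [formulaCode] at h; omega
    · simp only [formulaCode] at h; omega
    · cases r
      simp only [formulaCode] at h
      have h' := Nat.pair_eq_pair.1 (by omega :
        Nat.pair (termCode (ts 0)) (termCode (ts 1)) =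
          Nat.pair (termCode (ts' 0)) (termCode (ts' 1)))
      have : ts = ts' := by
        funext k
        fin_cases k
        · exact termCode_injective h'.1
        · exact termCode_injective h'.2
      rw [this]
    · simp only [formulaCode] at h; omega
    · simp only [formulaCode] at h; omega
  | imp φ₁ φ₂ ih₁ ih₂ =>
    intro ψ h
    rcases ψ with _ | ⟨s', t'⟩ | ⟨r, ts'⟩ | ⟨φ', ψ'⟩ | φ'
    · simp only [formulaCode] at h; omega
    · simp only [formulaCode] at h; omega
    · cases r; simp only [formulaCode] at h; omega
    · simp only [formulaCode] at h
      have h' := Nat.pair_eq_pair.1 (by omega :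
        Nat.pair (formulaCode φ₁) (formulaCode φ₂) = Nat.pair (formulaCode φ') (formulaCode ψ'))
      rw [ih₁ h'.1, ih₂ h'.2]
    · simp only [formulaCode] at h; omega
  | all φ₁ ih =>
    intro ψ h
    rcases ψ with _ | ⟨s', t'⟩ | ⟨r, ts'⟩ | ⟨φ', ψ'⟩ | φ'
    · simp only [formulaCode] at h; omega
    · simp only [formulaCode] at h; omega
    · cases r; simp only [formulaCode] at h; omega
    · simp only [formulaCode] at h; omega
    · simp only [formulaCode] at h
      rw [ih (by omega : formulaCode φ₁ = formulaCode φ')]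

/-- The first-order theory of the `{<, ×}`-structure `M` is decidable: an algorithm decides
whether a given number is the Gödel number of a sentence that is true in `M`. -/
def TheoryDecidable (M : Type) [langMul.Structure M] : Prop :=
  ComputablePred fun k : ℕ => ∃ φ : langMul.Sentence, formulaCode φ = k ∧ M ⊨ φ

end OrdMul

/-! Up to signs and zero, a model of either theory is an ordered abelian group P, written
additively: a `Chart` sends x to its sign and to the logarithm of its absolute value. The axioms say
that P is nontrivial, that for every n ≥ 1 the multiples of n are dense in it, and that finitely
many cosets of subgroups m_j P with m_j > 1 never cover it. In such a group the type of a tuple is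
determined by the signs of its integer linear forms and by their divisibility by integers. `Sim R`
is a finite approximation of this: equal signs for coefficients up to R, equal divisibility by R!.

The core is the one-point extension `Sim.extend`: if a and b are `simStep R`-similar, every c has a
counterpart c' such that (a, c) and (b, c') are R-similar. If c satisfies a small linear equation
over a, then c' solves the same equation over b. Otherwise `exists_residue` produces an r that
behaves like c modulo R!, and density moves r by a multiple of R! into the cut supplied by
`exists_cut`, which keeps the residue. Induction on formulas then gives
`Chart.Compatible.realize_iff`: sufficiently similar tuples, possibly in two different models,
satisfy the same formula. Applied to the empty tuple this is completeness. Applied inside one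
structure it is quantifier elimination, because R-similarity depends on finitely many conditions on
signs, order and powers (`QFInterp.qfDefinable`).

For decidability the same extension lemma keeps track of heights. An abstract model has constant
height (`HeightBound.trivial`). For a positive rational the height is the maximum of numerator and
denominator, and witnesses have height at most `ratBound`: a fine grid of fractions gives density,
and a prime from Bertrand's postulate gives an element independent of the given ones. Hence a
quantifier over ℚ may be restricted to a finite set with an explicit bound (`formulaEval_iff`), and
truth is computed by primitive recursion on Gödel numbers. -/

namespace OrdMul

/-! ### Integer linear forms and divisibility in abelian groups -/

section Lin

variable {G : Type*} [AddCommGroup G]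

/-- The integer linear form with coefficients `k`. -/
def lin {n : ℕ} (k : Fin n → ℤ) (a : Fin n → G) : G := ∑ i, k i • a i

theorem lin_add {n : ℕ} (k l : Fin n → ℤ) (a : Fin n → G) :
    lin (k + l) a = lin k a + lin l a := by
  simp [lin, add_zsmul, Finset.sum_add_distrib]

theorem lin_neg {n : ℕ} (k : Fin n → ℤ) (a : Fin n → G) : lin (-k) a = -lin k a := by
  simp [lin]

theorem lin_sub {n : ℕ} (k l : Fin n → ℤ) (a : Fin n → G) :
    lin (k - l) a = lin k a - lin l a := by
  rw [sub_eq_add_neg, lin_add, lin_neg, sub_eq_add_neg]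

theorem lin_smul {n : ℕ} (c : ℤ) (k : Fin n → ℤ) (a : Fin n → G) :
    lin (c • k) a = c • lin k a := by
  simp [lin, mul_zsmul, Finset.smul_sum]

theorem lin_zero {n : ℕ} (a : Fin n → G) : lin 0 a = 0 := by simp [lin]

theorem lin_single {n : ℕ} (i : Fin n) (a : Fin n → G) : lin (Pi.single i 1) a = a i := by
  classical
  simp only [lin]
  rw [Finset.sum_eq_single i]
  · simp
  · intro j _ hj; simp [hj]
  · simp

theorem lin_snoc {n : ℕ} (k : Fin (n + 1) → ℤ) (a : Fin n → G) (c : G) :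
    lin k (Fin.snoc a c : Fin (n + 1) → G) =
      lin (fun i => k i.castSucc) a + k (Fin.last n) • c := by
  simp [lin, Fin.sum_univ_castSucc]

/-- `m` divides `x` in the `ℤ`-module `G`. -/
def Divides (m : ℤ) (x : G) : Prop := ∃ z : G, x = m • z

theorem Divides.add {m : ℤ} {x y : G} : Divides m x → Divides m y → Divides m (x + y) := by
  rintro ⟨z, rfl⟩ ⟨w, rfl⟩
  exact ⟨z + w, (smul_add _ _ _).symm⟩

theorem Divides.smul {m : ℤ} {x : G} (c : ℤ) : Divides m x → Divides m (c • x) := by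
  rintro ⟨z, rfl⟩
  exact ⟨c • z, smul_comm _ _ _⟩

theorem Divides.neg {m : ℤ} {x : G} (h : Divides m x) : Divides m (-x) := by
  simpa using h.smul (-1)

theorem divides_neg {m : ℤ} {x : G} : Divides m (-x) ↔ Divides m x :=
  ⟨fun h => by simpa using h.neg, Divides.neg⟩

theorem Divides.sub {m : ℤ} {x y : G} (hx : Divides m x) (hy : Divides m y) :
    Divides m (x - y) := sub_eq_add_neg x y ▸ hx.add hy.neg

theorem divides_smul_self (m : ℤ) (x : G) : Divides m (m • x) := ⟨x, rfl⟩

theorem divides_smul_of_dvd {m c : ℤ} (h : m ∣ c) (x : G) : Divides m (c • x) := by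
  obtain ⟨d, rfl⟩ := h
  exact ⟨d • x, mul_zsmul' _ _ _ |>.trans (by rw [smul_comm])⟩

theorem Divides.of_dvd {l m : ℤ} {x : G} (h : l ∣ m) : Divides m x → Divides l x := by
  rintro ⟨z, rfl⟩
  exact divides_smul_of_dvd h z

theorem Divides.add_iff {m : ℤ} {x y : G} (h : Divides m x) :
    Divides m (x + y) ↔ Divides m y :=
  ⟨fun h' => by simpa using h'.sub h, h.add⟩

/-- The factor `l` cancels for lack of torsion. This allows a divisibility condition to be checked
after scaling, with the modulus scaled as well. -/
theorem divides_mul_smul [IsAddTorsionFree G] {l : ℤ} (hl : l ≠ 0) (m : ℤ) (x : G) :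
    Divides (l * m) (l • x) ↔ Divides m x := by
  constructor
  · rintro ⟨z, hz⟩
    rw [mul_zsmul'] at hz
    have hz' : l • x = l • (m • z) := by rw [hz, smul_comm]
    exact ⟨z, zsmul_right_injective hl hz'⟩
  · rintro ⟨z, rfl⟩
    exact ⟨z, by rw [mul_zsmul', smul_comm]⟩

/-- Modulo `m`, the coefficients of a linear form may be reduced. -/
theorem divides_lin_emod {n : ℕ} (m : ℤ) (k : Fin n → ℤ) (a : Fin n → G) :
    Divides m (lin k a - lin (fun i => k i % m) a) := by
  rw [← lin_sub]
  have : k - (fun i => k i % m) = m • fun i => k i / m := by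
    funext i
    have := Int.emod_add_mul_ediv (k i) m
    simp only [Pi.sub_apply, Pi.smul_apply, smul_eq_mul]
    linarith
  rw [this, lin_smul]
  exact divides_smul_self _ _

end Lin

/-! ### Heights -/

/-- A submultiplicative height `h` on an ordered abelian group `H`, and a bound `F` for the
heights of the elements which witness regular density and infinite indices. -/
structure HeightBound (H : Type*) [AddCommGroup H] [LinearOrder H] (h : H → ℕ) (F : ℕ → ℕ) :
    Prop where
  one_le : ∀ x, 1 ≤ h x
  zero : h 0 ≤ 1
  add : ∀ x y, h (x + y) ≤ h x * h y
  neg : ∀ x, h (-x) = h x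
  -- Quotients are no higher than what they divide, so solving `n • s = lin k b` for `s` costs no
  -- height.
  root : ∀ (n : ℤ) x, n ≠ 0 → h x ≤ h (n • x)
  pos : ∃ e, 0 < e ∧ h e ≤ F 1
  dense : ∀ (n : ℕ) (B : ℕ) (x z : H), 1 ≤ n → n ≤ B → h x ≤ B → h z ≤ B → x < z →
    ∃ y, h y ≤ F B ∧ x < (n : ℤ) • y ∧ (n : ℤ) • y < z
  -- The class of `y` in H/MH has order `M` and its multiples meet the span of `b` only in zero. The
  -- bound depends on neither `M` nor `n`.
  generic : ∀ {n : ℕ} (b : Fin n → H) (B M : ℕ), 1 ≤ M → (∀ i, h (b i) ≤ B) →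
    ∃ y, h y ≤ F B ∧ ∀ (t : ℤ) (k : Fin n → ℤ),
      Divides (M : ℤ) (t • y + lin k b) → (M : ℤ) ∣ t

namespace HeightBound

variable {H : Type*} [AddCommGroup H] [LinearOrder H] {h : H → ℕ} {F : ℕ → ℕ}

theorem smul_le (hh : HeightBound H h F) (c : ℤ) (x : H) : h (c • x) ≤ h x ^ c.natAbs := by
  have key : ∀ m : ℕ, h ((m : ℤ) • x) ≤ h x ^ m := by
    intro m
    induction m with
    | zero => simpa using hh.zero
    | succ m ih =>
      rw [Nat.cast_succ, add_zsmul, one_zsmul, pow_succ]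
      exact (hh.add _ _).trans (Nat.mul_le_mul_right _ ih)
  rcases Int.natAbs_eq c with hc | hc
  · conv_lhs => rw [hc]
    exact key _
  · conv_lhs => rw [hc]
    rw [neg_zsmul, hh.neg]
    exact key _

theorem lin_le (hh : HeightBound H h F) {B C : ℕ} (hB : 1 ≤ B) {n : ℕ} (k : Fin n → ℤ)
    (b : Fin n → H) (hb : ∀ i, h (b i) ≤ B) (hk : ∀ i, (k i).natAbs ≤ C) :
    h (lin k b) ≤ B ^ (n * C) := by
  induction n with
  | zero => simpa [lin] using hh.zero
  | succ n ih =>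
    rw [lin, Fin.sum_univ_castSucc, Nat.succ_mul, pow_add]
    refine (hh.add _ _).trans (Nat.mul_le_mul ?_ ?_)
    · exact ih (fun i => k i.castSucc) (fun i => b i.castSucc) (fun i => hb _) (fun i => hk _)
    · refine (hh.smul_le _ _).trans ((Nat.pow_le_pow_left (hb _) _).trans ?_)
      exact Nat.pow_le_pow_right hB (hk _)

theorem sub_le (hh : HeightBound H h F) (x y : H) : h (x - y) ≤ h x * h y := by
  rw [sub_eq_add_neg, ← hh.neg y]
  exact hh.add _ _

end HeightBound

/-! ### Residues and cuts -/

/-- The relations of `c` with `a` modulo `M` are generated by one relation d c + lin k₀ a ≡ 0 with d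
∣ M, together with relations of `a` alone. It suffices that `r` satisfies this relation over `b` and
that no `t • r` with d ∤ t lies in the span of `b` modulo `M`. -/
theorem exists_residue {G H : Type*} [AddCommGroup G] [AddCommGroup H] [LinearOrder H]
    {h : H → ℕ} {F : ℕ → ℕ} (hh : HeightBound H h F) {n M B B₁ : ℕ}
    (hM : 1 ≤ M) (hB : 1 ≤ B) (hB₁ : B ≤ B₁) (hnM : B ^ (n * M) ≤ B₁)
    {a : Fin n → G} {b : Fin n → H} (hb : ∀ i, h (b i) ≤ B)
    (hdvd : ∀ m : ℤ, m ∣ M → ∀ k, Divides m (lin k a) ↔ Divides m (lin k b)) (c : G) :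
    ∃ r : H, h r ≤ B₁ * F B₁ ^ M ∧
      ∀ (t : ℤ) (k : Fin n → ℤ),
        Divides (M : ℤ) (t • c + lin k a) ↔ Divides (M : ℤ) (t • r + lin k b) := by
  -- The multipliers that bring `c` into the span of `a` modulo `M` form a subgroup dℤ, and it
  -- contains `M`.
  let I : AddSubgroup ℤ :=
    { carrier := {t | ∃ k : Fin n → ℤ, Divides (M : ℤ) (t • c + lin k a)}
      zero_mem' := ⟨0, 0, by simp [lin_zero]⟩
      add_mem' := by
        rintro s t ⟨k, hk⟩ ⟨l, hl⟩
        refine ⟨k + l, ?_⟩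
        rw [add_zsmul, lin_add]
        convert hk.add hl using 1
        abel
      neg_mem' := by
        rintro s ⟨k, hk⟩
        refine ⟨-k, ?_⟩
        rw [neg_zsmul, lin_neg]
        convert hk.neg using 1
        abel }
  obtain ⟨d, hd⟩ := Int.subgroup_cyclic I
  have hmem : ∀ t : ℤ, (∃ k : Fin n → ℤ, Divides (M : ℤ) (t • c + lin k a)) ↔ d ∣ t := by
    intro t
    change t ∈ I ↔ _
    rw [hd, AddSubgroup.mem_closure_singleton]
    constructor
    · rintro ⟨z, rfl⟩; exact ⟨z, by simp [mul_comm]⟩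
    · rintro ⟨z, rfl⟩; exact ⟨z, by simp [mul_comm]⟩
  have hdM : d ∣ M := (hmem M).1 ⟨0, by rw [lin_zero, add_zero]; exact divides_smul_self _ _⟩
  obtain ⟨e, he⟩ := hdM
  have hM0 : (M : ℤ) ≠ 0 := by positivity
  have hd0 : d ≠ 0 := by rintro rfl; simp at he; omega
  have he0 : e ≠ 0 := by rintro rfl; simp at he; omega
  obtain ⟨k₁, hk₁⟩ := (hmem d).2 dvd_rfl
  -- Reducing the coefficients modulo `M` is harmless for the relation and bounds the height of `lin
  -- k₀ b`.
  set k₀ : Fin n → ℤ := fun i => k₁ i % M with hk₀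
  have hk₀' : Divides (M : ℤ) (d • c + lin k₀ a) := by
    convert hk₁.sub (divides_lin_emod (M : ℤ) k₁ a) using 1
    abel
  have hda : Divides d (lin k₀ a) := by
    have := (hk₀'.of_dvd ⟨e, he⟩).sub (divides_smul_self d c)
    simpa using this
  obtain ⟨s, hs⟩ := (hdvd d ⟨e, he⟩ k₀).1 hda
  have hsB : h s ≤ B ^ (n * M) := by
    refine (hh.root d s hd0).trans ?_
    rw [← hs]
    refine hh.lin_le hB _ _ hb fun i => ?_
    have h1 := Int.emod_nonneg (k₁ i) hM0
    have h2 := Int.emod_lt_of_pos (k₁ i) (by positivity : (0 : ℤ) < M)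
    simp only [hk₀]; omega
  obtain ⟨y, hyF, hy⟩ := hh.generic (Fin.snoc b s : Fin (n + 1) → H) B₁ M hM (by
    intro i
    refine Fin.lastCases ?_ (fun j => ?_) i
    · simpa using hsB.trans hnM
    · simpa using (hb j).trans hB₁)
  have h1F : 1 ≤ F B₁ := (hh.one_le y).trans hyF
  have heM : e.natAbs ≤ M := by
    have h1 : M = d.natAbs * e.natAbs := by
      rw [← Int.natAbs_mul, ← he]; simp
    have h2 : 1 ≤ d.natAbs := Int.natAbs_pos.2 hd0
    nlinarith
  -- Since M = d e and `lin k₀ b = d • s`, multiplying by d gives M y − lin k₀ b, which is −lin k₀ b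
  -- modulo `M`, as for `c`.
  refine ⟨e • y - s, ?_, ?_⟩
  · refine (hh.sub_le _ _).trans ?_
    rw [mul_comm]
    refine Nat.mul_le_mul (hsB.trans hnM) ((hh.smul_le _ _).trans ?_)
    exact (Nat.pow_le_pow_left hyF _).trans (Nat.pow_le_pow_right h1F heM)
  · intro t k
    by_cases hdt : d ∣ t
    · obtain ⟨j, rfl⟩ := hdt
      have hr : d • (e • y - s) = (M : ℤ) • y - lin k₀ b := by
        rw [zsmul_sub, hs, he, mul_zsmul']
        rw [smul_comm]
      have hA : (d * j) • c + lin k a = j • (d • c + lin k₀ a) + lin (k - j • k₀) a := by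
        rw [lin_sub, lin_smul, zsmul_add, mul_zsmul, smul_comm]; abel
      have hB : (d * j) • (e • y - s) + lin k b =
          j • ((M : ℤ) • y) + lin (k - j • k₀) b := by
        rw [lin_sub, lin_smul, mul_zsmul, smul_comm, hr, zsmul_sub]; abel
      rw [hA, hB, (hk₀'.smul j).add_iff, ((divides_smul_self (M : ℤ) y).smul j).add_iff]
      exact hdvd M dvd_rfl _
    · refine iff_of_false (fun hk => hdt ((hmem t).1 ⟨k, hk⟩)) fun hk => hdt ?_
      -- The left side is (t e) y plus a form in `b` and `s`; this is why `y` was chosen generic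
      -- over `s` too. From d e ∣ t e follows d ∣ t.
      have h2 : (M : ℤ) ∣ t * e := by
        refine hy (t * e) (Fin.snoc k (-t)) ?_
        rw [lin_snoc]
        convert hk using 1
        simp only [Fin.snoc_castSucc, Fin.snoc_last, zsmul_sub, mul_zsmul, neg_zsmul]
        abel
      rw [he] at h2
      exact Int.dvd_of_mul_dvd_mul_right he0 h2

/-- The endpoints are the images of the nearest values on both sides of `x`. If one side has none,
the missing endpoint is the other one shifted by a positive element of height at most `F 1`; this
accounts for the factor `F 1`. -/
theorem exists_cut {G H ι : Type*} [Finite ι] [Nonempty ι] [LinearOrder G] [AddCommGroup H]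
    [LinearOrder H] [IsOrderedAddMonoid H] {h : H → ℕ} {F : ℕ → ℕ} (hh : HeightBound H h F)
    {Q : ℕ} {f : ι → G} {f' : ι → H} (hQ : ∀ i, h (f' i) ≤ Q)
    (hf : ∀ i j, f i < f j ↔ f' i < f' j) (x : G) (hx : ∀ i, x ≠ f i) :
    ∃ lo hi : H, lo < hi ∧ h lo ≤ Q * F 1 ∧ h hi ≤ Q * F 1 ∧
      ∀ w, lo < w → w < hi → ∀ i, (f i < x → f' i < w) ∧ (x < f i → w < f' i) := by
  have hf' : ∀ i j, f i ≤ f j ↔ f' i ≤ f' j := fun i j => by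
    rw [← not_lt, ← not_lt, hf]
  obtain ⟨e, he, heF⟩ := hh.pos
  have hF : 1 ≤ F 1 := (hh.one_le e).trans heF
  have hQF : ∀ i, h (f' i) ≤ Q * F 1 := fun i =>
    (hQ i).trans (Nat.le_mul_of_pos_right _ hF)
  have hlo : {i | f i < x}.Nonempty → ∃ i, f i < x ∧ ∀ j, f j < x → f' j ≤ f' i := by
    intro hne
    obtain ⟨i, hi, hmax⟩ := (Set.toFinite {i | f i < x}).exists_maximalFor f _ hne
    refine ⟨i, hi, fun j hj => (hf' _ _).1 ?_⟩
    rcases le_total (f j) (f i) with h1 | h1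
    · exact h1
    · exact hmax hj h1
  have hhi : {i | x < f i}.Nonempty → ∃ i, x < f i ∧ ∀ j, x < f j → f' i ≤ f' j := by
    intro hne
    obtain ⟨i, hi, hmin⟩ := (Set.toFinite {i | x < f i}).exists_minimalFor f _ hne
    refine ⟨i, hi, fun j hj => (hf' _ _).1 ?_⟩
    rcases le_total (f i) (f j) with h1 | h1
    · exact h1
    · exact hmin hj h1
  rcases Set.eq_empty_or_nonempty {i | f i < x} with hL | hL
  · have hU : {i | x < f i}.Nonempty := by
      obtain ⟨i⟩ := ‹Nonempty ι›
      refine ⟨i, lt_of_le_of_ne (not_lt.1 fun hi => ?_) (hx i)⟩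
      exact (Set.eq_empty_iff_forall_notMem.1 hL i) hi
    obtain ⟨i, hi, hmin⟩ := hhi hU
    refine ⟨f' i - e, f' i, sub_lt_self _ he, ?_, hQF i, fun w _ hw j => ⟨fun hj => ?_, fun hj => ?_⟩⟩
    · exact (hh.sub_le _ _).trans (Nat.mul_le_mul (hQ i) heF)
    · exact absurd hj (Set.eq_empty_iff_forall_notMem.1 hL j)
    · exact hw.trans_le (hmin j hj)
  · obtain ⟨i, hi, hmax⟩ := hlo hL
    rcases Set.eq_empty_or_nonempty {i | x < f i} with hU | hU
    · refine ⟨f' i, f' i + e, lt_add_of_pos_right _ he, hQF i, ?_,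
        fun w hw _ j => ⟨fun hj => ?_, fun hj => ?_⟩⟩
      · exact (hh.add _ _).trans (Nat.mul_le_mul (hQ i) heF)
      · exact (hmax j hj).trans_lt hw
      · exact absurd hj (Set.eq_empty_iff_forall_notMem.1 hU j)
    · obtain ⟨j, hj, hmin⟩ := hhi hU
      refine ⟨f' i, f' j, (hf _ _).1 (hi.trans hj), hQF i, hQF j, fun w hw hw' l => ⟨fun hl => ?_, fun hl => ?_⟩⟩
      · exact (hmax l hl).trans_lt hw
      · exact hw'.trans_le (hmin l hl)

/-! ### Similarity of tuples -/

section Sim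

variable {G H : Type} [AddCommGroup G] [LinearOrder G] [AddCommGroup H] [LinearOrder H]

/-- Two tuples are `R`-similar if linear forms with coefficients at most `R` have the same sign
on them, and all linear forms have the same divisibility by `R!`. -/
structure Sim (R : ℕ) {n : ℕ} (a : Fin n → G) (b : Fin n → H) : Prop where
  pos : ∀ k : Fin n → ℤ, (∀ i, (k i).natAbs ≤ R) → (0 < lin k a ↔ 0 < lin k b)
  dvd : ∀ k : Fin n → ℤ,
    Divides (R.factorial : ℤ) (lin k a) ↔ Divides (R.factorial : ℤ) (lin k b)

theorem Sim.symm {R n : ℕ} {a : Fin n → G} {b : Fin n → H} (h : Sim R a b) : Sim R b a :=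
  ⟨fun k hk => (h.pos k hk).symm, fun k => (h.dvd k).symm⟩

theorem Sim.refl (R : ℕ) {n : ℕ} (a : Fin n → G) : Sim R a a :=
  ⟨fun _ _ => Iff.rfl, fun _ => Iff.rfl⟩

theorem Sim.nil (R : ℕ) (a : Fin 0 → G) (b : Fin 0 → H) : Sim R a b :=
  ⟨fun k _ => by simp [lin], fun k => by
    simp only [lin, Finset.univ_eq_empty, Finset.sum_empty]
    exact iff_of_true ⟨0, by simp⟩ ⟨0, by simp⟩⟩

variable [IsOrderedAddMonoid G] [IsOrderedAddMonoid H]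

/-- If R! = m e, then m divides a form exactly when R! divides e times it, and this is again a form.
Here it matters that `Sim` puts no bound on coefficients in its divisibility clause. -/
theorem Sim.dvd_of_dvd {R n : ℕ} {a : Fin n → G} {b : Fin n → H} (h : Sim R a b) {m : ℤ}
    (hm : m ∣ (R.factorial : ℤ)) (k : Fin n → ℤ) :
    Divides m (lin k a) ↔ Divides m (lin k b) := by
  obtain ⟨e, he⟩ := hm
  have hR : (R.factorial : ℤ) ≠ 0 := by exact_mod_cast R.factorial_ne_zero
  have he0 : e ≠ 0 := by rintro rfl; simp [R.factorial_ne_zero] at he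
  rw [← divides_mul_smul he0, ← divides_mul_smul he0 m (lin k b), ← lin_smul, ← lin_smul,
    mul_comm e m, ← he]
  exact h.dvd _

theorem Sim.mono {R S n : ℕ} {a : Fin n → G} {b : Fin n → H} (hRS : R ≤ S) (h : Sim S a b) :
    Sim R a b :=
  ⟨fun k hk => h.pos k fun i => (hk i).trans hRS, fun k => h.dvd_of_dvd (by
    exact_mod_cast Nat.factorial_dvd_factorial hRS) k⟩

theorem Sim.neg {R n : ℕ} {a : Fin n → G} {b : Fin n → H} (h : Sim R a b) {k : Fin n → ℤ}
    (hk : ∀ i, (k i).natAbs ≤ R) : lin k a < 0 ↔ lin k b < 0 := by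
  rw [← neg_pos, ← neg_pos (a := lin k b), ← lin_neg, ← lin_neg]
  exact h.pos _ fun i => by simpa using hk i

theorem Sim.eq_zero {R n : ℕ} {a : Fin n → G} {b : Fin n → H} (h : Sim R a b) {k : Fin n → ℤ}
    (hk : ∀ i, (k i).natAbs ≤ R) : lin k a = 0 ↔ lin k b = 0 := by
  have h1 := h.pos k hk
  have h2 := h.neg hk
  constructor
  · intro h0
    rw [h0] at h1 h2
    exact le_antisymm (not_lt.1 fun h' => lt_irrefl _ (h1.2 h'))
      (not_lt.1 fun h' => lt_irrefl _ (h2.2 h'))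
  · intro h0
    rw [h0] at h1 h2
    exact le_antisymm (not_lt.1 fun h' => lt_irrefl _ (h1.1 h'))
      (not_lt.1 fun h' => lt_irrefl _ (h2.1 h'))

/-! ### Extending similar tuples by one point -/

/-- The similarity which is needed to extend tuples to `R`-similar tuples. -/
def simStep (R : ℕ) : ℕ := 2 * R * (R.factorial + R)

theorem two_mul_le_simStep (R : ℕ) : 2 * R ≤ simStep R :=
  Nat.le_mul_of_pos_right _ (Nat.add_pos_left R.factorial_pos R)

theorem le_simStep (R : ℕ) : R ≤ simStep R := by
  have := two_mul_le_simStep R; omega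

/-- The height of the element by which a tuple of height `B` is extended. -/
def simBound (F : ℕ → ℕ) (n R B : ℕ) : ℕ :=
  -- The first summand B₁ covers a point that depends linearly on the tuple. The second bounds r +
  -- R! y: the residue r has height at most B₁ F(B₁)^{R!}, and y comes from density between
  -- endpoints shifted by R! r, hence the nested value of `F`. The added R!·R! makes the exponent in
  -- the density clause admissible.
  B ^ ((n + 1) * R.factorial * (R + 1)) +
    (B ^ ((n + 1) * R.factorial * (R + 1)) *
        F (B ^ ((n + 1) * R.factorial * (R + 1))) ^ R.factorial) *
      F (B ^ ((n + 1) * R.factorial * (R + 1)) * F 1 *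
          (B ^ ((n + 1) * R.factorial * (R + 1)) *
            F (B ^ ((n + 1) * R.factorial * (R + 1))) ^ R.factorial) ^ R.factorial +
        R.factorial * R.factorial) ^ R.factorial

/-- R!·R! divides (2R)!, and 2R ≤ `simStep R`. Moduli of this size appear when a condition modulo R!
is multiplied by some l ≤ R. -/
theorem Sim.factorial_mul_dvd {R n : ℕ} {a : Fin n → G} {b : Fin n → H}
    (hab : Sim (simStep R) a b) {m : ℤ} (hm : m ∣ R.factorial * R.factorial) (k : Fin n → ℤ) :
    Divides m (lin k a) ↔ Divides m (lin k b) := by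
  refine hab.dvd_of_dvd (hm.trans ?_) k
  have h1 := Nat.factorial_mul_factorial_dvd_factorial_add R R
  have h2 : (R + R).factorial ∣ (simStep R).factorial :=
    Nat.factorial_dvd_factorial (by have := two_mul_le_simStep R; omega)
  exact_mod_cast h1.trans h2

/-- Only positive coefficients of the new point need attention: a negative one is handled by
negating the form, which is why both signs are required, and a zero one by the similarity of the old
tuples. -/
theorem Sim.of_scaled {R n : ℕ} {a : Fin n → G} {b : Fin n → H} (hab : Sim R a b) {c : G} {c' : H}
    (hpos : ∀ (l : ℕ) (k : Fin n → ℤ), 1 ≤ l → l ≤ R → (∀ i, (k i).natAbs ≤ R) →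
      (0 < (l : ℤ) • c + lin k a ↔ 0 < (l : ℤ) • c' + lin k b) ∧
      ((l : ℤ) • c + lin k a < 0 ↔ (l : ℤ) • c' + lin k b < 0))
    (hdvd : ∀ (t : ℤ) (k : Fin n → ℤ), Divides (R.factorial : ℤ) (t • c + lin k a) ↔
      Divides (R.factorial : ℤ) (t • c' + lin k b)) :
    Sim R (Fin.snoc a c : Fin (n + 1) → G) (Fin.snoc b c' : Fin (n + 1) → H) := by
  refine ⟨fun k hk => ?_, fun k => ?_⟩
  · rw [lin_snoc, lin_snoc, add_comm, add_comm (lin _ b)]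
    have hl := hk (Fin.last n)
    rcases lt_trichotomy (k (Fin.last n)) 0 with h0 | h0 | h0
    · obtain ⟨l, hl'⟩ := Int.eq_ofNat_of_zero_le (by omega : 0 ≤ -k (Fin.last n))
      have := (hpos l (-fun i => k i.castSucc) (by omega) (by omega)
        (fun i => by simpa using hk _)).2
      have hk' : k (Fin.last n) = -(l : ℤ) := by omega
      rw [lin_neg, lin_neg] at this
      rw [hk', neg_zsmul, neg_zsmul, ← neg_lt_zero, ← neg_lt_zero (a := _ + lin _ b)]
      simpa [neg_add] using this
    · simp only [h0, zero_smul, zero_add]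
      exact hab.pos _ fun i => hk _
    · obtain ⟨l, hl'⟩ := Int.eq_ofNat_of_zero_le h0.le
      rw [hl']
      exact (hpos l _ (by omega) (by omega) fun i => hk _).1
  · rw [lin_snoc, lin_snoc, add_comm, add_comm (lin _ b)]
    exact hdvd _ _

/-- The equation l c = −lin k a makes `l` divide `lin k a`, hence `lin k b`, and the quotient gives
`c'`. After multiplication by `l`, every condition on `c` becomes one on the old tuple: signs of
forms with coefficients up to 2R², and divisibility by l R!. -/
theorem Sim.extend_of_eq {R n : ℕ} {a : Fin n → G} {b : Fin n → H} (hab : Sim (simStep R) a b)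
    {h : H → ℕ} {F : ℕ → ℕ} (hh : HeightBound H h F) {B : ℕ} (hB : 1 ≤ B)
    (hb : ∀ i, h (b i) ≤ B) {c : G} {l : ℕ} {k : Fin n → ℤ} (hl : 1 ≤ l) (hlR : l ≤ R)
    (hk : ∀ i, (k i).natAbs ≤ R) (hc : (l : ℤ) • c + lin k a = 0) :
    ∃ c' : H, h c' ≤ B ^ (n * R) ∧
      Sim R (Fin.snoc a c : Fin (n + 1) → G) (Fin.snoc b c' : Fin (n + 1) → H) := by
  have hl0 : (l : ℤ) ≠ 0 := by positivity
  have hlf : (l : ℤ) ∣ R.factorial := by exact_mod_cast Nat.dvd_factorial hl hlR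
  have hc1 : (l : ℤ) • c = -lin k a := eq_neg_of_add_eq_zero_left hc
  have hdb : Divides (l : ℤ) (lin k b) := (hab.factorial_mul_dvd (hlf.mul_left _) k).1 (by
    rw [← divides_neg, ← hc1]; exact divides_smul_self _ _)
  obtain ⟨s, hs⟩ := hdb
  have hsc : (l : ℤ) • (-s) = -lin k b := by rw [hs, smul_neg]
  have hA : ∀ (t : ℤ) (k' : Fin n → ℤ),
      (l : ℤ) • (t • c + lin k' a) = lin ((l : ℤ) • k' - t • k) a := fun t k' => by
    rw [smul_add, smul_comm, hc1, lin_sub, lin_smul, lin_smul, smul_neg]; abel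
  have hA' : ∀ (t : ℤ) (k' : Fin n → ℤ),
      (l : ℤ) • (t • (-s) + lin k' b) = lin ((l : ℤ) • k' - t • k) b := fun t k' => by
    rw [smul_add, smul_comm, hsc, lin_sub, lin_smul, lin_smul, smul_neg]; abel
  refine ⟨-s, ?_, (hab.mono (le_simStep R)).of_scaled ?_ ?_⟩
  · refine (hh.root l _ hl0).trans ?_
    rw [hsc, hh.neg]
    exact hh.lin_le hB _ _ hb hk
  · intro l' k' hl' hl'R hk'
    have hbd : ∀ i, (((l : ℤ) • k' - (l' : ℤ) • k) i).natAbs ≤ simStep R := fun i => by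
      have h1 : ((l : ℤ) * k' i).natAbs ≤ R * R := by
        rw [Int.natAbs_mul]; exact Nat.mul_le_mul (by simpa using hlR) (hk' i)
      have h2 : ((l' : ℤ) * k i).natAbs ≤ R * R := by
        rw [Int.natAbs_mul]; exact Nat.mul_le_mul (by simpa using hl'R) (hk i)
      have h3 : 2 * (R * R) ≤ simStep R := by rw [simStep]; nlinarith [Nat.zero_le (R * R.factorial)]
      simp only [Pi.sub_apply, Pi.smul_apply, smul_eq_mul]
      omega
    have hlpos : (0 : ℤ) < l := by positivity
    constructor
    · rw [← smul_pos_iff_of_pos_left hlpos, ← smul_pos_iff_of_pos_left hlpos (b := _ + lin k' b),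
        hA, hA']
      exact hab.pos _ hbd
    · rw [← smul_neg_iff_of_pos_left hlpos, ← smul_neg_iff_of_pos_left hlpos (b := _ + lin k' b),
        hA, hA']
      exact hab.neg hbd
  · intro t k'
    rw [← divides_mul_smul hl0, ← divides_mul_smul hl0 _ (_ + lin k' b), hA, hA']
    exact hab.factorial_mul_dvd (mul_dvd_mul_right hlf _) _

/-- If `c` solves no equation with small coefficients, its sign conditions are strict and cut out an
open interval. With M = R!, all of them are rescaled to compare M c with forms in `a`.
Independently, `r` realizes the residue conditions. Adding multiples of M to `r` keeps these and can
reach the interval. -/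
theorem Sim.extend {R n : ℕ} (hR : 1 ≤ R) {a : Fin n → G} {b : Fin n → H}
    (hab : Sim (simStep R) a b)
    {h : H → ℕ} {F : ℕ → ℕ} (hh : HeightBound H h F) {B : ℕ} (hB : 1 ≤ B)
    (hb : ∀ i, h (b i) ≤ B) (c : G) :
    ∃ c' : H, h c' ≤ simBound F n R B ∧
      Sim R (Fin.snoc a c : Fin (n + 1) → G) (Fin.snoc b c' : Fin (n + 1) → H) := by
  set M := R.factorial with hM
  have hM1 : 1 ≤ M := R.factorial_pos
  have hM0 : (M : ℤ) ≠ 0 := by positivity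
  have hMpos : (0 : ℤ) < M := by positivity
  set B₁ := B ^ ((n + 1) * M * (R + 1)) with hB₁
  have hpow : ∀ {e}, e ≤ (n + 1) * M * (R + 1) → B ^ e ≤ B₁ := fun he =>
    Nat.pow_le_pow_right hB he
  by_cases hex : ∃ (l : ℕ) (k : Fin n → ℤ), 1 ≤ l ∧ l ≤ R ∧ (∀ i, (k i).natAbs ≤ R) ∧
      (l : ℤ) • c + lin k a = 0
  · obtain ⟨l, k, hl, hlR, hk, hc⟩ := hex
    obtain ⟨c', hc', hs⟩ := hab.extend_of_eq hh hB hb hl hlR hk hc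
    refine ⟨c', hc'.trans ((hpow ?_).trans (Nat.le_add_right _ _)), hs⟩
    exact Nat.mul_le_mul (by nlinarith) (by omega)
  push Not at hex
  obtain ⟨r, hr, hrd⟩ := exists_residue hh (n := n) (B₁ := B₁) hM1 hB
    (by simpa using hpow (e := 1) (by nlinarith [Nat.mul_pos n.succ_pos hM1]))
    (hpow (by nlinarith [Nat.zero_le (n * M * R)])) hb
    (fun m hm k => hab.factorial_mul_dvd (hm.mul_left _) k) c
  set Br := B₁ * F B₁ ^ M with hBr
  -- The index (l − 1, k) stands for the form l c + lin k a. Multiplied by M / l it compares M c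
  -- with `lin (κ p) a`, where κ = −(M / l) k.
  let ι := Fin R × (Fin n → Finset.Icc (-(R : ℤ)) R)
  have hι : Nonempty ι := ⟨⟨⟨0, hR⟩, fun _ => ⟨0, by simp⟩⟩⟩
  let κ : ι → Fin n → ℤ := fun p i => -((M / (p.1 + 1) : ℕ) : ℤ) * (p.2 i : ℤ)
  have hκ : ∀ p i, (κ p i).natAbs ≤ M * R := fun p i => by
    simp only [κ, Int.natAbs_mul, Int.natAbs_neg, Int.natAbs_natCast]
    refine Nat.mul_le_mul (Nat.div_le_self _ _) ?_
    have := Finset.mem_Icc.1 (p.2 i).2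
    omega
  have hκ2 : ∀ p q i, ((κ p - κ q) i).natAbs ≤ simStep R := fun p q i => by
    have h1 := hκ p i
    have h2 := hκ q i
    have h3 : 2 * (M * R) ≤ simStep R := by rw [simStep, ← hM]; nlinarith [Nat.zero_le (R * R)]
    simp only [Pi.sub_apply]
    omega
  have hdiv : ∀ p : ι, (((p.1 + 1 : ℕ) : ℤ)) * ((M / (p.1 + 1) : ℕ) : ℤ) = M := fun p => by
    exact_mod_cast Nat.mul_div_cancel' (Nat.dvd_factorial (Nat.succ_pos _) p.1.2)
  have hdpos : ∀ p : ι, (0 : ℤ) < ((M / (p.1 + 1) : ℕ) : ℤ) := fun p => by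
    have := hdiv p
    by_contra h0
    nlinarith [Int.natCast_nonneg (p.1 + 1 : ℕ)]
  have hscale : ∀ {K : Type} [AddCommGroup K] (x : K) (y : Fin n → K) (p : ι),
      (M : ℤ) • x - lin (κ p) y = ((M / (p.1 + 1) : ℕ) : ℤ) •
        (((p.1 + 1 : ℕ) : ℤ) • x + lin (fun i => (p.2 i : ℤ)) y) := by
    intro K _ x y p
    have : κ p = -(((M / (p.1 + 1) : ℕ) : ℤ) • fun i => (p.2 i : ℤ)) := by
      funext i; simp [κ]
    rw [this, lin_neg, lin_smul, smul_add, smul_smul, mul_comm, hdiv, sub_neg_eq_add]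
  have hscale' : ∀ {K : Type} [AddCommGroup K] [LinearOrder K] [IsOrderedAddMonoid K]
      (x : K) (y : Fin n → K) (p : ι),
      (lin (κ p) y < (M : ℤ) • x ↔ 0 < ((p.1 + 1 : ℕ) : ℤ) • x + lin (fun i => (p.2 i : ℤ)) y) ∧
      ((M : ℤ) • x < lin (κ p) y ↔ ((p.1 + 1 : ℕ) : ℤ) • x + lin (fun i => (p.2 i : ℤ)) y < 0) := by
    intro K _ _ _ x y p
    exact ⟨by rw [← sub_pos, hscale, smul_pos_iff_of_pos_left (hdpos p)],
      by rw [← sub_neg, hscale, smul_neg_iff_of_pos_left (hdpos p)]⟩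
  obtain ⟨lo, hi, hlohi, hlo, hhi, hcut⟩ := exists_cut hh (ι := ι) (f := fun p => lin (κ p) a)
    (f' := fun p => lin (κ p) b) (Q := B₁)
    (fun p => (hh.lin_le hB _ _ hb (hκ p)).trans (hpow (by
      nlinarith [Nat.zero_le (n * M), Nat.zero_le M, Nat.zero_le (M * R)])))
    (fun p q => by
      rw [← sub_pos, ← sub_pos (a := lin (κ q) b), ← lin_sub, ← lin_sub]
      exact hab.pos _ (hκ2 q p)) ((M : ℤ) • c) (fun p hp => by
      have h1 := hscale c a p
      rw [hp, sub_self] at h1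
      have h2 := (smul_eq_zero.1 h1.symm).resolve_left (hdpos p).ne'
      refine hex (p.1 + 1) _ (by omega) (by omega) (fun i => ?_) h2
      have := Finset.mem_Icc.1 (p.2 i).2
      omega)
  have hMr : h ((M : ℤ) • r) ≤ Br ^ M :=
    (hh.smul_le _ _).trans (by simpa using Nat.pow_le_pow_left hr M)
  set B₂ := B₁ * F 1 * Br ^ M + M * M with hB₂
  -- The new point is r + M y, and M (r + M y) = M r + M² y has to lie between `lo` and `hi`. This
  -- explains the exponent M² and the shift of the endpoints by M r.
  obtain ⟨y, hy, hy1, hy2⟩ := hh.dense (M * M) B₂ (lo - (M : ℤ) • r) (hi - (M : ℤ) • r)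
    (Nat.mul_pos hM1 hM1) (Nat.le_add_left _ _)
    ((hh.sub_le _ _).trans ((Nat.mul_le_mul hlo hMr).trans (Nat.le_add_right _ _)))
    ((hh.sub_le _ _).trans ((Nat.mul_le_mul hhi hMr).trans (Nat.le_add_right _ _)))
    (sub_lt_sub_right hlohi _)
  have hw : (M : ℤ) • (r + (M : ℤ) • y) = (M : ℤ) • r + ((M * M : ℕ) : ℤ) • y := by
    rw [smul_add, smul_smul, Nat.cast_mul]
  rw [sub_lt_iff_lt_add'] at hy1
  rw [lt_sub_iff_add_lt'] at hy2
  rw [← hw] at hy1 hy2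
  refine ⟨r + (M : ℤ) • y, ?_, (hab.mono (le_simStep R)).of_scaled ?_ ?_⟩
  · refine (hh.add _ _).trans (le_trans ?_ (Nat.le_add_left _ _))
    refine Nat.mul_le_mul hr ((hh.smul_le _ _).trans ?_)
    simpa using Nat.pow_le_pow_left hy M
  · intro l k hl hlR hk
    let p : ι := (⟨l - 1, by omega⟩, fun i => ⟨k i, Finset.mem_Icc.2 (by have := hk i; omega)⟩)
    have hp : ((p.1 + 1 : ℕ) : ℤ) = l := by simp only [p]; omega
    have hc1 := hscale' c a p
    have hc2 := hscale' (r + (M : ℤ) • y) b p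
    rw [hp] at hc1 hc2
    change (_ ↔ 0 < (l : ℤ) • c + lin k a) ∧ (_ ↔ (l : ℤ) • c + lin k a < 0) at hc1
    change (_ ↔ 0 < (l : ℤ) • (r + (M : ℤ) • y) + lin k b) ∧
      (_ ↔ (l : ℤ) • (r + (M : ℤ) • y) + lin k b < 0) at hc2
    obtain ⟨hcut1, hcut2⟩ := hcut _ hy1 hy2 p
    rw [hc1.1, hc2.1] at hcut1
    rw [hc1.2, hc2.2] at hcut2
    have hne := hex l k hl hlR hk
    -- The cut transfers signs from `c` to the new point only; the converses hold because the form
    -- never vanishes at `c`.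
    refine ⟨⟨hcut1, fun h1 => ?_⟩, ⟨hcut2, fun h1 => ?_⟩⟩
    · exact (lt_or_gt_of_ne hne).resolve_left fun h2 => lt_asymm h1 (hcut2 h2)
    · exact (lt_or_gt_of_ne hne).resolve_right fun h2 => lt_asymm h1 (hcut1 h2)
  · intro t k
    rw [hrd t k, smul_add, add_right_comm, add_comm (_ + lin k b), smul_comm,
      (divides_smul_self (M : ℤ) (t • y)).add_iff]

end Sim

/-! ### Charts -/

/-- A chart describes the elements of an ordered multiplicative structure by their signs and the
logarithms of their absolute values. -/
structure Chart (M P : Type) [CommMonoid M] [Inv M] [LT M] [AddCommGroup P] [LinearOrder P] where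
  sgn : M → SignType
  lg : M → P
  sgn_one : sgn 1 = 1
  sgn_mul : ∀ x y, sgn (x * y) = sgn x * sgn y
  sgn_inv : ∀ x, sgn x⁻¹ = sgn x
  lg_mul : ∀ x y, sgn x ≠ 0 → sgn y ≠ 0 → lg (x * y) = lg x + lg y
  -- A normalization: zero has no logarithm, and the value 0 lets it drop out of linear forms.
  lg_zero : ∀ x, sgn x = 0 → lg x = 0
  lg_inv : ∀ x, lg x⁻¹ = -lg x
  -- The factor `sgn x` reverses the order of the logarithms on negative elements and makes the
  -- comparison of zero with zero false.
  lt_iff : ∀ x y, x < y ↔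
    sgn x < sgn y ∨ sgn x = sgn y ∧ 0 < ((sgn x : SignType) : ℤ) • (lg y - lg x)
  ext : ∀ x y, sgn x = sgn y → lg x = lg y → x = y
  surj : ∀ x p, sgn x ≠ 0 → ∃ y, sgn y = sgn x ∧ lg y = p

namespace Chart

section One

variable {M P : Type} [CommMonoid M] [Inv M] [LT M] [AddCommGroup P] [LinearOrder P]
  (C : Chart M P)

theorem lg_one : C.lg 1 = 0 := by
  have h1 : C.sgn 1 ≠ 0 := by rw [C.sgn_one]; decide
  simpa using C.lg_mul 1 1 h1 h1

theorem sgn_pow (x : M) (m : ℕ) : C.sgn (x ^ m) = C.sgn x ^ m := by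
  induction m with
  | zero => simp [C.sgn_one]
  | succ m ih => rw [pow_succ, pow_succ, C.sgn_mul, ih]

theorem lg_pow (x : M) {m : ℕ} (hm : m ≠ 0) : C.lg (x ^ m) = (m : ℤ) • C.lg x := by
  by_cases hx : C.sgn x = 0
  · rw [C.lg_zero x hx, C.lg_zero, smul_zero]
    rw [C.sgn_pow, hx, zero_pow hm]
  · clear hm
    induction m with
    | zero => simp [C.lg_one]
    | succ m ih =>
      rw [pow_succ, C.lg_mul _ _ _ hx, ih, Nat.cast_succ, add_zsmul, one_zsmul]
      rw [C.sgn_pow]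
      exact pow_ne_zero _ hx

/-- Sign and logarithm can be prescribed independently by `surj`, so being an `m`-th power splits
into a condition on each. -/
theorem exists_pow_iff (x : M) {m : ℕ} (hm : m ≠ 0) :
    (∃ z, x = z ^ m) ↔ (∃ z, C.sgn z ^ m = C.sgn x) ∧ Divides (m : ℤ) (C.lg x) := by
  constructor
  · rintro ⟨z, rfl⟩
    exact ⟨⟨z, (C.sgn_pow z m).symm⟩, C.lg z, C.lg_pow z hm⟩
  · rintro ⟨⟨z, hz⟩, p, hp⟩
    by_cases hx : C.sgn x = 0
    · refine ⟨x, C.ext _ _ ?_ ?_⟩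
      · rw [C.sgn_pow, hx, zero_pow hm]
      · rw [C.lg_pow _ hm, C.lg_zero x hx, smul_zero]
    · have hz0 : C.sgn z ≠ 0 := by
        intro h0
        rw [h0, zero_pow hm] at hz
        exact hx hz.symm
      obtain ⟨y, hy, hyp⟩ := C.surj z p hz0
      refine ⟨y, C.ext _ _ ?_ ?_⟩
      · rw [C.sgn_pow, hy, hz]
      · rw [C.lg_pow _ hm, hyp, hp]

end One

/-! ### Similarity and term values in two structures with charts -/

section Two

variable {M P M' P' : Type} [CommMonoid M] [Inv M] [LT M] [AddCommGroup P] [LinearOrder P]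
  [CommMonoid M'] [Inv M'] [LT M'] [AddCommGroup P'] [LinearOrder P']
  (C : Chart M P) (C' : Chart M' P')

/-- Two charts have the same signs. -/
def SameSigns : Prop := ∀ s, (∃ x, C.sgn x = s) ↔ ∃ y, C'.sgn y = s

/-- Similarity of tuples in two structures with charts. -/
structure ESim (R : ℕ) {n : ℕ} (a : Fin n → M) (b : Fin n → M') : Prop where
  sgn : ∀ i, C.sgn (a i) = C'.sgn (b i)
  sim : Sim R (C.lg ∘ a) (C'.lg ∘ b)

/-- The values `x` and `y` of a term at the tuples `a` and `b`. -/
structure TermRel (R : ℕ) {n : ℕ} (a : Fin n → M) (b : Fin n → M') (x : M) (y : M') : Prop where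
  sgn : C.sgn x = C'.sgn y
  lg : ∃ k : Fin n → ℤ, (∀ i, (k i).natAbs ≤ R) ∧ C.lg x = lin k (C.lg ∘ a) ∧
    C'.lg y = lin k (C'.lg ∘ b)

variable {C C'}

theorem SameSigns.symm (h : SameSigns C C') : SameSigns C' C := fun s => (h s).symm

theorem ESim.symm {R n : ℕ} {a : Fin n → M} {b : Fin n → M'} (h : ESim C C' R a b) :
    ESim C' C R b a := ⟨fun i => (h.sgn i).symm, h.sim.symm⟩

theorem ESim.refl (C : Chart M P) (R : ℕ) {n : ℕ} (a : Fin n → M) : ESim C C R a a :=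
  ⟨fun _ => rfl, Sim.refl R _⟩

theorem ESim.nil (R : ℕ) (a : Fin 0 → M) (b : Fin 0 → M') : ESim C C' R a b :=
  ⟨fun i => i.elim0, Sim.nil R _ _⟩

namespace TermRel

variable {n : ℕ} {a : Fin n → M} {b : Fin n → M'}

theorem mono {R S : ℕ} (hRS : R ≤ S) {x : M} {y : M'} (h : TermRel C C' R a b x y) :
    TermRel C C' S a b x y := by
  obtain ⟨h1, k, h2, h3⟩ := h
  exact ⟨h1, k, fun i => (h2 i).trans hRS, h3⟩

theorem var {i : Fin n} (h : C.sgn (a i) = C'.sgn (b i)) :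
    TermRel C C' 1 a b (a i) (b i) := by
  refine ⟨h, Pi.single i 1, fun j => ?_, ?_, ?_⟩
  · by_cases hj : j = i
    · subst hj; simp
    · simp [hj]
  · rw [lin_single]; rfl
  · rw [lin_single]; rfl

theorem const {R : ℕ} {x : M} {y : M'} (h : C.sgn x = C'.sgn y) (hx : C.lg x = 0)
    (hy : C'.lg y = 0) : TermRel C C' R a b x y :=
  ⟨h, 0, by simp, by rw [lin_zero, hx], by rw [lin_zero, hy]⟩

theorem one : TermRel C C' 0 a b 1 1 :=
  const (C.sgn_one.trans C'.sgn_one.symm) C.lg_one C'.lg_one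

theorem mul {R S : ℕ} {x z : M} {y w : M'} (h : TermRel C C' R a b x y)
    (h' : TermRel C C' S a b z w) : TermRel C C' (R + S) a b (x * z) (y * w) := by
  have hs : C.sgn (x * z) = C'.sgn (y * w) := by rw [C.sgn_mul, C'.sgn_mul, h.sgn, h'.sgn]
  obtain ⟨k, hk, hx, hy⟩ := h.lg
  obtain ⟨l, hl, hz, hw⟩ := h'.lg
  -- When the product is zero, its logarithm is 0 by convention and not the sum of the logarithms of
  -- the factors, so the zero form must be used.
  by_cases h0 : C.sgn (x * z) = 0
  · exact const hs (C.lg_zero _ h0) (C'.lg_zero _ (hs ▸ h0))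
  · have h0' : C'.sgn (y * w) ≠ 0 := hs ▸ h0
    rw [C.sgn_mul] at h0
    rw [C'.sgn_mul] at h0'
    refine ⟨hs, k + l, fun i => ?_, ?_, ?_⟩
    · have := hk i
      have := hl i
      simp only [Pi.add_apply]; omega
    · rw [C.lg_mul _ _ (left_ne_zero_of_mul h0) (right_ne_zero_of_mul h0), hx, hz, lin_add]
    · rw [C'.lg_mul _ _ (left_ne_zero_of_mul h0') (right_ne_zero_of_mul h0'), hy, hw, lin_add]

theorem inv {R : ℕ} {x : M} {y : M'} (h : TermRel C C' R a b x y) :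
    TermRel C C' R a b x⁻¹ y⁻¹ := by
  obtain ⟨h1, k, hk, hx, hy⟩ := h
  refine ⟨by rw [C.sgn_inv, C'.sgn_inv, h1], -k, fun i => by simpa using hk i, ?_, ?_⟩
  · rw [C.lg_inv, hx, lin_neg]
  · rw [C'.lg_inv, hy, lin_neg]

variable [IsOrderedAddMonoid P] [IsOrderedAddMonoid P']

theorem eq_iff {R S T : ℕ} {x z : M} {y w : M'} (hab : ESim C C' T a b) (hT : R + S ≤ T)
    (h : TermRel C C' R a b x y) (h' : TermRel C C' S a b z w) : x = z ↔ y = w := by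
  obtain ⟨h1, k, hk, hx, hy⟩ := h
  obtain ⟨h2, l, hl, hz, hw⟩ := h'
  have hkl : ∀ i, ((k - l) i).natAbs ≤ T := fun i => by
    have := hk i
    have := hl i
    simp only [Pi.sub_apply]; omega
  have h3 : C.lg x = C.lg z ↔ C'.lg y = C'.lg w := by
    rw [← sub_eq_zero, ← sub_eq_zero (b := C'.lg w), hx, hy, hz, hw, ← lin_sub, ← lin_sub]
    exact hab.sim.eq_zero hkl
  constructor
  · rintro rfl
    exact C'.ext _ _ (h1.symm.trans h2) (h3.1 rfl)
  · rintro rfl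
    exact C.ext _ _ (h1.trans h2.symm) (h3.2 rfl)

theorem lt_iff {R S T : ℕ} {x z : M} {y w : M'} (hab : ESim C C' T a b) (hT : R + S ≤ T)
    (h : TermRel C C' R a b x y) (h' : TermRel C C' S a b z w) : x < z ↔ y < w := by
  obtain ⟨h1, k, hk, hx, hy⟩ := h
  obtain ⟨h2, l, hl, hz, hw⟩ := h'
  have hkl : ∀ i, ((l - k) i).natAbs ≤ T := fun i => by
    have := hk i
    have := hl i
    simp only [Pi.sub_apply]; omega
  rw [C.lt_iff, C'.lt_iff, hx, hy, hz, hw, ← lin_sub, ← lin_sub, h1, h2]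
  refine or_congr Iff.rfl (and_congr_right fun _ => ?_)
  cases C'.sgn y
  · simp
  · simpa using hab.sim.neg hkl
  · simpa using hab.sim.pos _ hkl

theorem exists_pow_iff {R m : ℕ} (hCC : SameSigns C C') {x : M} {y : M'} (hab : ESim C C' m a b)
    (hm : m ≠ 0) (h : TermRel C C' R a b x y) : (∃ z, x = z ^ m) ↔ ∃ z, y = z ^ m := by
  rw [C.exists_pow_iff _ hm, C'.exists_pow_iff _ hm, h.sgn]
  obtain ⟨h1, k, hk, hx, hy⟩ := h
  refine and_congr ?_ ?_
  · constructor
    · rintro ⟨z, hz⟩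
      obtain ⟨z', hz'⟩ := (hCC _).1 ⟨z, rfl⟩
      exact ⟨z', hz'.symm ▸ hz⟩
    · rintro ⟨z, hz⟩
      obtain ⟨z', hz'⟩ := (hCC _).2 ⟨z, rfl⟩
      exact ⟨z', hz'.symm ▸ hz⟩
  · rw [hx, hy]
    exact hab.sim.dvd_of_dvd (by exact_mod_cast Nat.dvd_factorial (Nat.pos_of_ne_zero hm) le_rfl) k

end TermRel

/-- The symbols of `L` are compatible with the charts. -/
structure Compatible (L : FirstOrder.Language.{0, 0}) [L.Structure M] [L.Structure M']
    (C : Chart M P) (C' : Chart M' P') : Prop where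
  -- `S` may depend on the symbol and on `R`, but not on the tuples or their length.
  func : ∀ {l : ℕ} (f : L.Functions l) (R : ℕ), ∃ S, ∀ {n : ℕ} {a : Fin n → M} {b : Fin n → M'}
    {xs : Fin l → M} {ys : Fin l → M'}, (∀ i, TermRel C C' R a b (xs i) (ys i)) →
      TermRel C C' S a b (Structure.funMap f xs) (Structure.funMap f ys)
  rel : ∀ {l : ℕ} (r : L.Relations l) (R : ℕ), ∃ S, ∀ {n : ℕ} {a : Fin n → M} {b : Fin n → M'}
    {xs : Fin l → M} {ys : Fin l → M'}, ESim C C' S a b →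
      (∀ i, TermRel C C' R a b (xs i) (ys i)) →
      (Structure.RelMap r xs ↔ Structure.RelMap r ys)

theorem Compatible.term {L : FirstOrder.Language.{0, 0}} [L.Structure M] [L.Structure M']
    (hL : Compatible L C C') {n : ℕ} (t : L.Term (Empty ⊕ Fin n)) :
    ∃ S, ∀ {a : Fin n → M} {b : Fin n → M'}, (∀ i, C.sgn (a i) = C'.sgn (b i)) →
      TermRel C C' S a b (t.realize (Sum.elim default a)) (t.realize (Sum.elim default b)) := by
  induction t with
  | var x =>
    rcases x with x | i
    · exact x.elim
    · exact ⟨1, fun hs => TermRel.var (hs i)⟩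
  | func f ts ih =>
    choose S hS using ih
    obtain ⟨T, hT⟩ := hL.func f (Finset.univ.sup S)
    exact ⟨T, fun hs => hT fun i => (hS i hs).mono (Finset.le_sup (Finset.mem_univ i))⟩

variable [IsOrderedAddMonoid P] [IsOrderedAddMonoid P']

theorem ESim.mono {R S n : ℕ} {a : Fin n → M} {b : Fin n → M'} (hRS : R ≤ S)
    (h : ESim C C' S a b) : ESim C C' R a b := ⟨h.sgn, h.sim.mono hRS⟩

theorem ESim.extend {R n : ℕ} (hCC : SameSigns C C') (hR : 1 ≤ R) {a : Fin n → M} {b : Fin n → M'}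
    (hab : ESim C C' (simStep R) a b) {h : P' → ℕ} {F : ℕ → ℕ} (hh : HeightBound P' h F) {B : ℕ}
    (hB : 1 ≤ B) (hb : ∀ i, h (C'.lg (b i)) ≤ B) (c : M) :
    ∃ c' : M', h (C'.lg c') ≤ simBound F n R B ∧
      ESim C C' R (Fin.snoc a c : Fin (n + 1) → M) (Fin.snoc b c' : Fin (n + 1) → M') := by
  obtain ⟨p, hp, hs⟩ := hab.sim.extend hR hh hB hb (C.lg c)
  obtain ⟨y, hy⟩ := (hCC (C.sgn c)).1 ⟨c, rfl⟩
  obtain ⟨c', hc', hcp⟩ : ∃ c' : M', C'.sgn c' = C.sgn c ∧ C'.lg c' = p := by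
    by_cases h0 : C.sgn c = 0
    · refine ⟨y, hy, ?_⟩
      rw [C'.lg_zero y (hy.trans h0)]
      -- The sign of `c` leaves no choice of logarithm here. Similarity applied to the form "last
      -- coordinate", admissible since 1 ≤ R, shows that `p` is 0 as required.
      have := hs.eq_zero (k := Pi.single (Fin.last n) 1) (fun i => by
        by_cases hi : i = Fin.last n
        · subst hi; simpa using hR
        · simp [hi])
      rw [lin_single, lin_single, Fin.snoc_last, Fin.snoc_last] at this
      exact (this.1 (C.lg_zero c h0)).symm
    · obtain ⟨c', h1, h2⟩ := C'.surj y p (by rwa [hy])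
      exact ⟨c', h1.trans hy, h2⟩
  refine ⟨c', hcp ▸ hp, fun i => ?_, ?_⟩
  · refine Fin.lastCases ?_ (fun j => ?_) i
    · simpa using hc'.symm
    · simpa using hab.sgn j
  · rw [Fin.comp_snoc, Fin.comp_snoc, hcp]
    exact hs

/-! ### Back-and-forth along the structure of formulas -/

section EF

variable {L : FirstOrder.Language.{0, 0}} [L.Structure M] [L.Structure M']

/-- Sufficiently similar tuples satisfy the same formula. -/
theorem Compatible.realize_iff (hL : Compatible L C C') (hCC : SameSigns C C')
    {h : P → ℕ} {F : ℕ → ℕ} (hh : HeightBound P h F)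
    {h' : P' → ℕ} {F' : ℕ → ℕ} (hh' : HeightBound P' h' F')
    {n : ℕ} (φ : L.BoundedFormula Empty n) :
    ∃ R, ∀ {a : Fin n → M} {b : Fin n → M'}, ESim C C' R a b →
      (φ.Realize default a ↔ φ.Realize default b) := by
  induction φ with
  | falsum => exact ⟨0, fun _ => Iff.rfl⟩
  | equal t s =>
    obtain ⟨R, hR⟩ := hL.term t
    obtain ⟨S, hS⟩ := hL.term s
    exact ⟨R + S, fun hab => (hR hab.sgn).eq_iff hab le_rfl (hS hab.sgn)⟩
  | rel r ts =>
    choose S hS using fun i => hL.term (ts i)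
    obtain ⟨T, hT⟩ := hL.rel r (Finset.univ.sup S)
    exact ⟨T, fun hab => hT hab fun i =>
      (hS i hab.sgn).mono (Finset.le_sup (Finset.mem_univ i))⟩
  | imp φ ψ ih₁ ih₂ =>
    obtain ⟨R, hR⟩ := ih₁
    obtain ⟨S, hS⟩ := ih₂
    refine ⟨max R S, fun hab => ?_⟩
    rw [BoundedFormula.realize_imp, BoundedFormula.realize_imp,
      hR (hab.mono (le_max_left _ _)), hS (hab.mono (le_max_right _ _))]
  | @all n φ ih =>
    obtain ⟨R, hR⟩ := ih
    -- The extension lemma needs a positive parameter, hence R + 1. The height bound on the new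
    -- point is discarded: for equivalence its existence is enough.
    refine ⟨simStep (R + 1), fun {a b} hab => ?_⟩
    rw [BoundedFormula.realize_all, BoundedFormula.realize_all]
    constructor
    · intro hφ c
      obtain ⟨c', -, hc⟩ := hab.symm.extend hCC.symm (by omega) hh
        (B := 1 + Finset.univ.sup fun i => h (C.lg (a i))) (by omega) (fun i =>
          (Finset.le_sup (f := fun i => h (C.lg (a i))) (Finset.mem_univ i)).trans
            (Nat.le_add_left _ _)) c
      exact (hR (hc.symm.mono (by omega))).1 (hφ c')
    · intro hφ c
      obtain ⟨c', -, hc⟩ := hab.extend hCC (by omega) hh'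
        (B := 1 + Finset.univ.sup fun i => h' (C'.lg (b i))) (by omega) (fun i =>
          (Finset.le_sup (f := fun i => h' (C'.lg (b i))) (Finset.mem_univ i)).trans
            (Nat.le_add_left _ _)) c
      exact (hR (hc.mono (by omega))).2 (hφ c')

theorem Compatible.sentence_iff (hL : Compatible L C C') (hCC : SameSigns C C')
    {h : P → ℕ} {F : ℕ → ℕ} (hh : HeightBound P h F)
    {h' : P' → ℕ} {F' : ℕ → ℕ} (hh' : HeightBound P' h' F') (φ : L.Sentence) :
    M ⊨ φ ↔ M' ⊨ φ := by
  obtain ⟨R, hR⟩ := hL.realize_iff hCC hh hh' φ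
  have := hR (ESim.nil R default default)
  exact this

end EF

end Two

end Chart

/-! ### Regularly dense groups with infinite indices -/

/-- A failure M ∣ t y + lin k b with M ∤ t can be normalized to t = g = gcd(t, M) and coefficients
modulo `M`. Dividing by g turns it into M/g ∣ y + x with x = lin k b / g. There are finitely many
such conditions, each with M/g > 1, and the non-covering hypothesis avoids them all. -/
theorem exists_generic {P : Type} [AddCommGroup P] [IsAddTorsionFree P]
    (hindex : ∀ (q : ℕ) (m : Fin q → ℕ) (x : Fin q → P), (∀ j, 1 < m j) →
      ∃ y, ∀ j, ¬ Divides (m j : ℤ) (y + x j))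
    {n : ℕ} (b : Fin n → P) {M : ℕ} (hM : 1 ≤ M) :
    ∃ y, ∀ (t : ℤ) (k : Fin n → ℤ), Divides (M : ℤ) (t • y + lin k b) → (M : ℤ) ∣ t := by
  classical
  let J := Fin (M + 1) × (Fin n → Fin M)
  let kk : J → Fin n → ℤ := fun p i => ((p.2 i : ℕ) : ℤ)
  -- The value 2 and, below, the value 0 are dummies for indices that do not describe a possible
  -- failure.
  let mm : J → ℕ := fun p => if 1 < M / p.1 then M / p.1 else 2
  let xx : J → P := fun p =>
    if h : Divides ((p.1 : ℕ) : ℤ) (lin (kk p) b) then h.choose else 0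
  let e := Fintype.equivFin J
  obtain ⟨y, hy⟩ := hindex (Fintype.card J) (mm ∘ e.symm) (xx ∘ e.symm) (fun j => by
    simp only [mm, Function.comp]; split_ifs <;> omega)
  refine ⟨y, fun t k htk => ?_⟩
  by_contra hMt
  have hM0 : (M : ℤ) ≠ 0 := by positivity
  set g := Int.gcd t M with hg
  have hgM : g ∣ M := by exact_mod_cast Int.gcd_dvd_right t (M : ℤ)
  obtain ⟨d, hd⟩ := hgM
  have hg0 : 0 < g := Nat.pos_of_ne_zero (by rintro h0; simp [h0] at hd; omega)
  have hd1 : 1 < d := by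
    rcases Nat.lt_or_ge 1 d with h | h
    · exact h
    · exfalso
      have : d ≠ 0 := by rintro rfl; simp at hd; omega
      have hd' : d = 1 := by omega
      rw [hd', mul_one] at hd
      exact hMt (hd ▸ Int.gcd_dvd_left t (M : ℤ))
  have hbez := Int.gcd_eq_gcd_ab t M
  set u := Int.gcdA t M
  set v := Int.gcdB t M
  rw [← hg] at hbez
  set k' : Fin n → ℤ := fun i => (u • k) i % M with hk'
  -- Bézout: multiply the relation by u, where g = t u + M v, and add a multiple of `M`.
  have h1 : Divides (M : ℤ) ((g : ℤ) • y + lin k' b) := by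
    have h2 := (htk.smul u).sub (divides_lin_emod (M : ℤ) (u • k) b)
    have h3 := h2.add (divides_smul_self (M : ℤ) (v • y))
    convert h3 using 1
    rw [hbez, lin_smul, smul_add, add_zsmul, mul_comm t, mul_zsmul, mul_zsmul]
    abel
  have hgMlt : g < M + 1 := by
    have := Nat.le_of_dvd hM ⟨d, hd⟩; omega
  let p : J := (⟨g, hgMlt⟩, fun i => ⟨(k' i).toNat, by
    have h1 := Int.emod_nonneg ((u • k) i) hM0
    have h2 := Int.emod_lt_of_pos ((u • k) i) (by positivity : (0 : ℤ) < M)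
    simp only [hk']; omega⟩)
  have hkp : kk p = k' := by
    funext i
    have h1 := Int.emod_nonneg ((u • k) i) hM0
    simp only [kk, p, hk']; omega
  have hmp : mm p = d := by
    have : M / g = d := by rw [hd, Nat.mul_div_cancel_left _ hg0]
    simp only [mm, p, this, if_pos hd1]
  have hdiv : Divides ((p.1 : ℕ) : ℤ) (lin (kk p) b) := by
    rw [hkp]
    have h2 := (h1.of_dvd ⟨(d : ℤ), by exact_mod_cast hd⟩ : Divides (g : ℤ) _)
    exact (divides_smul_self (g : ℤ) y).add_iff.1 h2
  have hxp : lin k' b = (g : ℤ) • xx p := by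
    have : xx p = hdiv.choose := dif_pos hdiv
    rw [this, ← hkp]
    exact hdiv.choose_spec
  have := hy (e p)
  simp only [Function.comp, Equiv.symm_apply_apply, hmp] at this
  refine this ((divides_mul_smul (by positivity : (g : ℤ) ≠ 0) _ _).1 ?_)
  rw [smul_add, ← hxp]
  exact_mod_cast hd ▸ h1

/-- A regularly dense group with infinite indices. -/
theorem HeightBound.trivial {P : Type} [AddCommGroup P] [LinearOrder P] [IsOrderedAddMonoid P]
    [Nontrivial P]
    (hdense : ∀ (n : ℕ) (x z : P), 1 ≤ n → x < z → ∃ y, x < (n : ℤ) • y ∧ (n : ℤ) • y < z)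
    (hindex : ∀ (q : ℕ) (m : Fin q → ℕ) (x : Fin q → P), (∀ j, 1 < m j) →
      ∃ y, ∀ j, ¬ Divides (m j : ℤ) (y + x j)) :
    HeightBound P (fun _ => 1) (fun _ => 1) where
  -- With constant heights every bound is void, and only the existence of the witnesses remains.
  one_le _ := le_rfl
  zero := le_rfl
  add _ _ := le_rfl
  neg _ := rfl
  root _ _ _ := le_rfl
  pos := by
    obtain ⟨e, he⟩ := exists_zero_lt (α := P)
    exact ⟨e, he, le_rfl⟩
  dense n B x z hn _ _ _ hxz := by
    obtain ⟨y, hy⟩ := hdense n x z hn hxz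
    exact ⟨y, le_rfl, hy⟩
  generic b B M hM _ := by
    obtain ⟨y, hy⟩ := exists_generic hindex b hM
    exact ⟨y, le_rfl, hy⟩

/-! ### Truth of the axioms -/

section Axioms

variable {L : FirstOrder.Language.{0, 0}} {M : Type} [L.Structure M]

theorem realize_axO1 (lt : L.Relations 2) : M ⊨ axO1 lt ↔
    ∀ x y : M, Structure.RelMap lt ![x, y] → ¬ Structure.RelMap lt ![y, x] := by
  simp [axO1, Sentence.Realize, Formula.Realize, Fin.snoc]

theorem realize_axO2 (lt : L.Relations 2) : M ⊨ axO2 lt ↔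
    ∀ x y z : M, Structure.RelMap lt ![x, y] → Structure.RelMap lt ![y, z] →
      Structure.RelMap lt ![x, z] := by
  simp [axO2, Sentence.Realize, Formula.Realize, Fin.snoc]

theorem realize_axO3 (lt : L.Relations 2) : M ⊨ axO3 lt ↔
    ∀ x y : M, Structure.RelMap lt ![x, y] ∨ x = y ∨ Structure.RelMap lt ![y, x] := by
  simp [axO3, Sentence.Realize, Formula.Realize, Fin.snoc]

theorem realize_axM1 (mul : L.Functions 2) : M ⊨ axM1 mul ↔
    ∀ x y z : M, Structure.funMap mul ![x, Structure.funMap mul ![y, z] ] =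
      Structure.funMap mul ![Structure.funMap mul ![x, y], z] := by
  simp [axM1, Sentence.Realize, Formula.Realize, Fin.snoc]

theorem realize_axM2 (mul : L.Functions 2) (one : L.Constants) : M ⊨ axM2 mul one ↔
    ∀ x : M, Structure.funMap mul ![x, (one : M)] = x := by
  simp [axM2, Sentence.Realize, Formula.Realize, Fin.snoc]

theorem realize_axM3 (mul : L.Functions 2) (inv : L.Functions 1) (one : L.Constants) :
    M ⊨ axM3 mul inv one ↔
    ∀ x : M, Structure.funMap mul ![x, Structure.funMap inv ![x] ] = (one : M) := by
  simp [axM3, Sentence.Realize, Formula.Realize, Fin.snoc]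

theorem realize_axM4 (mul : L.Functions 2) : M ⊨ axM4 mul ↔
    ∀ x y : M, Structure.funMap mul ![x, y] = Structure.funMap mul ![y, x] := by
  simp [axM4, Sentence.Realize, Formula.Realize, Fin.snoc]

theorem realize_axM5 (lt : L.Relations 2) (mul : L.Functions 2) : M ⊨ axM5 lt mul ↔
    ∀ x y z : M, Structure.RelMap lt ![x, y] →
      Structure.RelMap lt ![Structure.funMap mul ![x, z], Structure.funMap mul ![y, z] ] := by
  simp [axM5, Sentence.Realize, Formula.Realize, Fin.snoc]

theorem realize_axM6 (one : L.Constants) : M ⊨ axM6 one ↔ ∃ y : M, y ≠ (one : M) := by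
  simp [axM6, Sentence.Realize, Formula.Realize, Fin.snoc]

theorem realize_axM2' (mul : L.Functions 2) (inv : L.Functions 1) (zero one : L.Constants) :
    M ⊨ axM2' mul inv zero one ↔
    ∀ x : M, Structure.funMap mul ![x, (one : M)] = x ∧
      Structure.funMap mul ![x, (zero : M)] = (zero : M) ∧
      (zero : M) = Structure.funMap inv ![(zero : M)] := by
  simp [axM2', Sentence.Realize, Formula.Realize, Fin.snoc]

theorem realize_axM3' (mul : L.Functions 2) (inv : L.Functions 1) (zero one : L.Constants) :
    M ⊨ axM3' mul inv zero one ↔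
    ∀ x : M, x ≠ (zero : M) →
      Structure.funMap mul ![x, Structure.funMap inv ![x] ] = (one : M) := by
  simp [axM3', Sentence.Realize, Formula.Realize, Fin.snoc]

theorem realize_axM5pos (lt : L.Relations 2) (mul : L.Functions 2) (zero : L.Constants) :
    M ⊨ axM5pos lt mul zero ↔
    ∀ x y z : M, Structure.RelMap lt ![x, y] → Structure.RelMap lt ![(zero : M), z] →
      Structure.RelMap lt ![Structure.funMap mul ![x, z], Structure.funMap mul ![y, z] ] := by
  simp [axM5pos, Sentence.Realize, Formula.Realize, Fin.snoc]

theorem realize_axM5neg (lt : L.Relations 2) (mul : L.Functions 2) (zero : L.Constants) :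
    M ⊨ axM5neg lt mul zero ↔
    ∀ x y z : M, Structure.RelMap lt ![x, y] → Structure.RelMap lt ![z, (zero : M)] →
      Structure.RelMap lt ![Structure.funMap mul ![y, z], Structure.funMap mul ![x, z] ] := by
  simp [axM5neg, Sentence.Realize, Formula.Realize, Fin.snoc]

theorem realize_axM6' (lt : L.Relations 2) (negOne zero one : L.Constants) :
    M ⊨ axM6' lt negOne zero one ↔
    ∃ y : M, Structure.RelMap lt ![(negOne : M), (zero : M)] ∧
      Structure.RelMap lt ![(zero : M), (one : M)] ∧ Structure.RelMap lt ![(one : M), y] := by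
  simp [axM6', Sentence.Realize, Formula.Realize, Fin.snoc]

variable [Monoid M] {mul : L.Functions 2}

/-- The condition 1 ≤ n cannot be dropped, since `powTerm mul t 0` is `t` and not the unit. -/
theorem realize_powTerm (hmul : ∀ x y : M, Structure.funMap mul ![x, y] = x * y) {α : Type}
    (t : L.Term α) (v : α → M) {n : ℕ} (hn : 1 ≤ n) :
    (powTerm mul t n).realize v = t.realize v ^ n := by
  obtain ⟨m, rfl⟩ := Nat.exists_eq_add_of_le' hn
  rw [powTerm, Nat.add_sub_cancel]
  clear hn
  induction m with
  | zero => simp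
  | succ m ih =>
    rw [Function.iterate_succ_apply', Term.realize_functions_apply₂, ih, hmul, pow_succ _ (m + 1)]

theorem realize_axM8 (hmul : ∀ x y : M, Structure.funMap mul ![x, y] = x * y)
    (negOne one : L.Constants) {n : ℕ} (hn : 1 ≤ n) :
    M ⊨ axM8 mul negOne one n ↔
    ∀ x : M, x ^ (2 * n) = (one : M) ↔ x = (one : M) ∨ x = (negOne : M) := by
  have h2n : 1 ≤ 2 * n := by omega
  simp [axM8, Sentence.Realize, Formula.Realize, Fin.snoc, realize_powTerm hmul _ _ h2n]

theorem realize_axM10 (hmul : ∀ x y : M, Structure.funMap mul ![x, y] = x * y)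
    (lt : L.Relations 2) {n : ℕ} (hn : 1 ≤ n) :
    M ⊨ axM10 lt mul n ↔
    ∀ x z : M, ∃ y, Structure.RelMap lt ![x, z] →
      Structure.RelMap lt ![x, y ^ n] ∧ Structure.RelMap lt ![y ^ n, z] := by
  simp [axM10, Sentence.Realize, Formula.Realize, Fin.snoc, realize_powTerm hmul _ _ hn]

theorem realize_axM10' (hmul : ∀ x y : M, Structure.funMap mul ![x, y] = x * y)
    (lt : L.Relations 2) (zero : L.Constants) {n : ℕ} (hn : 1 ≤ n) :
    M ⊨ axM10' lt mul zero n ↔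
    ∀ x z : M, ∃ y, Structure.RelMap lt ![(zero : M), x] → Structure.RelMap lt ![x, z] →
      Structure.RelMap lt ![x, y ^ n] ∧ Structure.RelMap lt ![y ^ n, z] := by
  simp [axM10', Sentence.Realize, Formula.Realize, Fin.snoc, realize_powTerm hmul _ _ hn]

theorem realize_notPowers (hmul : ∀ x y : M, Structure.funMap mul ![x, y] = x * y)
    {n : ℕ} (hn : 1 ≤ n) {q : ℕ} {m : Fin q → ℕ} (hm : ∀ j, 1 < m j) (x : Fin q → M) (y z : M) :
    (notPowers mul n m).Realize default (Fin.snoc (Fin.snoc x y : Fin (q + 1) → M) z) ↔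
    ∀ j, ¬ m j ∣ n → y ^ n * x j ≠ z ^ m j := by
  have h0 : (Fin.snoc (Fin.snoc x y : Fin (q + 1) → M) z : Fin (q + 2) → M) (Fin.natAdd q (0 : Fin 2)) = y := by
    rw [show Fin.natAdd q (0 : Fin 2) = (Fin.last q).castSucc from rfl, Fin.snoc_castSucc,
      Fin.snoc_last]
  have h1 : (Fin.snoc (Fin.snoc x y : Fin (q + 1) → M) z : Fin (q + 2) → M) (Fin.natAdd q (1 : Fin 2)) = z := by
    rw [show Fin.natAdd q (1 : Fin 2) = Fin.last (q + 1) from rfl, Fin.snoc_last]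
  have h2 : ∀ j, (Fin.snoc (Fin.snoc x y : Fin (q + 1) → M) z : Fin (q + 2) → M)
      (Fin.castAdd 2 j) = x j := fun j => by
    rw [show Fin.castAdd 2 j = j.castSucc.castSucc from rfl, Fin.snoc_castSucc,
      Fin.snoc_castSucc]
  rw [notPowers, BoundedFormula.realize_iInf, Subtype.forall]
  refine forall₂_congr fun j _ => ?_
  simp only [BoundedFormula.realize_not, BoundedFormula.realize_bdEqual,
    Term.realize_functions_apply₂, realize_powTerm hmul _ _ hn,
    realize_powTerm hmul _ _ (hm j).le, hmul, Function.comp_apply, Term.realize_var, Sum.elim_inr, h0,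
    h1, h2, ne_eq]

theorem realize_axM11 (hmul : ∀ x y : M, Structure.funMap mul ![x, y] = x * y)
    {n : ℕ} (hn : 1 ≤ n) {q : ℕ} {m : Fin q → ℕ} (hm : ∀ j, 1 < m j) :
    M ⊨ axM11 mul n m ↔
    ∀ x : Fin q → M, ∃ y, ∀ z, ∀ j, ¬ m j ∣ n → y ^ n * x j ≠ z ^ m j := by
  rw [axM11, Sentence.Realize, BoundedFormula.realize_alls]
  simp only [BoundedFormula.realize_ex, BoundedFormula.realize_all, realize_notPowers hmul hn hm]

theorem realize_axM11' (hmul : ∀ x y : M, Structure.funMap mul ![x, y] = x * y)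
    (zero : L.Constants) {n : ℕ} (hn : 1 ≤ n) {q : ℕ} {m : Fin q → ℕ} (hm : ∀ j, 1 < m j) :
    M ⊨ axM11' mul zero n m ↔
    ∀ x : Fin q → M, ∃ y, ∀ z, (∀ j, x j ≠ (zero : M)) →
      ∀ j, ¬ m j ∣ n → y ^ n * x j ≠ z ^ m j := by
  rw [axM11', Sentence.Realize, BoundedFormula.realize_alls]
  have h2 : ∀ (x : Fin q → M) y z j, (Fin.snoc (Fin.snoc x y : Fin (q + 1) → M) z : Fin (q + 2) → M)
      (Fin.castAdd 2 j) = x j := fun x y z j => by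
    rw [show Fin.castAdd 2 j = j.castSucc.castSucc from rfl, Fin.snoc_castSucc,
      Fin.snoc_castSucc]
  simp only [BoundedFormula.realize_ex, BoundedFormula.realize_all, BoundedFormula.realize_imp,
    BoundedFormula.realize_iInf, realize_notPowers hmul hn hm, BoundedFormula.realize_not,
    BoundedFormula.realize_bdEqual, Function.comp_apply, Term.realize_var, Sum.elim_inr, h2,
    Term.realize_constants, ne_eq]

end Axioms

/-! ### Models of `TQ` -/

/-- The symbol `×` of `langGroup`. -/
abbrev gMul : langGroup.Functions 2 := GroupFunc.mul

/-- The symbol `⁻¹` of `langGroup`. -/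
abbrev gInv : langGroup.Functions 1 := GroupFunc.inv

/-- The symbol `1` of `langGroup`. -/
abbrev gOne : langGroup.Constants := GroupFunc.one

/-- The symbol `<` of `langGroup`. -/
abbrev gLt : langGroup.Relations 2 := LtRel.lt

/-- The symbols of `langGroup` are interpreted by the operations of `G`. -/
structure GroupInterp (G : Type) [CommGroup G] [LT G] [langGroup.Structure G] : Prop where
  mul : ∀ x y : G, Structure.funMap gMul ![x, y] = x * y
  inv : ∀ x : G, Structure.funMap gInv ![x] = x⁻¹
  one : ((gOne : langGroup.Constants) : G) = 1
  lt : ∀ x y : G, Structure.RelMap gLt ![x, y] ↔ x < y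

/-- In an ordered group all elements are positive. -/
def groupChart (G : Type) [CommGroup G] [LinearOrder G] [IsOrderedMonoid G] :
    Chart G (Additive G) where
  sgn _ := 1
  lg := Additive.ofMul
  sgn_one := rfl
  sgn_mul _ _ := rfl
  sgn_inv _ := rfl
  lg_mul _ _ _ _ := rfl
  lg_zero _ h := absurd h (by decide)
  lg_inv _ := rfl
  lt_iff x y := by
    simp only [lt_self_iff_false, true_and, false_or, SignType.coe_one, one_zsmul, sub_pos]
    exact Iff.rfl
  ext _ _ _ h := h
  surj _ p _ := ⟨p.toMul, rfl, rfl⟩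

theorem groupChart_sameSigns (G H : Type) [CommGroup G] [LinearOrder G] [IsOrderedMonoid G]
    [CommGroup H] [LinearOrder H] [IsOrderedMonoid H] :
    Chart.SameSigns (groupChart G) (groupChart H) := fun _ =>
  ⟨fun ⟨_, hx⟩ => ⟨1, hx⟩, fun ⟨_, hx⟩ => ⟨1, hx⟩⟩

theorem GroupInterp.compatible {G H : Type} [CommGroup G] [LinearOrder G] [IsOrderedMonoid G]
    [CommGroup H] [LinearOrder H] [IsOrderedMonoid H] [langGroup.Structure G]
    [langGroup.Structure H] (hG : GroupInterp G) (hH : GroupInterp H) :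
    Chart.Compatible langGroup (groupChart G) (groupChart H) where
  func := by
    intro l f R
    cases f with
    | mul =>
      refine ⟨R + R, fun {n a b xs ys} h => ?_⟩
      rw [← FinVec.etaExpand_eq xs, ← FinVec.etaExpand_eq ys]
      change Chart.TermRel _ _ _ _ _ (Structure.funMap gMul
        ![xs 0, xs 1]) (Structure.funMap gMul ![ys 0, ys 1])
      rw [hG.mul, hH.mul]
      exact (h 0).mul (h 1)
    | inv =>
      refine ⟨R, fun {n a b xs ys} h => ?_⟩
      rw [← FinVec.etaExpand_eq xs, ← FinVec.etaExpand_eq ys]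
      change Chart.TermRel _ _ _ _ _ (Structure.funMap gInv
        ![xs 0]) (Structure.funMap gInv ![ys 0])
      rw [hG.inv, hH.inv]
      exact (h 0).inv
    | one =>
      refine ⟨0, fun {n a b xs ys} h => ?_⟩
      have h1 : Structure.funMap gOne xs = (1 : G) := by
        rw [← hG.one, ← funMap_eq_coe_constants, Subsingleton.elim xs default]
      have h2 : Structure.funMap gOne ys = (1 : H) := by
        rw [← hH.one, ← funMap_eq_coe_constants, Subsingleton.elim ys default]
      change Chart.TermRel _ _ _ _ _ (Structure.funMap gOne xs)
        (Structure.funMap gOne ys)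
      rw [h1, h2]
      exact Chart.TermRel.one
  rel := by
    intro l r R
    cases r with
    | lt =>
      refine ⟨R + R, fun {n a b xs ys} hab h => ?_⟩
      rw [← FinVec.etaExpand_eq xs, ← FinVec.etaExpand_eq ys]
      change Structure.RelMap gLt ![xs 0, xs 1] ↔
        Structure.RelMap gLt ![ys 0, ys 1]
      rw [hG.lt, hH.lt]
      exact (h 0).lt_iff hab le_rfl (h 1)

/-- The ordered groups that are models of `TQ`. -/
theorem GroupInterp.model_iff {G : Type} [CommGroup G] [LinearOrder G] [IsOrderedMonoid G]
    [langGroup.Structure G] (hG : GroupInterp G) :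
    G ⊨ TQ ↔ (∃ y : G, y ≠ 1) ∧ (∀ n : ℕ, 1 ≤ n → ∀ x z : G, ∃ y, x < z → x < y ^ n ∧ y ^ n < z) ∧
      ∀ n : ℕ, 1 ≤ n → ∀ (q : ℕ) (m : Fin q → ℕ), (∀ j, 1 < m j) →
        ∀ x : Fin q → G, ∃ y, ∀ z, ∀ j, ¬ m j ∣ n → y ^ n * x j ≠ z ^ m j := by
  have h10 : ∀ n : ℕ, 1 ≤ n → (G ⊨ axM10 gLt
      gMul n ↔
      ∀ x z : G, ∃ y, x < z → x < y ^ n ∧ y ^ n < z) := fun n hn => by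
    rw [realize_axM10 hG.mul _ hn]
    simp only [hG.lt]
  have h11 := fun (n : ℕ) (hn : 1 ≤ n) (q : ℕ) (m : Fin q → ℕ) (hm : ∀ j, 1 < m j) =>
    realize_axM11 hG.mul hn hm
  rw [Theory.model_iff]
  constructor
  · intro h
    refine ⟨?_, fun n hn => ?_, fun n hn q m hm => ?_⟩
    · have := (realize_axM6 _).1 (h (axM6 gOne)
        (Or.inl (Or.inl (by simp))))
      rwa [hG.one] at this
    · exact (h10 n hn).1 (h _ (Or.inl (Or.inr ⟨n, hn, rfl⟩)))
    · exact (h11 n hn q m hm).1 (h _ (Or.inr ⟨n, hn, q, m, hm, rfl⟩))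
  · rintro ⟨h6, hd, hi⟩ φ ((hφ | ⟨n, hn, rfl⟩) | ⟨n, hn, q, m, hm, rfl⟩)
    · simp only [Set.mem_insert_iff, Set.mem_singleton_iff] at hφ
      rcases hφ with rfl | rfl | rfl | rfl | rfl | rfl | rfl | rfl | rfl
      · refine (realize_axO1 gLt).2 ?_; simp only [hG.lt]; exact fun x y h => h.asymm
      · refine (realize_axO2 gLt).2 ?_; simp only [hG.lt]; exact fun x y z => lt_trans
      · refine (realize_axO3 gLt).2 ?_; simp only [hG.lt]; exact lt_trichotomy
      · refine (realize_axM1 gMul).2 ?_; simp only [hG.mul]; exact fun x y z => (mul_assoc _ _ _).symm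
      · refine (realize_axM2 gMul gOne).2 ?_; simp only [hG.mul, hG.one]; exact mul_one
      · refine (realize_axM3 gMul gInv gOne).2 ?_; simp only [hG.mul, hG.one, hG.inv]; exact mul_inv_cancel
      · refine (realize_axM4 gMul).2 ?_; simp only [hG.mul]; exact mul_comm
      · refine (realize_axM5 gLt gMul).2 ?_; simp only [hG.mul, hG.lt]
        exact fun x y z h => mul_lt_mul_left h z
      · refine (realize_axM6 gOne).2 ?_; simpa only [hG.one] using h6
    · exact (h10 n hn).2 (hd n hn)
    · exact (h11 n hn q m hm).2 (hi n hn q m hm)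

/-- From the axioms (M₁₁) only the case n = 1 is used, where m ∤ 1 holds for every m > 1;
`exists_generic` obtains all multiples of `y` from it. -/
theorem GroupInterp.heightBound {G : Type} [CommGroup G] [LinearOrder G] [IsOrderedMonoid G]
    [langGroup.Structure G] (hG : GroupInterp G) (h : G ⊨ TQ) :
    HeightBound (Additive G) (fun _ => 1) (fun _ => 1) := by
  obtain ⟨⟨y, hy⟩, hd, hi⟩ := hG.model_iff.1 h
  have : Nontrivial (Additive G) := ⟨Additive.ofMul y, 0, hy⟩
  refine HeightBound.trivial (fun n x z hn hxz => ?_) fun q m x hm => ?_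
  · obtain ⟨y, hy⟩ := hd n hn x.toMul z.toMul
    refine ⟨Additive.ofMul y, ?_⟩
    rw [natCast_zsmul]
    exact hy hxz
  · obtain ⟨y, hy⟩ := hi 1 le_rfl q m hm fun j => (x j).toMul
    refine ⟨Additive.ofMul y, fun j => ?_⟩
    rintro ⟨z, hz⟩
    rw [natCast_zsmul] at hz
    refine hy z.toMul j (by have := hm j; rw [Nat.dvd_one]; omega) ?_
    rw [pow_one]
    exact hz

/-- Every model of `TQ` is an ordered group. -/
theorem exists_groupInterp (N : Type) [langGroup.Structure N] (h : N ⊨ TQ) :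
    ∃ (_ : CommGroup N) (_ : LinearOrder N), IsOrderedMonoid N ∧ GroupInterp N := by
  rw [Theory.model_iff] at h
  have hO1 := (realize_axO1 _).1 (h (axO1 gLt)
    (Or.inl (Or.inl (by simp))))
  have hO2 := (realize_axO2 _).1 (h (axO2 gLt)
    (Or.inl (Or.inl (by simp))))
  have hO3 := (realize_axO3 _).1 (h (axO3 gLt)
    (Or.inl (Or.inl (by simp))))
  have hM1 := (realize_axM1 _).1 (h (axM1 gMul)
    (Or.inl (Or.inl (by simp))))
  have hM2 := (realize_axM2 _ _).1 (h (axM2 gMul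
    gOne) (Or.inl (Or.inl (by simp))))
  have hM3 := (realize_axM3 _ _ _).1 (h (axM3 gMul
    gInv gOne)
    (Or.inl (Or.inl (by simp))))
  have hM4 := (realize_axM4 _).1 (h (axM4 gMul)
    (Or.inl (Or.inl (by simp))))
  have hM5 := (realize_axM5 _ _).1 (h (axM5 gLt
    gMul) (Or.inl (Or.inl (by simp))))
  let i₁ : CommGroup N :=
    { mul := fun x y => Structure.funMap gMul ![x, y]
      mul_assoc := fun x y z => (hM1 x y z).symm
      one := ((gOne : langGroup.Constants) : N)
      one_mul := fun x => (hM4 _ _).trans (hM2 x)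
      mul_one := hM2
      inv := fun x => Structure.funMap gInv ![x]
      inv_mul_cancel := fun x => (hM4 _ _).trans (hM3 x)
      mul_comm := hM4 }
  let r : N → N → Prop := fun x y => Structure.RelMap gLt ![x, y]
  have : IsStrictTotalOrder N r :=
    { trichotomous := fun x y h1 h2 => by
        rcases hO3 x y with h3 | h3 | h3
        · exact absurd h3 h1
        · exact h3
        · exact absurd h3 h2
      irrefl := fun x hx => hO1 x x hx hx
      trans := hO2 }
  classical
  let i₂ : LinearOrder N := linearOrderOfSTO r
  refine ⟨i₁, i₂, ?_, ⟨fun _ _ => rfl, fun _ => rfl, rfl, fun _ _ => Iff.rfl⟩⟩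
  exact
    { mul_le_mul_left := fun x y hxy z => by
        rcases hxy.lt_or_eq with h1 | rfl
        · exact (show x * z < y * z from hM5 x y z h1).le
        · exact le_rfl }

/-! ### Heights and approximation of rational numbers -/

/-- A crude mean value estimate, with K^n instead of K^(n−1) to keep the induction simple. It
controls the step of n-th powers along a grid. -/
theorem pow_sub_pow_le_mul {n : ℕ} {u v K : ℚ} (hu : 0 ≤ u) (huv : u ≤ v) (hvK : v ≤ K)
    (hK : 1 ≤ K) : v ^ n - u ^ n ≤ n * (v - u) * K ^ n := by
  induction n with
  | zero => simp
  | succ n ih =>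
    have h1 : u ^ n ≤ K ^ (n + 1) :=
      (pow_le_pow_left₀ hu (huv.trans hvK) n).trans (pow_le_pow_right₀ hK n.le_succ)
    have h2 : 0 ≤ v - u := sub_nonneg.2 huv
    have h4 : v ^ n - u ^ n ≥ 0 := sub_nonneg.2 (pow_le_pow_left₀ hu huv n)
    calc v ^ (n + 1) - u ^ (n + 1) = v * (v ^ n - u ^ n) + (v - u) * u ^ n := by ring
      _ ≤ K * (n * (v - u) * K ^ n) + (v - u) * K ^ (n + 1) :=
        add_le_add (mul_le_mul hvK ih h4 (by linarith)) (mul_le_mul_of_nonneg_left h1 h2)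
      _ = ((n + 1 : ℕ) : ℚ) * (v - u) * K ^ (n + 1) := by push_cast; ring

/-- The height of a rational number. -/
def ratHeight (x : ℚ) : ℕ := max x.num.natAbs x.den

theorem ratHeight_div_le (j D : ℕ) (hj : j ≠ 0) (hD : D ≠ 0) : ratHeight (j / D : ℚ) ≤ max j D := by
  have h1 := Rat.num_dvd (j : ℤ) (b := (D : ℤ)) (by exact_mod_cast hD)
  have h2 := Rat.den_dvd (j : ℤ) (D : ℤ)
  rw [Rat.divInt_eq_div] at h1 h2
  rw [Int.cast_natCast, Int.cast_natCast] at h1 h2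
  refine max_le_max ?_ ?_
  · exact Nat.le_of_dvd (Nat.pos_of_ne_zero hj) (by simpa using Int.natAbs_dvd_natAbs.2 h1)
  · exact Nat.le_of_dvd (Nat.pos_of_ne_zero hD) (Int.natCast_dvd_natCast.1 h2)

/-- The bound for the heights of witnesses in the rational numbers. -/
def ratBound (B : ℕ) : ℕ := (B + 2) ^ (B + 4)

/-- Between two positive rationals there is an `n`-th power of bounded height. -/
theorem exists_pow_between {n B : ℕ} (hn : 1 ≤ n) (hnB : n ≤ B) {x z : ℚ} (hx : 0 < x)
    (hxz : x < z) (hxB : ratHeight x ≤ B) (hzB : ratHeight z ≤ B) :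
    ∃ y : ℚ, 0 < y ∧ x < y ^ n ∧ y ^ n < z ∧ ratHeight y ≤ ratBound B := by
  have hB1 : 1 ≤ B := hn.trans hnB
  have hB1' : (1 : ℚ) ≤ B := by exact_mod_cast hB1
  -- Candidates are the fractions j/D. Below B + 1 consecutive n-th powers differ by at most n
  -- (B+1)^n / D, and this `D` makes that less than 1/B².
  set D := n * (B + 1) ^ n * B ^ 2 + 1 with hD
  have hD0 : (0 : ℚ) < D := by positivity
  have hxle : x ≤ B := by
    have h1 : (x.num : ℚ) ≤ B := by
      have : x.num ≤ B := by
        have := (le_max_left _ _).trans hxB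
        omega
      exact_mod_cast this
    have h2 : x * x.den = x.num := Rat.mul_den_eq_num x
    have h3 : (1 : ℚ) ≤ x.den := by exact_mod_cast x.den_pos
    nlinarith
  -- Distinct fractions with denominators at most B differ by at least 1/B².
  have hdiff : 1 ≤ (z - x) * B ^ 2 := by
    have h1 : x * x.den = x.num := Rat.mul_den_eq_num x
    have h2 : z * z.den = z.num := Rat.mul_den_eq_num z
    have hxd : (0 : ℚ) < x.den := by exact_mod_cast x.den_pos
    have hzd : (0 : ℚ) < z.den := by exact_mod_cast z.den_pos
    have hxdB : (x.den : ℚ) ≤ B := by exact_mod_cast (le_max_right _ _).trans hxB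
    have hzdB : (z.den : ℚ) ≤ B := by exact_mod_cast (le_max_right _ _).trans hzB
    have h3 : (z - x) * (z.den * x.den) = (z.num * x.den - x.num * z.den : ℤ) := by
      push_cast; rw [← h1, ← h2]; ring
    have h4 : (0 : ℚ) < (z.num * x.den - x.num * z.den : ℤ) := by
      rw [← h3]; exact mul_pos (sub_pos.2 hxz) (mul_pos hzd hxd)
    have h5 : (1 : ℚ) ≤ (z.num * x.den - x.num * z.den : ℤ) := by exact_mod_cast h4
    rw [← h3] at h5
    refine h5.trans (mul_le_mul_of_nonneg_left ?_ (sub_pos.2 hxz).le)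
    rw [sq]
    exact mul_le_mul hzdB hxdB hxd.le (by positivity)
  have hex : ∃ j : ℕ, x < ((j : ℚ) / D) ^ n := by
    refine ⟨(B + 1) * D, ?_⟩
    have : (((B + 1) * D : ℕ) : ℚ) / D = B + 1 := by push_cast; field_simp
    rw [this]
    calc x ≤ B := hxle
      _ < B + 1 := by linarith
      _ ≤ (B + 1 : ℚ) ^ n := le_self_pow₀ (by linarith) (by omega)
  classical
  -- The first grid point whose n-th power exceeds `x`: the preceding power is at most `x`, and one
  -- step is shorter than z − x, so `z` is not reached.
  obtain ⟨j, hj, hjmin⟩ : ∃ j : ℕ, x < ((j : ℚ) / D) ^ n ∧ ∀ i < j, ¬ x < ((i : ℚ) / D) ^ n :=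
    ⟨Nat.find hex, Nat.find_spec hex, fun i hi => Nat.find_min hex hi⟩
  have hj0 : j ≠ 0 := by
    rintro rfl
    simp only [Nat.cast_zero, zero_div, zero_pow (by omega : n ≠ 0)] at hj
    exact lt_asymm hj hx
  obtain ⟨i, rfl⟩ := Nat.exists_eq_succ_of_ne_zero hj0
  have hi := not_lt.1 (hjmin i i.lt_succ_self)
  have hi0 : (0 : ℚ) ≤ (i : ℚ) / D := by positivity
  have hiB : (i : ℚ) / D ≤ B := by
    by_contra hlt
    rw [not_le] at hlt
    have h1 : (i : ℚ) / D ≤ ((i : ℚ) / D) ^ n := le_self_pow₀ (by linarith) (by omega)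
    linarith
  have hv : ((i.succ : ℕ) : ℚ) / D = i / D + 1 / D := by push_cast; ring
  have h1D : (1 : ℚ) / D ≤ 1 := by
    rw [div_le_one hD0]; exact_mod_cast Nat.le_add_left 1 _
  have hvB : ((i.succ : ℕ) : ℚ) / D ≤ B + 1 := by rw [hv]; linarith
  refine ⟨((i.succ : ℕ) : ℚ) / D, by positivity, hj, ?_, ?_⟩
  · have h1 := pow_sub_pow_le_mul (n := n) hi0 (by rw [hv]; linarith [one_div_pos.2 hD0]) hvB
      (by linarith : (1 : ℚ) ≤ B + 1)
    have h2 : ((i.succ : ℕ) : ℚ) / D - i / D = 1 / D := by rw [hv]; ring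
    rw [h2] at h1
    have h3 : (n : ℚ) * (1 / D) * (B + 1) ^ n < z - x := by
      have h4 : (n : ℚ) * (1 / D) * (B + 1) ^ n = n * (B + 1) ^ n / D := by ring
      rw [h4, div_lt_iff₀ hD0, hD]
      push_cast
      have h5 : (0 : ℚ) ≤ n * (B + 1) ^ n := by positivity
      have h6 := mul_le_mul_of_nonneg_left hdiff h5
      have h7 := sub_pos.2 hxz
      nlinarith
    linarith
  · refine (ratHeight_div_le _ _ (by omega) (by omega)).trans ?_
    have hDb : D ≤ (B + 2) ^ (B + 3) := by
      have h1 : (B + 1) ^ n ≤ (B + 2) ^ B :=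
        (Nat.pow_le_pow_left (by omega) n).trans (Nat.pow_le_pow_right (by omega) hnB)
      have h2 : 1 ≤ (B + 2) ^ B := Nat.one_le_pow _ _ (by omega)
      calc D ≤ B * (B + 2) ^ B * B ^ 2 + (B + 2) ^ B := by
            rw [hD]
            exact Nat.add_le_add (Nat.mul_le_mul_right _ (Nat.mul_le_mul hnB h1)) h2
        _ = (B + 2) ^ B * (B ^ 3 + 1) := by ring
        _ ≤ (B + 2) ^ B * (B + 2) ^ 3 := by
            refine Nat.mul_le_mul_left _ ?_
            ring_nf; omega
        _ = (B + 2) ^ (B + 3) := by rw [← pow_add]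
    have hsB : i.succ ≤ (B + 1) * D := by
      have : ((i.succ : ℕ) : ℚ) ≤ (B + 1) * D := by rwa [div_le_iff₀ hD0] at hvB
      exact_mod_cast this
    have hBD : (B + 1) * D ≤ ratBound B := by
      rw [ratBound, show B + 4 = (B + 3) + 1 from rfl, pow_succ, mul_comm (_ ^ _)]
      exact Nat.mul_le_mul (by omega) hDb
    exact max_le (hsB.trans hBD) ((Nat.le_mul_of_pos_left _ (Nat.succ_pos B)).trans hBD)

/-! ### Properties of the rational height -/

theorem padicValRat_eq_zero_of_height_lt {p : ℕ} (hp : p.Prime) {x : ℚ} (hx : x ≠ 0)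
    (hxp : ratHeight x < p) : padicValRat p x = 0 := by
  have : Fact p.Prime := ⟨hp⟩
  have h1 : padicValInt p x.num = 0 := padicValInt.eq_zero_of_not_dvd fun h => by
    have h2 := Nat.le_of_dvd (Int.natAbs_pos.2 (Rat.num_ne_zero.2 hx)) (Int.natCast_dvd.1 h)
    have := le_max_left x.num.natAbs x.den
    unfold ratHeight at hxp
    omega
  have h2 : padicValNat p x.den = 0 := padicValNat.eq_zero_of_not_dvd fun h => by
    have h2 := Nat.le_of_dvd x.den_pos h
    have := le_max_right x.num.natAbs x.den
    unfold ratHeight at hxp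
    omega
  simp [padicValRat, h1, h2]

theorem one_le_ratHeight (x : ℚ) : 1 ≤ ratHeight x := x.den_pos.trans_le (le_max_right _ _)

/-- The product of numerators over the product of denominators represents |x y|, and reducing a
fraction cannot raise its height. -/
theorem ratHeight_mul_le {x y : ℚ} (hx : x ≠ 0) (hy : y ≠ 0) :
    ratHeight (x * y) ≤ ratHeight x * ratHeight y := by
  have h1 := ratHeight_div_le (x.num.natAbs * y.num.natAbs) (x.den * y.den)
    (mul_ne_zero (Int.natAbs_pos.2 (Rat.num_ne_zero.2 hx)).ne'
      (Int.natAbs_pos.2 (Rat.num_ne_zero.2 hy)).ne') (mul_ne_zero x.den_ne_zero y.den_ne_zero)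
  have h2 : ratHeight (x * y) = ratHeight
      (((x.num.natAbs * y.num.natAbs : ℕ) : ℚ) / ((x.den * y.den : ℕ) : ℚ)) := by
    have h3 : (((x.num.natAbs * y.num.natAbs : ℕ) : ℚ) / ((x.den * y.den : ℕ) : ℚ)) = |x * y| := by
      rw [abs_mul, ← Rat.num_div_den |x|, ← Rat.num_div_den |y|, Rat.num_abs_eq_abs_num,
        Rat.num_abs_eq_abs_num, Rat.den_abs_eq_den, Rat.den_abs_eq_den]
      push_cast
      rw [Nat.cast_natAbs, Nat.cast_natAbs]
      push_cast
      field_simp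
    rw [h3, ratHeight, ratHeight, Rat.num_abs_eq_abs_num, Rat.den_abs_eq_den, Int.natAbs_abs]
  rw [h2]
  refine h1.trans (max_le ?_ ?_)
  · exact Nat.mul_le_mul (le_max_left _ _) (le_max_left _ _)
  · exact Nat.mul_le_mul (le_max_right _ _) (le_max_right _ _)

theorem ratHeight_inv {x : ℚ} (hx : x ≠ 0) : ratHeight x⁻¹ = ratHeight x := by
  rw [ratHeight, ratHeight, Rat.num_inv, Rat.den_inv_of_ne_zero hx, max_comm]
  congr 1
  rw [Int.natAbs_mul, Int.natAbs_sign_of_ne_zero (Rat.num_ne_zero.2 hx)]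
  simp

/-- A power of a reduced fraction is reduced, so numerator and denominator are raised separately; a
negative exponent only interchanges them. -/
theorem ratHeight_le_zpow {x : ℚ} (hx : x ≠ 0) {n : ℤ} (hn : n ≠ 0) :
    ratHeight x ≤ ratHeight (x ^ n) := by
  have key : ∀ m : ℕ, m ≠ 0 → ratHeight x ≤ ratHeight (x ^ m) := fun m hm => by
    rw [ratHeight, ratHeight, Rat.num_pow, Rat.den_pow, Int.natAbs_pow]
    refine max_le_max ?_ ?_
    · exact Nat.le_self_pow hm _
    · exact Nat.le_self_pow hm _
  rcases Int.natAbs_eq n with h | h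
  · rw [h, zpow_natCast]; exact key _ (by omega)
  · rw [h, zpow_neg, zpow_natCast, ratHeight_inv (pow_ne_zero _ hx)]; exact key _ (by omega)

/-- An ordered group of positive rational numbers, with the height of rational numbers. -/
theorem ratHeight_heightBound {P : Type} [AddCommGroup P] [LinearOrder P] (f : P → ℚ)
    (hpos : ∀ p, 0 < f p) (hf0 : f 0 = 1) (hadd : ∀ p q, f (p + q) = f p * f q)
    (hlt : ∀ p q, p < q ↔ f p < f q) (hsurj : ∀ x, 0 < x → ∃ p, f p = x) :
    HeightBound P (fun p => ratHeight (f p)) ratBound := by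
  have hne : ∀ p, f p ≠ 0 := fun p => (hpos p).ne'
  have hneg : ∀ p, f (-p) = (f p)⁻¹ := fun p => by
    rw [eq_comm, inv_eq_iff_eq_inv, eq_comm]
    exact inv_eq_of_mul_eq_one_right (by rw [← hadd, neg_add_cancel, hf0])
  have hnsmul : ∀ (n : ℕ) p, f (n • p) = f p ^ n := fun n p => by
    induction n with
    | zero => simp [hf0]
    | succ n ih => rw [succ_nsmul, hadd, ih, pow_succ]
  have hzsmul : ∀ (n : ℤ) p, f (n • p) = f p ^ n := fun n p => by
    rcases Int.natAbs_eq n with h | h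
    · rw [h, natCast_zsmul, hnsmul, zpow_natCast]
    · rw [h, neg_zsmul, natCast_zsmul, hneg, hnsmul, zpow_neg, zpow_natCast]
  refine ⟨fun x => one_le_ratHeight _, ?_, fun x y => ?_, fun x => ?_, fun n x hn => ?_, ?_,
    fun n B x z hn hnB hx hz hxz => ?_, fun {n} b B M hM hb => ?_⟩
  · simp [hf0, ratHeight]
  · simp only [hadd]; exact ratHeight_mul_le (hne x) (hne y)
  · simp only [hneg]; exact ratHeight_inv (hne x)
  · simp only [hzsmul]; exact ratHeight_le_zpow (hne x) hn
  · obtain ⟨e, he⟩ := hsurj 2 (by norm_num)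
    refine ⟨e, ?_, ?_⟩
    · rw [hlt, hf0, he]; norm_num
    · simp [he, ratHeight, ratBound]
  · obtain ⟨y, hy, h1, h2, h3⟩ := exists_pow_between hn hnB (hpos x) ((hlt _ _).1 hxz) hx hz
    obtain ⟨p, rfl⟩ := hsurj y hy
    refine ⟨p, h3, ?_, ?_⟩
    · rwa [hlt, hzsmul, zpow_natCast]
    · rwa [hlt, hzsmul, zpow_natCast]
  -- The generic element is a prime p with B + 1 < p ≤ 2(B + 1), which divides no numerator or
  -- denominator of height at most B. Its valuation is 1 on p and 0 on all `b i`, so M z = t y + lin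
  -- k b gives M v(z) = t.
  · obtain ⟨p, hp, hp1, hp2⟩ := Nat.exists_prime_lt_and_le_two_mul (B + 1) (by omega)
    have : Fact p.Prime := ⟨hp⟩
    obtain ⟨y, hy⟩ := hsurj p (by exact_mod_cast hp.pos)
    let v : P →+ ℤ :=
      { toFun := fun x => padicValRat p (f x)
        map_zero' := by simp [hf0]
        map_add' := fun x z => by rw [hadd, padicValRat.mul (hne x) (hne z)] }
    have hvb : ∀ i, v (b i) = 0 := fun i =>
      padicValRat_eq_zero_of_height_lt hp (hne _) ((hb i).trans_lt (by omega))
    have hvy : v y = 1 := by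
      change padicValRat p (f y) = 1
      rw [hy]; exact padicValRat.self hp.one_lt
    refine ⟨y, ?_, fun t k => ?_⟩
    · have h1 : ratHeight (f y) = p := by simp [hy, ratHeight, hp.one_le]
      rw [h1]
      refine hp2.trans ?_
      calc 2 * (B + 1) ≤ (B + 2) ^ 2 := by nlinarith
        _ ≤ ratBound B := Nat.pow_le_pow_right (by omega) (by omega)
    · rintro ⟨z, hz⟩
      have := congrArg v hz
      rw [map_add, map_zsmul, map_zsmul, hvy, lin, map_sum] at this
      simp only [map_zsmul, hvb, smul_eq_mul, mul_zero, Finset.sum_const_zero, mul_one,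
        add_zero] at this
      exact ⟨v z, this⟩

/-! ### Ordered multiplicative structures with negative elements -/

/-- The multiplicative structure of an ordered field, with `e` in the role of `-1`. -/
structure SignedMul (M : Type) [CommGroupWithZero M] [LinearOrder M] (e : M) : Prop where
  neg : e < 0
  pos : (0 : M) < 1
  mul_lt_mul_of_pos : ∀ x y z : M, x < y → 0 < z → x * z < y * z
  mul_lt_mul_of_neg : ∀ x y z : M, x < y → z < 0 → y * z < x * z
  sq : e * e = 1

namespace SignedMul

variable {M : Type} [CommGroupWithZero M] [LinearOrder M] {e : M}

theorem mul_pos (h : SignedMul M e) {x y : M} (hx : 0 < x) (hy : 0 < y) : 0 < x * y := by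
  simpa using h.mul_lt_mul_of_pos 0 x y hx hy

theorem mul_neg_of_neg_of_pos (h : SignedMul M e) {x y : M} (hx : x < 0) (hy : 0 < y) :
    x * y < 0 := by
  simpa using h.mul_lt_mul_of_pos x 0 y hx hy

theorem mul_pos_of_neg (h : SignedMul M e) {x y : M} (hx : x < 0) (hy : y < 0) : 0 < x * y := by
  simpa using h.mul_lt_mul_of_neg x 0 y hx hy

theorem inv_pos (h : SignedMul M e) {x : M} (hx : 0 < x) : 0 < x⁻¹ := by
  rcases lt_trichotomy x⁻¹ 0 with h1 | h1 | h1
  · have := h.mul_neg_of_neg_of_pos h1 hx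
    rw [inv_mul_cancel₀ hx.ne'] at this
    exact absurd h.pos this.asymm
  · exact absurd (inv_eq_zero.1 h1) hx.ne'
  · exact h1

theorem inv_neg (h : SignedMul M e) {x : M} (hx : x < 0) : x⁻¹ < 0 := by
  rcases lt_trichotomy x⁻¹ 0 with h1 | h1 | h1
  · exact h1
  · exact absurd (inv_eq_zero.1 h1) hx.ne
  · have := h.mul_neg_of_neg_of_pos hx h1
    rw [mul_inv_cancel₀ hx.ne] at this
    exact absurd h.pos this.asymm

theorem inv_e (h : SignedMul M e) : e⁻¹ = e := inv_eq_of_mul_eq_one_left h.sq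

/-- The group of positive elements. -/
def posUnits (h : SignedMul M e) : Subgroup Mˣ where
  carrier := {u | 0 < (u : M)}
  mul_mem' hx hy := by
    simp only [Set.mem_ofPred_eq, Units.val_mul] at *
    exact h.mul_pos hx hy
  one_mem' := h.pos
  inv_mem' hx := by
    simp only [Set.mem_ofPred_eq, Units.val_inv_eq_inv_val] at *
    exact h.inv_pos hx

/-- A positive element as an element of the structure. -/
def val (h : SignedMul M e) (p : h.posUnits) : M := ((p : Mˣ) : M)

theorem val_pos (h : SignedMul M e) (p : h.posUnits) : 0 < h.val p := p.2

theorem val_mul (h : SignedMul M e) (p q : h.posUnits) : h.val (p * q) = h.val p * h.val q := rfl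

theorem val_one (h : SignedMul M e) : h.val 1 = 1 := rfl

theorem val_lt (h : SignedMul M e) (p q : h.posUnits) : h.val p < h.val q ↔ p < q := Iff.rfl

theorem val_injective (h : SignedMul M e) : Function.Injective h.val := fun _ _ hpq =>
  Subtype.ext (Units.ext hpq)

theorem val_inv (h : SignedMul M e) (p : h.posUnits) : h.val p⁻¹ = (h.val p)⁻¹ :=
  Units.val_inv_eq_inv_val _

theorem val_pow (h : SignedMul M e) (p : h.posUnits) (n : ℕ) : h.val (p ^ n) = h.val p ^ n := by
  simp [val]

instance isOrderedMonoid_posUnits (h : SignedMul M e) : IsOrderedMonoid h.posUnits where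
  mul_le_mul_left x y hxy z := by
    rcases hxy.lt_or_eq with h1 | rfl
    · exact (show x * z < y * z from h.mul_lt_mul_of_pos _ _ _ h1 z.2).le
    · exact le_rfl

/-- The positive element `x`. -/
def ofPos (h : SignedMul M e) (x : M) (hx : 0 < x) : h.posUnits := ⟨Units.mk0 x hx.ne', hx⟩

theorem val_ofPos (h : SignedMul M e) (x : M) (hx : 0 < x) : h.val (h.ofPos x hx) = x := rfl

/-- The absolute value of `x`, or `1` for `x = 0`. -/
def posAbs (h : SignedMul M e) (x : M) : h.posUnits :=
  if hx : 0 < x then h.ofPos x hx else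
    if hx : x < 0 then h.ofPos (x * e) (h.mul_pos_of_neg hx h.neg) else 1

theorem val_posAbs_of_pos (h : SignedMul M e) {x : M} (hx : 0 < x) : h.val (h.posAbs x) = x := by
  rw [posAbs, dif_pos hx, val_ofPos]

theorem val_posAbs_of_neg (h : SignedMul M e) {x : M} (hx : x < 0) :
    h.val (h.posAbs x) = x * e := by
  rw [posAbs, dif_neg hx.not_gt, dif_pos hx, val_ofPos]

theorem posAbs_zero (h : SignedMul M e) : h.posAbs 0 = 1 := by
  rw [posAbs, dif_neg (lt_irrefl _), dif_neg (lt_irrefl _)]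

theorem val_mul_e_neg (h : SignedMul M e) (p : h.posUnits) : h.val p * e < 0 := by
  simpa using h.mul_lt_mul_of_neg 0 _ e (h.val_pos p) h.neg

theorem mul_e_mul_e (h : SignedMul M e) (x : M) : x * e * e = x := by
  rw [mul_assoc, h.sq, mul_one]

theorem sign_mul (h : SignedMul M e) (x y : M) :
    SignType.sign (x * y) = SignType.sign x * SignType.sign y := by
  rcases lt_trichotomy x 0 with hx | rfl | hx <;> rcases lt_trichotomy y 0 with hy | rfl | hy
  · rw [sign_neg hx, sign_neg hy, sign_pos (h.mul_pos_of_neg hx hy)]; rfl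
  · simp
  · rw [sign_neg hx, sign_pos hy, sign_neg (h.mul_neg_of_neg_of_pos hx hy)]; rfl
  · simp
  · simp
  · simp
  · rw [sign_pos hx, sign_neg hy, mul_comm, sign_neg (h.mul_neg_of_neg_of_pos hy hx)]; rfl
  · simp
  · rw [sign_pos hx, sign_pos hy, sign_pos (h.mul_pos hx hy)]; rfl

theorem posAbs_mul (h : SignedMul M e) {x y : M} (hx : x ≠ 0) (hy : y ≠ 0) :
    h.posAbs (x * y) = h.posAbs x * h.posAbs y := by
  apply h.val_injective
  rw [val_mul]
  rcases hx.lt_or_gt with hx | hx <;> rcases hy.lt_or_gt with hy | hy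
  · rw [h.val_posAbs_of_pos (h.mul_pos_of_neg hx hy), h.val_posAbs_of_neg hx,
      h.val_posAbs_of_neg hy, mul_mul_mul_comm, h.sq, mul_one]
  · rw [h.val_posAbs_of_neg (h.mul_neg_of_neg_of_pos hx hy), h.val_posAbs_of_neg hx,
      h.val_posAbs_of_pos hy, mul_right_comm]
  · rw [h.val_posAbs_of_neg (mul_comm y x ▸ h.mul_neg_of_neg_of_pos hy hx),
      h.val_posAbs_of_pos hx, h.val_posAbs_of_neg hy, mul_assoc]
  · rw [h.val_posAbs_of_pos (h.mul_pos hx hy), h.val_posAbs_of_pos hx, h.val_posAbs_of_pos hy]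

theorem posAbs_inv (h : SignedMul M e) (x : M) : h.posAbs x⁻¹ = (h.posAbs x)⁻¹ := by
  rcases lt_trichotomy x 0 with hx | rfl | hx
  · apply h.val_injective
    rw [val_inv, h.val_posAbs_of_neg hx, h.val_posAbs_of_neg (h.inv_neg hx), mul_inv, h.inv_e]
  · rw [inv_zero, posAbs_zero, inv_one]
  · apply h.val_injective
    rw [val_inv, h.val_posAbs_of_pos hx, h.val_posAbs_of_pos (h.inv_pos hx)]

theorem posAbs_e (h : SignedMul M e) : h.posAbs e = 1 := by
  apply h.val_injective
  rw [h.val_posAbs_of_neg h.neg, h.sq, val_one]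

theorem posAbs_lt_of_pos (h : SignedMul M e) {x y : M} (hx : 0 < x) (hy : 0 < y) :
    h.posAbs x < h.posAbs y ↔ x < y := by
  rw [← val_lt, h.val_posAbs_of_pos hx, h.val_posAbs_of_pos hy]

theorem posAbs_lt_of_neg (h : SignedMul M e) {x y : M} (hx : x < 0) (hy : y < 0) :
    h.posAbs y < h.posAbs x ↔ x < y := by
  rw [← val_lt, h.val_posAbs_of_neg hx, h.val_posAbs_of_neg hy]
  constructor
  · intro h1
    simpa [h.mul_e_mul_e] using h.mul_lt_mul_of_neg _ _ e h1 h.neg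
  · intro h1
    exact h.mul_lt_mul_of_neg _ _ e h1 h.neg

/-- Signs and logarithms of absolute values. -/
def chart (h : SignedMul M e) : Chart M (Additive h.posUnits) where
  sgn := SignType.sign
  lg x := Additive.ofMul (h.posAbs x)
  sgn_one := sign_pos h.pos
  sgn_mul := h.sign_mul
  sgn_inv x := by
    rcases lt_trichotomy x 0 with hx | rfl | hx
    · rw [sign_neg hx, sign_neg (h.inv_neg hx)]
    · rw [inv_zero]
    · rw [sign_pos hx, sign_pos (h.inv_pos hx)]
  lg_mul x y hx hy := by
    rw [h.posAbs_mul (sign_ne_zero.1 hx) (sign_ne_zero.1 hy), ofMul_mul]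
  lg_zero x hx := by rw [sign_eq_zero_iff.1 hx, posAbs_zero, ofMul_one]
  lg_inv x := by rw [h.posAbs_inv, ofMul_inv]
  lt_iff x y := by
    rcases lt_trichotomy x 0 with hx | rfl | hx <;> rcases lt_trichotomy y 0 with hy | rfl | hy
    · rw [sign_neg hx, sign_neg hy]
      simp [← h.posAbs_lt_of_neg hx hy]
    · rw [sign_neg hx, sign_zero]
      simpa using hx
    · rw [sign_neg hx, sign_pos hy]
      simpa using hx.trans hy
    · rw [sign_neg hy, sign_zero]
      simpa using hy.le
    · simp
    · rw [sign_pos hy, sign_zero]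
      simpa using hy
    · rw [sign_neg hy, sign_pos hx]
      simpa using (hy.trans hx).le
    · rw [sign_pos hx, sign_zero]
      simpa using hx.le
    · rw [sign_pos hx, sign_pos hy]
      simp [← h.posAbs_lt_of_pos hx hy]
  ext x y hs hl := by
    have hl' := congrArg h.val (show h.posAbs x = h.posAbs y from hl)
    rcases lt_trichotomy x 0 with hx | rfl | hx
    · rw [sign_neg hx] at hs
      have hy := sign_eq_neg_one_iff.1 hs.symm
      rw [h.val_posAbs_of_neg hx, h.val_posAbs_of_neg hy] at hl'
      rw [← h.mul_e_mul_e x, hl', h.mul_e_mul_e]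
    · rw [sign_zero] at hs
      exact (sign_eq_zero_iff.1 hs.symm).symm
    · rw [sign_pos hx] at hs
      have hy := sign_eq_one_iff.1 hs.symm
      rwa [h.val_posAbs_of_pos hx, h.val_posAbs_of_pos hy] at hl'
  surj x p hx := by
    rcases (sign_ne_zero.1 hx).lt_or_gt with hx | hx
    · refine ⟨h.val p.toMul * e, ?_, ?_⟩
      · rw [sign_neg hx, sign_neg (h.val_mul_e_neg _)]
      · refine congrArg Additive.ofMul (h.val_injective ?_ : _ = p.toMul)
        rw [h.val_posAbs_of_neg (h.val_mul_e_neg _), h.mul_e_mul_e]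
    · refine ⟨h.val p.toMul, ?_, ?_⟩
      · rw [sign_pos hx, sign_pos (h.val_pos _)]
      · refine congrArg Additive.ofMul (h.val_injective ?_ : _ = p.toMul)
        rw [h.val_posAbs_of_pos (h.val_pos _)]

theorem chart_sgn_surjective (h : SignedMul M e) (s : SignType) : ∃ x, h.chart.sgn x = s := by
  cases s
  · exact ⟨0, sign_zero⟩
  · exact ⟨e, sign_neg h.neg⟩
  · exact ⟨1, sign_pos h.pos⟩

end SignedMul

theorem SignedMul.sameSigns {M N : Type} [CommGroupWithZero M] [LinearOrder M] {e : M}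
    [CommGroupWithZero N] [LinearOrder N] {e' : N} (h : SignedMul M e) (h' : SignedMul N e') :
    Chart.SameSigns h.chart h'.chart := fun s =>
  iff_of_true (h.chart_sgn_surjective s) (h'.chart_sgn_surjective s)

/-! ### Models of `TQSigned` -/

/-- The symbol `×` of `langSigned`. -/
abbrev sMul : langSigned.Functions 2 := SignedFunc.mul

/-- The symbol `⁻¹` of `langSigned`. -/
abbrev sInv : langSigned.Functions 1 := SignedFunc.inv

/-- The symbol `-1` of `langSigned`. -/
abbrev sNegOne : langSigned.Constants := SignedFunc.negOne

/-- The symbol `0` of `langSigned`. -/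
abbrev sZero : langSigned.Constants := SignedFunc.zero

/-- The symbol `1` of `langSigned`. -/
abbrev sOne : langSigned.Constants := SignedFunc.one

/-- The symbol `<` of `langSigned`. -/
abbrev sLt : langSigned.Relations 2 := LtRel.lt

/-- The symbols of `langSigned` are interpreted by the operations of `M`. -/
structure SignedInterp (M : Type) [CommGroupWithZero M] [LinearOrder M] (e : M)
    [langSigned.Structure M] : Prop where
  mul : ∀ x y : M, Structure.funMap sMul ![x, y] = x * y
  inv : ∀ x : M, Structure.funMap sInv ![x] = x⁻¹
  negOne : ((sNegOne : langSigned.Constants) : M) = e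
  zero : ((sZero : langSigned.Constants) : M) = 0
  one : ((sOne : langSigned.Constants) : M) = 1
  lt : ∀ x y : M, Structure.RelMap sLt ![x, y] ↔ x < y

theorem funMap_constant {L : FirstOrder.Language.{0, 0}} {M : Type} [L.Structure M]
    (c : L.Constants) (xs : Fin 0 → M) : Structure.funMap c xs = (c : M) := by
  rw [← funMap_eq_coe_constants, Subsingleton.elim xs default]

theorem SignedInterp.compatible {M N : Type} [CommGroupWithZero M] [LinearOrder M] {e : M}
    [langSigned.Structure M] [CommGroupWithZero N] [LinearOrder N] {e' : N}
    [langSigned.Structure N] (hM : SignedInterp M e) (hN : SignedInterp N e')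
    (h : SignedMul M e) (h' : SignedMul N e') :
    Chart.Compatible langSigned h.chart h'.chart where
  func := by
    intro l f R
    cases f with
    | mul =>
      refine ⟨R + R, fun {n a b xs ys} h => ?_⟩
      rw [← FinVec.etaExpand_eq xs, ← FinVec.etaExpand_eq ys]
      change Chart.TermRel _ _ _ _ _ (Structure.funMap sMul ![xs 0, xs 1])
        (Structure.funMap sMul ![ys 0, ys 1])
      rw [hM.mul, hN.mul]
      exact (h 0).mul (h 1)
    | inv =>
      refine ⟨R, fun {n a b xs ys} h => ?_⟩
      rw [← FinVec.etaExpand_eq xs, ← FinVec.etaExpand_eq ys]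
      change Chart.TermRel _ _ _ _ _ (Structure.funMap sInv ![xs 0])
        (Structure.funMap sInv ![ys 0])
      rw [hM.inv, hN.inv]
      exact (h 0).inv
    | negOne =>
      refine ⟨0, fun {n a b xs ys} _ => ?_⟩
      change Chart.TermRel _ _ _ _ _ (Structure.funMap sNegOne xs) (Structure.funMap sNegOne ys)
      rw [funMap_constant, funMap_constant, hM.negOne, hN.negOne]
      exact Chart.TermRel.const ((sign_neg h.neg).trans (sign_neg h'.neg).symm)
        (congrArg Additive.ofMul h.posAbs_e) (congrArg Additive.ofMul h'.posAbs_e)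
    | zero =>
      refine ⟨0, fun {n a b xs ys} _ => ?_⟩
      change Chart.TermRel _ _ _ _ _ (Structure.funMap sZero xs) (Structure.funMap sZero ys)
      rw [funMap_constant, funMap_constant, hM.zero, hN.zero]
      exact Chart.TermRel.const (sign_zero.trans sign_zero.symm)
        (congrArg Additive.ofMul h.posAbs_zero) (congrArg Additive.ofMul h'.posAbs_zero)
    | one =>
      refine ⟨0, fun {n a b xs ys} _ => ?_⟩
      change Chart.TermRel _ _ _ _ _ (Structure.funMap sOne xs) (Structure.funMap sOne ys)
      rw [funMap_constant, funMap_constant, hM.one, hN.one]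
      exact Chart.TermRel.one
  rel := by
    intro l r R
    cases r with
    | lt =>
      refine ⟨R + R, fun {n a b xs ys} hab h => ?_⟩
      rw [← FinVec.etaExpand_eq xs, ← FinVec.etaExpand_eq ys]
      change Structure.RelMap sLt ![xs 0, xs 1] ↔ Structure.RelMap sLt ![ys 0, ys 1]
      rw [hM.lt, hN.lt]
      exact (h 0).lt_iff hab le_rfl (h 1)

/-- The structures `SignedMul` that are models of `TQSigned`. -/
theorem SignedInterp.model_iff {M : Type} [CommGroupWithZero M] [LinearOrder M] {e : M}
    [langSigned.Structure M] (hM : SignedInterp M e) (h : SignedMul M e) :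
    M ⊨ TQSigned ↔ (∃ y : M, 1 < y) ∧
      (∀ n : ℕ, 1 ≤ n → ∀ x : M, x ^ (2 * n) = 1 ↔ x = 1 ∨ x = e) ∧
      (∀ n : ℕ, 1 ≤ n → ∀ x z : M, ∃ y, 0 < x → x < z → x < y ^ n ∧ y ^ n < z) ∧
      ∀ n : ℕ, 1 ≤ n → ∀ (q : ℕ) (m : Fin q → ℕ), (∀ j, 1 < m j) →
        ∀ x : Fin q → M, ∃ y, ∀ z, (∀ j, x j ≠ 0) → ∀ j, ¬ m j ∣ n → y ^ n * x j ≠ z ^ m j := by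
  have h8 : ∀ n : ℕ, 1 ≤ n → (M ⊨ axM8 sMul sNegOne sOne n ↔
      ∀ x : M, x ^ (2 * n) = 1 ↔ x = 1 ∨ x = e) := fun n hn => by
    rw [realize_axM8 hM.mul _ _ hn]
    simp only [hM.one, hM.negOne]
  have h10 : ∀ n : ℕ, 1 ≤ n → (M ⊨ axM10' sLt sMul sZero n ↔
      ∀ x z : M, ∃ y, 0 < x → x < z → x < y ^ n ∧ y ^ n < z) := fun n hn => by
    rw [realize_axM10' hM.mul _ _ hn]
    simp only [hM.lt, hM.zero]
  have h11 : ∀ (n : ℕ), 1 ≤ n → ∀ (q : ℕ) (m : Fin q → ℕ), (∀ j, 1 < m j) →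
      (M ⊨ axM11' sMul sZero n m ↔ ∀ x : Fin q → M, ∃ y, ∀ z, (∀ j, x j ≠ 0) →
        ∀ j, ¬ m j ∣ n → y ^ n * x j ≠ z ^ m j) := fun n hn q m hm => by
    rw [realize_axM11' hM.mul _ hn hm]
    simp only [hM.zero]
  rw [Theory.model_iff]
  constructor
  · intro h
    refine ⟨?_, fun n hn => ?_, fun n hn => ?_, fun n hn q m hm => ?_⟩
    · obtain ⟨y, -, -, hy⟩ := (realize_axM6' sLt sNegOne sZero sOne).1
        (h _ (Or.inl (Or.inl (Or.inl (by simp)))))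
      rw [hM.lt, hM.one] at hy
      exact ⟨y, hy⟩
    · exact (h8 n hn).1 (h _ (Or.inl (Or.inl (Or.inr ⟨n, hn, rfl⟩))))
    · exact (h10 n hn).1 (h _ (Or.inl (Or.inr ⟨n, hn, rfl⟩)))
    · exact (h11 n hn q m hm).1 (h _ (Or.inr ⟨n, hn, q, m, hm, rfl⟩))
  · rintro ⟨h6, he, hd, hi⟩ φ
      (((hφ | ⟨n, hn, rfl⟩) | ⟨n, hn, rfl⟩) | ⟨n, hn, q, m, hm, rfl⟩)
    · simp only [Set.mem_insert_iff, Set.mem_singleton_iff] at hφ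
      rcases hφ with rfl | rfl | rfl | rfl | rfl | rfl | rfl | rfl | rfl | rfl
      · refine (realize_axO1 sLt).2 ?_; simp only [hM.lt]; exact fun x y h => h.asymm
      · refine (realize_axO2 sLt).2 ?_; simp only [hM.lt]; exact fun x y z => lt_trans
      · refine (realize_axO3 sLt).2 ?_; simp only [hM.lt]; exact lt_trichotomy
      · refine (realize_axM1 sMul).2 ?_; simp only [hM.mul]
        exact fun x y z => (mul_assoc _ _ _).symm
      · refine (realize_axM2' sMul sInv sZero sOne).2 ?_
        simp only [hM.mul, hM.one, hM.inv, hM.zero]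
        exact fun x => ⟨mul_one x, mul_zero x, inv_zero.symm⟩
      · refine (realize_axM3' sMul sInv sZero sOne).2 ?_
        simp only [hM.mul, hM.one, hM.inv, hM.zero]
        exact fun x hx => mul_inv_cancel₀ hx
      · refine (realize_axM4 sMul).2 ?_; simp only [hM.mul]; exact mul_comm
      · refine (realize_axM5pos sLt sMul sZero).2 ?_; simp only [hM.mul, hM.lt, hM.zero]
        exact h.mul_lt_mul_of_pos
      · refine (realize_axM5neg sLt sMul sZero).2 ?_; simp only [hM.mul, hM.lt, hM.zero]
        exact h.mul_lt_mul_of_neg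
      · refine (realize_axM6' sLt sNegOne sZero sOne).2 ?_
        simp only [hM.lt, hM.zero, hM.one, hM.negOne]
        obtain ⟨y, hy⟩ := h6
        exact ⟨y, h.neg, h.pos, hy⟩
    · exact (h8 n hn).2 (he n hn)
    · exact (h10 n hn).2 (hd n hn)
    · exact (h11 n hn q m hm).2 (hi n hn q m hm)

/-- The axioms supply witnesses of unknown sign, whereas the group consists of positive elements. In
both clauses the witness is replaced by its absolute value, and it has to be checked that this does
no harm. -/
theorem SignedInterp.heightBound {M : Type} [CommGroupWithZero M] [LinearOrder M] {e : M}
    [langSigned.Structure M] (hM : SignedInterp M e) (h : SignedMul M e) (hT : M ⊨ TQSigned) :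
    HeightBound (Additive h.posUnits) (fun _ => 1) (fun _ => 1) := by
  obtain ⟨⟨y, hy⟩, -, hd, hi⟩ := (hM.model_iff h).1 hT
  have : Nontrivial (Additive h.posUnits) := by
    refine ⟨Additive.ofMul (h.ofPos y (h.pos.trans hy)), 0, fun h0 => hy.ne' ?_⟩
    exact congrArg (fun p => h.val p.toMul) h0
  refine HeightBound.trivial (fun n x z hn hxz => ?_) fun q m x hm => ?_
  · obtain ⟨y, hy⟩ := hd n hn (h.val x.toMul) (h.val z.toMul)
    obtain ⟨hy1, hy2⟩ := hy (h.val_pos _) hxz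
    -- For density: y^n is positive, so it equals the n-th power of the absolute value of `y`.
    have hpow : h.posAbs y ^ n = h.posAbs (y ^ n) := by
      have h1 := h.chart.lg_pow y (m := n) (by omega)
      rw [natCast_zsmul] at h1
      exact h1.symm
    have hval : h.val (h.posAbs y ^ n) = y ^ n := by
      rw [hpow, h.val_posAbs_of_pos ((h.val_pos _).trans hy1)]
    refine ⟨Additive.ofMul (h.posAbs y), ?_⟩
    rw [natCast_zsmul]
    refine ⟨?_, ?_⟩
    · change h.val x.toMul < h.val (h.posAbs y ^ n)
      rwa [hval]
    · change h.val (h.posAbs y ^ n) < h.val z.toMul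
      rwa [hval]
  -- Each x_j is entered twice, as x_j and as −x_j. If `y` is negative, the condition for −x_j is
  -- the required one for |y|.
  · obtain ⟨y, hy⟩ := hi 1 le_rfl (q + q) (Fin.append m m)
      (fun j => Fin.addCases (fun i => by rw [Fin.append_left]; exact hm i)
        (fun i => by rw [Fin.append_right]; exact hm i) j)
      (Fin.append (fun j => h.val (x j).toMul) (fun j => h.val (x j).toMul * e))
    have hy1 : ∀ z j, y * h.val (x j).toMul ≠ z ^ m j ∧ y * (h.val (x j).toMul * e) ≠ z ^ m j := by
      intro z j
      have h0 : ∀ j, Fin.append (fun j => h.val (x j).toMul) (fun j => h.val (x j).toMul * e) j ≠ 0 :=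
        fun j => Fin.addCases (fun i => by rw [Fin.append_left]; exact (h.val_pos _).ne')
          (fun i => by rw [Fin.append_right]; exact mul_ne_zero (h.val_pos _).ne' h.neg.ne) j
      have hmj : ¬ m j ∣ 1 := by have := hm j; rw [Nat.dvd_one]; omega
      have h1 := hy z h0 (Fin.castAdd q j) (by rwa [Fin.append_left])
      have h2 := hy z h0 (Fin.natAdd q j) (by rwa [Fin.append_right])
      simp only [Fin.append_left, Fin.append_right, pow_one] at h1 h2
      exact ⟨h1, h2⟩
    refine ⟨Additive.ofMul (h.posAbs y), fun j => ?_⟩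
    rintro ⟨z, hz⟩
    rw [natCast_zsmul] at hz
    have hz' : h.val (h.posAbs y) * h.val (x j).toMul = h.val z.toMul ^ m j := by
      rw [← h.val_pow, ← h.val_mul]
      exact congrArg (fun p => h.val p.toMul) hz
    rcases lt_trichotomy y 0 with hy0 | rfl | hy0
    · rw [h.val_posAbs_of_neg hy0] at hz'
      refine (hy1 (h.val z.toMul) j).2 ?_
      rw [← hz', mul_assoc, mul_comm e]
    -- The witness is not zero, since 0 is the m-th power of 0.
    · refine (hy1 0 j).1 ?_
      rw [zero_mul, zero_pow (by have := hm j; omega)]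
    · rw [h.val_posAbs_of_pos hy0] at hz'
      exact (hy1 _ j).1 hz'

/-- Every model of `TQSigned` is an ordered multiplicative structure with negative elements. -/
theorem exists_signedInterp (N : Type) [langSigned.Structure N] (h : N ⊨ TQSigned) :
    ∃ (_ : CommGroupWithZero N) (_ : LinearOrder N) (e : N), SignedMul N e ∧ SignedInterp N e := by
  rw [Theory.model_iff] at h
  have hO1 := (realize_axO1 _).1 (h (axO1 sLt) (Or.inl (Or.inl (Or.inl (by simp)))))
  have hO2 := (realize_axO2 _).1 (h (axO2 sLt) (Or.inl (Or.inl (Or.inl (by simp)))))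
  have hO3 := (realize_axO3 _).1 (h (axO3 sLt) (Or.inl (Or.inl (Or.inl (by simp)))))
  have hM1 := (realize_axM1 _).1 (h (axM1 sMul) (Or.inl (Or.inl (Or.inl (by simp)))))
  have hM2 := (realize_axM2' _ _ _ _).1 (h (axM2' sMul sInv sZero sOne)
    (Or.inl (Or.inl (Or.inl (by simp)))))
  have hM3 := (realize_axM3' _ _ _ _).1 (h (axM3' sMul sInv sZero sOne)
    (Or.inl (Or.inl (Or.inl (by simp)))))
  have hM4 := (realize_axM4 _).1 (h (axM4 sMul) (Or.inl (Or.inl (Or.inl (by simp)))))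
  have hM5 := (realize_axM5pos _ _ _).1 (h (axM5pos sLt sMul sZero)
    (Or.inl (Or.inl (Or.inl (by simp)))))
  have hM5' := (realize_axM5neg _ _ _).1 (h (axM5neg sLt sMul sZero)
    (Or.inl (Or.inl (Or.inl (by simp)))))
  obtain ⟨_, hneg, hpos, -⟩ := (realize_axM6' _ _ _ _).1 (h (axM6' sLt sNegOne sZero sOne)
    (Or.inl (Or.inl (Or.inl (by simp)))))
  let i₁ : CommGroupWithZero N :=
    { mul := fun x y => Structure.funMap sMul ![x, y]
      mul_assoc := fun x y z => (hM1 x y z).symm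
      one := ((sOne : langSigned.Constants) : N)
      one_mul := fun x => (hM4 _ _).trans (hM2 x).1
      mul_one := fun x => (hM2 x).1
      zero := ((sZero : langSigned.Constants) : N)
      zero_mul := fun x => (hM4 _ _).trans (hM2 x).2.1
      mul_zero := fun x => (hM2 x).2.1
      inv := fun x => Structure.funMap sInv ![x]
      inv_zero := (hM2 ((sZero : langSigned.Constants) : N)).2.2.symm
      mul_inv_cancel := hM3
      exists_pair_ne := ⟨((sZero : langSigned.Constants) : N), ((sOne : langSigned.Constants) : N),
        fun h0 => by rw [← h0] at hpos; exact hO1 _ _ hpos hpos⟩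
      mul_comm := hM4 }
  let r : N → N → Prop := fun x y => Structure.RelMap sLt ![x, y]
  have : IsStrictTotalOrder N r :=
    { trichotomous := fun x y h1 h2 => by
        rcases hO3 x y with h3 | h3 | h3
        · exact absurd h3 h1
        · exact h3
        · exact absurd h3 h2
      irrefl := fun x hx => hO1 x x hx hx
      trans := hO2 }
  classical
  let i₂ : LinearOrder N := linearOrderOfSTO r
  -- The only consequence of (M₈) that is needed is (−1)² = 1; distinctness and signs of the
  -- constants come from (M₆°).
  have hM8 := (realize_axM8 (mul := sMul) (fun _ _ => rfl) _ _ le_rfl).1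
    (h (axM8 sMul sNegOne sOne 1) (Or.inl (Or.inl (Or.inr ⟨1, le_rfl, rfl⟩))))
  refine ⟨i₁, i₂, ((sNegOne : langSigned.Constants) : N), ⟨hneg, hpos, hM5, hM5', ?_⟩,
    ⟨fun _ _ => rfl, fun _ => rfl, rfl, rfl, rfl, fun _ _ => Iff.rfl⟩⟩
  rw [← sq]
  exact (hM8 _).2 (Or.inr rfl)

/-! ### The rational numbers as models -/

/-- Take for `y` a prime p above all heights of the x_j. The p-adic valuation of y^n x_j is then n,
and that of an m-th power is a multiple of m. One `y` serves all n and m. -/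
theorem exists_pow_mul_ne_pow {q : ℕ} (x : Fin q → ℚ) :
    ∃ y : ℚ, 0 < y ∧ ∀ (n m : ℕ) (z : ℚ) (j : Fin q), 1 < m → ¬ m ∣ n → x j ≠ 0 →
      y ^ n * x j ≠ z ^ m := by
  obtain ⟨p, hpB, hp⟩ := Nat.exists_infinite_primes (Finset.univ.sup (fun j => ratHeight (x j)) + 1)
  have : Fact p.Prime := ⟨hp⟩
  have hp0 : (0 : ℚ) < p := by exact_mod_cast hp.pos
  refine ⟨p, hp0, fun n m z j hm hmn hxj heq => hmn ?_⟩
  have hz : z ≠ 0 := by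
    rintro rfl
    rw [zero_pow (by omega)] at heq
    exact mul_ne_zero (pow_ne_zero n hp0.ne') hxj heq
  have h1 := congrArg (padicValRat p) heq
  have hle := Finset.le_sup (f := fun j => ratHeight (x j)) (Finset.mem_univ j)
  have hpow : padicValRat p ((p : ℚ) ^ n) = n := by
    rw [padicValRat.pow, padicValRat.self hp.one_lt, mul_one]
  rw [padicValRat.mul (pow_ne_zero n hp0.ne') hxj, hpow, padicValRat.pow,
    padicValRat_eq_zero_of_height_lt hp hxj (by omega), add_zero] at h1
  exact Int.natCast_dvd_natCast.1 ⟨_, h1⟩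

theorem exists_rat_pow_between {n : ℕ} (hn : 1 ≤ n) {x z : ℚ} (hx : 0 < x) (hxz : x < z) :
    ∃ y : ℚ, 0 < y ∧ x < y ^ n ∧ y ^ n < z := by
  obtain ⟨y, h1, h2, h3, -⟩ := exists_pow_between (B := n + ratHeight x + ratHeight z) hn
    (by omega) hx hxz (by omega) (by omega)
  exact ⟨y, h1, h2, h3⟩

theorem groupInterp_posRat : GroupInterp PosRat :=
  ⟨fun _ _ => rfl, fun _ => rfl, rfl, fun _ _ => Iff.rfl⟩

theorem posRat_model : PosRat ⊨ TQ := by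
  rw [groupInterp_posRat.model_iff]
  refine ⟨⟨⟨2, by norm_num⟩, fun h => ?_⟩, fun n hn x z => ?_, fun n _ q m hm x => ?_⟩
  · have := congrArg Subtype.val h
    norm_num at this
  · by_cases hxz : x < z
    · obtain ⟨y, hy, h1, h2⟩ := exists_rat_pow_between hn x.2 hxz
      exact ⟨⟨y, hy⟩, fun _ => ⟨h1, h2⟩⟩
    · exact ⟨1, fun h => absurd h hxz⟩
  · obtain ⟨y, hy, h⟩ := exists_pow_mul_ne_pow fun j => ((x j : PosRat) : ℚ)
    refine ⟨⟨y, hy⟩, fun z j hj heq => h n (m j) z j (hm j) hj (x j).2.ne' ?_⟩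
    exact congrArg Subtype.val heq

theorem signedMul_rat : SignedMul ℚ (-1) :=
  ⟨by norm_num, by norm_num, fun _ _ _ h h' => mul_lt_mul_of_pos_right h h',
    fun _ _ _ h h' => mul_lt_mul_of_neg_right h h', by norm_num⟩

theorem signedInterp_rat : SignedInterp ℚ (-1) :=
  ⟨fun _ _ => rfl, fun _ => rfl, rfl, rfl, rfl, fun _ _ => Iff.rfl⟩

theorem rat_model : ℚ ⊨ TQSigned := by
  rw [signedInterp_rat.model_iff signedMul_rat]
  refine ⟨⟨2, by norm_num⟩, fun n hn x => ?_, fun n hn x z => ?_, fun n _ q m hm x => ?_⟩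
  · rw [pow_mul, pow_eq_one_iff_of_nonneg (sq_nonneg x) (by omega), sq_eq_one_iff]
  · by_cases hxz : 0 < x ∧ x < z
    · obtain ⟨y, hy, h1, h2⟩ := exists_rat_pow_between hn hxz.1 hxz.2
      exact ⟨y, fun _ _ => ⟨h1, h2⟩⟩
    · exact ⟨1, fun h h' => absurd ⟨h, h'⟩ hxz⟩
  · obtain ⟨y, hy, h⟩ := exists_pow_mul_ne_pow x
    exact ⟨y, fun z hx j hj => h n (m j) z j (hm j) hj (hx j)⟩

/-! ### Complete axiomatizability -/

/-- Any model is an ordered group satisfying the hypotheses of the back-and-forth argument, so it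
agrees with the positive rationals on every sentence. -/
theorem completelyAxiomatizes_TQ : CompletelyAxiomatizes TQ PosRat := by
  intro φ
  rw [Theory.models_sentence_iff]
  have hpos := posRat_model
  refine ⟨fun h => h (Theory.ModelType.of TQ PosRat), fun h N => ?_⟩
  obtain ⟨i₁, i₂, i₃, hN⟩ := exists_groupInterp N inferInstance
  exact ((groupInterp_posRat.compatible hN).sentence_iff (groupChart_sameSigns _ _)
    (groupInterp_posRat.heightBound hpos) (hN.heightBound inferInstance) φ).1 h

theorem completelyAxiomatizes_TQSigned : CompletelyAxiomatizes TQSigned ℚ := by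
  intro φ
  rw [Theory.models_sentence_iff]
  have hpos := rat_model
  refine ⟨fun h => h (Theory.ModelType.of TQSigned ℚ), fun h N => ?_⟩
  obtain ⟨i₁, i₂, e, hS, hN⟩ := exists_signedInterp N inferInstance
  exact ((signedInterp_rat.compatible hN signedMul_rat hS).sentence_iff
    (signedMul_rat.sameSigns hS) (signedInterp_rat.heightBound signedMul_rat hpos)
    (hN.heightBound hS inferInstance) φ).1 h

instance toGroup_isExpansionOn : toGroup.IsExpansionOn PosRat where
  map_onFunction := fun f _ => by cases f; rfl
  map_onRelation := fun r _ => by cases r; rfl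

instance toSigned_isExpansionOn : toSigned.IsExpansionOn ℚ where
  map_onFunction := fun f _ => by cases f; rfl
  map_onRelation := fun r _ => by cases r; rfl

theorem CompletelyAxiomatizes.via {L L' : FirstOrder.Language.{0, 0}} (i : L →ᴸ L')
    {T : L'.Theory} {M : Type} [L.Structure M] [L'.Structure M] [i.IsExpansionOn M]
    (h : CompletelyAxiomatizes T M) : CompletelyAxiomatizesVia i T M := fun φ => by
  rw [h, LHom.realize_onSentence]

/-! ### Quantifier-free definability -/

section QF

variable {L : FirstOrder.Language.{0, 0}} {M : Type} [L.Structure M] {n : ℕ}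

theorem isQF_foldr_inf {α : Type} {l : List (L.BoundedFormula α n)} (h : ∀ φ ∈ l, φ.IsQF) :
    (l.foldr (· ⊓ ·) ⊤).IsQF := by
  induction l with
  | nil => exact BoundedFormula.IsQF.top
  | cons φ l ih =>
    exact (h φ (by simp)).inf (ih fun ψ hψ => h ψ (by simp [hψ]))

theorem isQF_foldr_sup {α : Type} {l : List (L.BoundedFormula α n)} (h : ∀ φ ∈ l, φ.IsQF) :
    (l.foldr (· ⊔ ·) ⊥).IsQF := by
  induction l with
  | nil => exact BoundedFormula.isQF_bot
  | cons φ l ih =>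
    exact (h φ (by simp)).sup (ih fun ψ hψ => h ψ (by simp [hψ]))

variable (L) in
/-- The set `S` is defined by a quantifier-free formula. -/
def QFDefinable (S : Set (Fin n → M)) : Prop :=
  ∃ ψ : L.Formula (Fin n), BoundedFormula.IsQF ψ ∧ ∀ v, v ∈ S ↔ ψ.Realize v

theorem QFDefinable.compl {S : Set (Fin n → M)} (h : QFDefinable L S) : QFDefinable L Sᶜ := by
  obtain ⟨ψ, hψ, hS⟩ := h
  exact ⟨∼ψ, hψ.not, fun v => by rw [Set.mem_compl_iff, hS, Formula.realize_not]⟩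

theorem QFDefinable.iInter {ι : Type} [Finite ι] {S : ι → Set (Fin n → M)}
    (h : ∀ i, QFDefinable L (S i)) : QFDefinable L (⋂ i, S i) := by
  choose ψ hψ hS using h
  refine ⟨BoundedFormula.iInf ψ, isQF_foldr_inf (by simpa using hψ), fun v => ?_⟩
  rw [Set.mem_iInter, Formula.Realize, BoundedFormula.realize_iInf]
  exact forall_congr' fun i => hS i v

theorem QFDefinable.iUnion {ι : Type} [Finite ι] {S : ι → Set (Fin n → M)}
    (h : ∀ i, QFDefinable L (S i)) : QFDefinable L (⋃ i, S i) := by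
  choose ψ hψ hS using h
  refine ⟨BoundedFormula.iSup ψ, isQF_foldr_sup (by simpa using hψ), fun v => ?_⟩
  rw [Set.mem_iUnion, Formula.Realize, BoundedFormula.realize_iSup]
  exact exists_congr fun i => hS i v

theorem QFDefinable.equal (t s : L.Term (Fin n)) :
    QFDefinable L {v : Fin n → M | t.realize v = s.realize v} :=
  ⟨t.equal s, (BoundedFormula.IsAtomic.equal _ _).isQF, fun v => by
    rw [Formula.realize_equal]; rfl⟩

theorem QFDefinable.rel {l : ℕ} (r : L.Relations l) (ts : Fin l → L.Term (Fin n)) :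
    QFDefinable L {v : Fin n → M | Structure.RelMap r fun i => (ts i).realize v} :=
  ⟨r.formula ts, (BoundedFormula.IsAtomic.rel _ _).isQF, fun v => by
    rw [Formula.realize_rel]; rfl⟩

theorem QFDefinable.const (p : Prop) : QFDefinable L {_v : Fin n → M | p} := by
  by_cases hp : p
  · exact ⟨⊤, BoundedFormula.IsQF.top, fun v => by simp [hp]⟩
  · exact ⟨⊥, BoundedFormula.isQF_bot, fun v => by simp [hp, Formula.Realize]⟩

/-- A set which is determined by finitely many definable sets is definable. -/
theorem QFDefinable.of_finite {ι : Type} [Finite ι] {S : ι → Set (Fin n → M)}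
    (h : ∀ i, QFDefinable L (S i)) {A : Set (Fin n → M)}
    (hA : ∀ a b, (∀ i, a ∈ S i ↔ b ∈ S i) → a ∈ A → b ∈ A) : QFDefinable L A := by
  -- `A` is the union of the atoms that it meets in the Boolean algebra generated by the sets `S i`;
  -- `T` records which `S i` contain a given atom.
  have key : A = ⋃ T : {T : Set ι // ∃ a ∈ A, ∀ i, a ∈ S i ↔ i ∈ T},
      ⋂ i, {v | v ∈ S i ↔ i ∈ T.1} := by
    ext v
    simp only [Set.mem_iUnion, Set.mem_iInter]
    constructor
    · intro hv
      exact ⟨⟨{i | v ∈ S i}, v, hv, fun i => Iff.rfl⟩, fun i => Iff.rfl⟩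
    · rintro ⟨⟨T, a, ha, haT⟩, hT⟩
      exact hA a v (fun i => (haT i).trans (hT i).symm) ha
  rw [key]
  refine QFDefinable.iUnion fun T => QFDefinable.iInter fun i => ?_
  by_cases hi : i ∈ T.1
  · convert h i using 1
    ext v; exact iff_true_right hi
  · convert (h i).compl using 1
    ext v; exact iff_false_right hi

/-! ### Terms for monomials and definability of similarity -/

variable (L) in
/-- The function `f` is the interpretation of a term. -/
def TermDefinable (f : (Fin n → M) → M) : Prop :=
  ∃ t : L.Term (Fin n), ∀ v, t.realize v = f v

theorem TermDefinable.var (i : Fin n) : TermDefinable L fun v : Fin n → M => v i :=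
  ⟨Term.var i, fun _ => rfl⟩

variable {P : Type} [CommMonoid M] [Inv M] [LT M] [AddCommGroup P] [LinearOrder P]

variable (L) in
/-- The operations, the order, the powers and the signs are quantifier-free definable. -/
structure QFInterp (C : Chart M P) : Prop where
  one : ∀ {n : ℕ}, TermDefinable L fun _ : Fin n → M => (1 : M)
  mul : ∀ {n : ℕ} {f g : (Fin n → M) → M}, TermDefinable L f → TermDefinable L g →
    TermDefinable L fun v => f v * g v
  inv : ∀ {n : ℕ} {f : (Fin n → M) → M}, TermDefinable L f → TermDefinable L fun v => (f v)⁻¹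
  lt : ∀ {n : ℕ} {f g : (Fin n → M) → M}, TermDefinable L f → TermDefinable L g →
    QFDefinable L {v | f v < g v}
  pow : ∀ {n : ℕ} {f : (Fin n → M) → M} (m : ℕ), 1 < m → TermDefinable L f →
    QFDefinable L {v | ∃ z, f v = z ^ m}
  sgn : ∀ {n : ℕ} (i : Fin n) (s : SignType), QFDefinable L {v : Fin n → M | C.sgn (v i) = s}

namespace QFInterp

variable {C : Chart M P}

theorem exists_zpow (hC : QFInterp L C) (i : Fin n) (k : ℤ) :
    ∃ f : (Fin n → M) → M, TermDefinable L f ∧ ∀ v, C.sgn (v i) ≠ 0 →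
      C.sgn (f v) ≠ 0 ∧ C.lg (f v) = k • C.lg (v i) := by
  have key : ∀ m : ℕ, ∃ f : (Fin n → M) → M, TermDefinable L f ∧ ∀ v, C.sgn (v i) ≠ 0 →
      C.sgn (f v) ≠ 0 ∧ C.lg (f v) = (m : ℤ) • C.lg (v i) := by
    intro m
    induction m with
    | zero =>
      refine ⟨_, hC.one, fun v _ => ⟨by rw [C.sgn_one]; decide, ?_⟩⟩
      rw [C.lg_one, Nat.cast_zero, zero_smul]
    | succ m ih =>
      obtain ⟨f, hf, h⟩ := ih
      refine ⟨_, hC.mul hf (TermDefinable.var i), fun v hv => ?_⟩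
      obtain ⟨h1, h2⟩ := h v hv
      refine ⟨by rw [C.sgn_mul]; exact mul_ne_zero h1 hv, ?_⟩
      rw [C.lg_mul _ _ h1 hv, h2, Nat.cast_succ, add_zsmul, one_zsmul]
  obtain ⟨f, hf, h⟩ := key k.natAbs
  rcases Int.natAbs_eq k with hk | hk
  · rw [← hk] at h
    exact ⟨f, hf, h⟩
  · refine ⟨_, hC.inv hf, fun v hv => ⟨by rw [C.sgn_inv]; exact (h v hv).1, ?_⟩⟩
    rw [C.lg_inv, (h v hv).2, ← neg_zsmul, ← hk]

theorem exists_prod (hC : QFInterp L C) (Z : Finset (Fin n)) (k : Fin n → ℤ) :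
    ∃ f : (Fin n → M) → M, TermDefinable L f ∧ ∀ v, (∀ i ∈ Z, C.sgn (v i) ≠ 0) →
      C.sgn (f v) ≠ 0 ∧ C.lg (f v) = ∑ i ∈ Z, k i • C.lg (v i) := by
  classical
  induction Z using Finset.induction_on with
  | empty => exact ⟨_, hC.one, fun v _ => ⟨by rw [C.sgn_one]; decide, by simp [C.lg_one]⟩⟩
  | insert i Z hi ih =>
    obtain ⟨f, hf, h⟩ := ih
    obtain ⟨g, hg, h'⟩ := hC.exists_zpow i (k i)
    refine ⟨_, hC.mul hg hf, fun v hv => ?_⟩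
    obtain ⟨h1, h2⟩ := h v fun j hj => hv j (Finset.mem_insert_of_mem hj)
    obtain ⟨h3, h4⟩ := h' v (hv i (Finset.mem_insert_self _ _))
    refine ⟨by rw [C.sgn_mul]; exact mul_ne_zero h3 h1, ?_⟩
    rw [C.lg_mul _ _ h3 h1, h2, h4, Finset.sum_insert hi]

/-- Squaring the monomial makes it positive, so order and power predicates see only its logarithm.
Zero coordinates are omitted through `Z`; they contribute nothing to the linear form, as their
logarithm is 0. -/
theorem exists_prod_sq (hC : QFInterp L C) (Z : Finset (Fin n)) (k : Fin n → ℤ) :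
    ∃ f : (Fin n → M) → M, TermDefinable L f ∧ ∀ v, (∀ i, i ∈ Z ↔ C.sgn (v i) ≠ 0) →
      C.sgn (f v) = 1 ∧ C.lg (f v) = (2 : ℤ) • lin k (C.lg ∘ v) := by
  obtain ⟨f, hf, h⟩ := hC.exists_prod Z k
  refine ⟨_, hC.mul hf hf, fun v hv => ?_⟩
  obtain ⟨h1, h2⟩ := h v fun i hi => (hv i).1 hi
  constructor
  · rw [C.sgn_mul]
    revert h1
    generalize C.sgn (f v) = s
    revert s
    decide
  · rw [C.lg_mul _ _ h1 h1, h2, two_zsmul]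
    have : ∑ i ∈ Z, k i • C.lg (v i) = lin k (C.lg ∘ v) := by
      refine Finset.sum_subset (Finset.subset_univ Z) fun i _ hi => ?_
      rw [C.lg_zero _ (not_not.1 fun h0 => hi ((hv i).2 h0)), smul_zero]
    rw [this]

variable [IsOrderedAddMonoid P]

/-- A set that is invariant under similarity is quantifier-free definable. -/
theorem qfDefinable (hC : QFInterp L C) (R : ℕ) {A : Set (Fin n → M)}
    (hA : ∀ a b, Chart.ESim C C R a b → a ∈ A → b ∈ A) : QFDefinable L A := by
  classical
  choose f hf h using fun (Z : Finset (Fin n)) k => hC.exists_prod_sq Z k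
  have hfac : 0 < R.factorial := R.factorial_pos
  let κ : (Fin n → Finset.Icc (-(R : ℤ)) R) → Fin n → ℤ := fun k i => k i
  let μ : (Fin n → Fin R.factorial) → Fin n → ℤ := fun k i => ((k i : ℕ) : ℤ)
  -- The finitely many conditions behind R-similarity: the signs, the small forms compared with 0 (a
  -- square compared with 1), and divisibility by R! with coefficients modulo R!. For squares the
  -- latter means being a 2·R!-th power, and 2·R! > 1, so a predicate ℜ is available.
  let S : (Fin n × SignType) ⊕ (Finset (Fin n) × (Fin n → Finset.Icc (-(R : ℤ)) R)) ⊕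
      (Finset (Fin n) × (Fin n → Fin R.factorial)) → Set (Fin n → M) :=
    Sum.elim (fun p => {v | C.sgn (v p.1) = p.2})
      (Sum.elim (fun p => {v | 1 < f p.1 (κ p.2) v})
        (fun p => {v | ∃ z, f p.1 (μ p.2) v = z ^ (2 * R.factorial)}))
  have hS : ∀ i, QFDefinable L (S i) := by
    rintro (p | p | p)
    · exact hC.sgn _ _
    · exact hC.lt hC.one (hf _ _)
    · exact hC.pow _ (by omega) (hf _ _)
  refine QFDefinable.of_finite hS fun a b hab => hA a b ?_
  have hsgn : ∀ i, C.sgn (a i) = C.sgn (b i) := fun i =>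
    ((hab (Sum.inl (i, C.sgn (a i)))).1 rfl).symm
  let Z : Finset (Fin n) := Finset.univ.filter fun i => C.sgn (a i) ≠ 0
  have hZa : ∀ i, i ∈ Z ↔ C.sgn (a i) ≠ 0 := fun i => by simp [Z]
  have hZb : ∀ i, i ∈ Z ↔ C.sgn (b i) ≠ 0 := fun i => by rw [← hsgn, hZa]
  have hone : ∀ v k, (∀ i, i ∈ Z ↔ C.sgn (v i) ≠ 0) →
      (1 < f Z k v ↔ 0 < lin k (C.lg ∘ v)) := fun v k hv => by
    obtain ⟨h1, h2⟩ := h Z k v hv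
    rw [C.lt_iff, h1, h2, C.sgn_one, C.lg_one]
    simp only [lt_self_iff_false, true_and, false_or, SignType.coe_one, one_zsmul, sub_zero]
    exact smul_pos_iff_of_pos_left (by norm_num : (0 : ℤ) < 2)
  have hpow : ∀ v k, (∀ i, i ∈ Z ↔ C.sgn (v i) ≠ 0) →
      ((∃ z, f Z k v = z ^ (2 * R.factorial)) ↔
        Divides (R.factorial : ℤ) (lin k (C.lg ∘ v))) := fun v k hv => by
    obtain ⟨h1, h2⟩ := h Z k v hv
    rw [C.exists_pow_iff _ (by omega), h1, h2, Nat.cast_mul, Nat.cast_ofNat,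
      divides_mul_smul (by norm_num)]
    exact and_iff_right ⟨1, by rw [C.sgn_one, one_pow]⟩
  refine ⟨hsgn, fun k hk => ?_, fun k => ?_⟩
  · let k' : Fin n → Finset.Icc (-(R : ℤ)) R := fun i =>
      ⟨k i, Finset.mem_Icc.2 (by have := hk i; omega)⟩
    rw [← hone a k hZa, ← hone b k hZb]
    exact hab (Sum.inr (Sum.inl (Z, k')))
  · have hred : ∀ v : Fin n → M, Divides (R.factorial : ℤ) (lin k (C.lg ∘ v)) ↔
        Divides (R.factorial : ℤ) (lin (fun i => k i % (R.factorial : ℤ)) (C.lg ∘ v)) := fun v => by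
      have := (divides_lin_emod (R.factorial : ℤ) k (C.lg ∘ v)).add_iff
        (y := lin (fun i => k i % (R.factorial : ℤ)) (C.lg ∘ v))
      rwa [sub_add_cancel] at this
    let k' : Fin n → Fin R.factorial := fun i => ⟨(k i % (R.factorial : ℤ)).toNat, by
      have h1 := Int.emod_nonneg (k i) (by positivity : (R.factorial : ℤ) ≠ 0)
      have h2 := Int.emod_lt_of_pos (k i) (by positivity : (0 : ℤ) < R.factorial)
      omega⟩
    have hk' : (fun i => k i % (R.factorial : ℤ)) = μ k' := by
      funext i
      have h1 := Int.emod_nonneg (k i) (by positivity : (R.factorial : ℤ) ≠ 0)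
      simp only [μ, k']; omega
    rw [hred a, hred b, hk', ← hpow a _ hZa, ← hpow b _ hZb]
    exact hab (Sum.inr (Sum.inr (Z, k')))

end QFInterp

/-- Quantifier elimination. -/
theorem Chart.Compatible.hasQE [IsOrderedAddMonoid P] {C : Chart M P}
    (hL : Chart.Compatible L C C) (hC : QFInterp L C) {h : P → ℕ} {F : ℕ → ℕ}
    (hh : HeightBound P h F) : HasQE L M := by
  intro n φ
  obtain ⟨R, hR⟩ := hL.realize_iff (fun _ => Iff.rfl) hh hh (BoundedFormula.relabel Sum.inr φ)
  have key : ∀ {a b : Fin n → M}, Chart.ESim C C R a b → (φ.Realize a ↔ φ.Realize b) :=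
    fun {a b} hab => by
      have := hR hab
      rwa [Formula.realize_relabel_sumInr, Formula.realize_relabel_sumInr] at this
  exact hC.qfDefinable R (A := {v | φ.Realize v}) fun a b hab => (key hab).1

end QF

/-! ### Quantifier elimination for the rational numbers -/

/-- The predicates `ℜ_n` are compatible with all charts. -/
theorem Chart.Compatible.sum_langPow {L : FirstOrder.Language.{0, 0}} {M P M' P' : Type}
    [CommMonoid M] [Inv M] [LT M] [AddCommGroup P] [LinearOrder P] [IsOrderedAddMonoid P]
    [CommMonoid M'] [Inv M'] [LT M'] [AddCommGroup P'] [LinearOrder P'] [IsOrderedAddMonoid P']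
    [L.Structure M] [L.Structure M'] {C : Chart M P} {C' : Chart M' P'}
    (hL : Chart.Compatible L C C') (hCC : Chart.SameSigns C C') :
    Chart.Compatible (L.sum langPow) C C' where
  func := by
    rintro l (f | f) R
    · exact hL.func f R
    · exact f.elim
  rel := by
    rintro l (r | r) R
    · exact hL.rel r R
    · cases r with
      | isPow m hm => exact ⟨m, fun hab h => (h 0).exists_pow_iff hCC hab (by omega)⟩

theorem qfDefinable_pow {L : FirstOrder.Language.{0, 0}} {M : Type} [L.Structure M] [Monoid M]
    {n : ℕ} {f : (Fin n → M) → M} (m : ℕ) (hm : 1 < m) (hf : TermDefinable (L.sum langPow) f) :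
    QFDefinable (L.sum langPow) {v | ∃ z, f v = z ^ m} := by
  obtain ⟨t, ht⟩ := hf
  have := QFDefinable.rel (M := M) (Sum.inr (PowRel.isPow m hm) : (L.sum langPow).Relations 1) ![t]
  convert this using 1
  ext v
  exact exists_congr fun z => by rw [← ht v]; rfl

theorem qfInterp_posRat : QFInterp (langGroup.sum langPow) (groupChart PosRat) where
  one := ⟨Term.func (Sum.inl GroupFunc.one) Fin.elim0, fun _ => rfl⟩
  mul := by
    rintro n f g ⟨t, ht⟩ ⟨s, hs⟩
    exact ⟨Term.func (Sum.inl GroupFunc.mul) ![t, s], fun v => by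
      change t.realize v * s.realize v = f v * g v
      rw [ht v, hs v]⟩
  inv := by
    rintro n f ⟨t, ht⟩
    exact ⟨Term.func (Sum.inl GroupFunc.inv) ![t], fun v => by
      change (t.realize v)⁻¹ = (f v)⁻¹
      rw [ht v]⟩
  lt := by
    rintro n f g ⟨t, ht⟩ ⟨s, hs⟩
    convert QFDefinable.rel (M := PosRat)
      (Sum.inl LtRel.lt : (langGroup.sum langPow).Relations 2) ![t, s] using 1
    ext v
    change f v < g v ↔ t.realize v < s.realize v
    rw [ht v, hs v]
  pow m hm hf := qfDefinable_pow m hm hf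
  sgn i s := QFDefinable.const ((1 : SignType) = s)

theorem hasQE_posRat : HasQE (langGroup.sum langPow) PosRat :=
  ((groupInterp_posRat.compatible groupInterp_posRat).sum_langPow
    (groupChart_sameSigns _ _)).hasQE qfInterp_posRat (groupInterp_posRat.heightBound posRat_model)

theorem qfInterp_rat : QFInterp (langSigned.sum langPow) signedMul_rat.chart where
  one := ⟨Term.func (Sum.inl SignedFunc.one) Fin.elim0, fun _ => rfl⟩
  mul := by
    rintro n f g ⟨t, ht⟩ ⟨s, hs⟩
    exact ⟨Term.func (Sum.inl SignedFunc.mul) ![t, s], fun v => by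
      change t.realize v * s.realize v = f v * g v
      rw [ht v, hs v]⟩
  inv := by
    rintro n f ⟨t, ht⟩
    exact ⟨Term.func (Sum.inl SignedFunc.inv) ![t], fun v => by
      change (t.realize v)⁻¹ = (f v)⁻¹
      rw [ht v]⟩
  lt := by
    rintro n f g ⟨t, ht⟩ ⟨s, hs⟩
    convert QFDefinable.rel (M := ℚ)
      (Sum.inl LtRel.lt : (langSigned.sum langPow).Relations 2) ![t, s] using 1
    ext v
    change f v < g v ↔ t.realize v < s.realize v
    rw [ht v, hs v]
  pow m hm hf := qfDefinable_pow m hm hf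
  sgn {n} i s := by
    let z : (langSigned.sum langPow).Term (Fin n) :=
      Term.func (Sum.inl SignedFunc.zero) Fin.elim0
    cases s with
    | zero =>
      convert QFDefinable.equal (M := ℚ) (Term.var i) z using 1
      ext v
      exact sign_eq_zero_iff
    | neg =>
      convert QFDefinable.rel (M := ℚ)
        (Sum.inl LtRel.lt : (langSigned.sum langPow).Relations 2) ![Term.var i, z] using 1
      ext v
      exact sign_eq_neg_one_iff
    | pos =>
      convert QFDefinable.rel (M := ℚ)
        (Sum.inl LtRel.lt : (langSigned.sum langPow).Relations 2) ![z, Term.var i] using 1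
      ext v
      exact sign_eq_one_iff

theorem hasQE_rat : HasQE (langSigned.sum langPow) ℚ :=
  ((signedInterp_rat.compatible signedInterp_rat signedMul_rat signedMul_rat).sum_langPow
    (signedMul_rat.sameSigns signedMul_rat)).hasQE qfInterp_rat
      (signedInterp_rat.heightBound signedMul_rat rat_model)

/-! ### Primitive recursion along finite lists of smaller arguments -/

/-- Recursion in which the value at `b` depends on the values at the elements of `l b`. -/
def listRec {β σ : Type} (m : β → ℕ) (l : β → List β) (g : β → List σ → σ)
    (hl : ∀ b, ∀ b' ∈ l b, m b' < m b) (b : β) : σ :=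
  g b ((l b).attach.map fun b' => listRec m l g hl b'.1)
termination_by m b
decreasing_by exact hl _ _ b'.2

theorem listRec_eq {β σ : Type} (m : β → ℕ) (l : β → List β) (g : β → List σ → σ)
    (hl : ∀ b, ∀ b' ∈ l b, m b' < m b) (b : β) :
    listRec m l g hl b = g b ((l b).map (listRec m l g hl)) := by
  rw [listRec, List.attach_map_val (l := l b) (f := listRec m l g hl)]

theorem primrec_listRec {β σ : Type} [Primcodable β] [Primcodable σ] {m : β → ℕ} {l : β → List β}
    {g : β → List σ → σ} (hl : ∀ b, ∀ b' ∈ l b, m b' < m b) (hm : Primrec m) (hlp : Primrec l)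
    (hg : Primrec₂ g) : Primrec (listRec m l g hl) :=
  Primrec.nat_omega_rec' (listRec m l g hl) hm hlp (Primrec.option_some.comp₂ hg) hl fun b =>
    congrArg some (listRec_eq m l g hl b).symm

/-! ### Primitive recursiveness of the height bounds -/

theorem primrec_pow : Primrec₂ ((· ^ ·) : ℕ → ℕ → ℕ) := Primrec₂.unpaired'.1 Nat.Primrec.pow

theorem primrec_factorial : Primrec Nat.factorial := by
  refine (Primrec.nat_rec₁ (f := fun n x => (n + 1) * x) 1
    (Primrec.nat_mul.comp (Primrec.succ.comp Primrec.fst) Primrec.snd)).of_eq fun n => ?_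
  induction n with
  | zero => rfl
  | succ n ih => rw [Nat.factorial_succ, ← ih]

theorem primrec_simStep : Primrec simStep :=
  Primrec.nat_mul.comp (Primrec.nat_mul.comp (Primrec.const 2) Primrec.id)
    (Primrec.nat_add.comp primrec_factorial Primrec.id)

theorem primrec_ratBound : Primrec ratBound :=
  primrec_pow.comp (Primrec.nat_add.comp Primrec.id (Primrec.const 2))
    (Primrec.nat_add.comp Primrec.id (Primrec.const 4))

theorem primrec_simBound : Primrec fun p : ℕ × ℕ × ℕ => simBound ratBound p.1 p.2.1 p.2.2 := by
  have hR : Primrec fun p : ℕ × ℕ × ℕ => p.2.1 := Primrec.fst.comp Primrec.snd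
  have hM : Primrec fun p : ℕ × ℕ × ℕ => p.2.1.factorial := primrec_factorial.comp hR
  have hB₁ : Primrec fun p : ℕ × ℕ × ℕ => p.2.2 ^ ((p.1 + 1) * p.2.1.factorial * (p.2.1 + 1)) :=
    primrec_pow.comp (Primrec.snd.comp Primrec.snd) (Primrec.nat_mul.comp (Primrec.nat_mul.comp
      (Primrec.succ.comp Primrec.fst) hM) (Primrec.succ.comp hR))
  have hBr := Primrec.nat_mul.comp hB₁ (primrec_pow.comp (primrec_ratBound.comp hB₁) hM)
  have hB₂ := Primrec.nat_add.comp (Primrec.nat_mul.comp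
    (Primrec.nat_mul.comp hB₁ (Primrec.const (ratBound 1))) (primrec_pow.comp hBr hM))
    (Primrec.nat_mul.comp hM hM)
  exact Primrec.nat_add.comp hB₁
    (Primrec.nat_mul.comp hBr (primrec_pow.comp (primrec_ratBound.comp hB₂) hM))

/-! ### Codes of rational numbers -/

/-- The rational number with code `j`. -/
def codeVal (j : ℕ) : ℚ :=
  -- Codes are triples (a, b, c) of naturals for (a − b)/(c + 1). Every number is a code, and
  -- uniqueness is not needed.
  ((j.unpair.1 : ℚ) - j.unpair.2.unpair.1) / (j.unpair.2.unpair.2 + 1)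

/-- A code of a product. -/
def codeMul (i j : ℕ) : ℕ :=
  Nat.pair (i.unpair.1 * j.unpair.1 + i.unpair.2.unpair.1 * j.unpair.2.unpair.1)
    (Nat.pair (i.unpair.1 * j.unpair.2.unpair.1 + i.unpair.2.unpair.1 * j.unpair.1)
      -- The third component is a denominator minus 1: (c + 1)(c' + 1) = (c c' + c + c') + 1.
      (i.unpair.2.unpair.2 * j.unpair.2.unpair.2 + i.unpair.2.unpair.2 + j.unpair.2.unpair.2))

theorem codeVal_mul (i j : ℕ) : codeVal (codeMul i j) = codeVal i * codeVal j := by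
  simp only [codeVal, codeMul, Nat.unpair_pair]
  push_cast
  rw [div_mul_div_comm]
  congr 1 <;> ring

/-- The two sides of a cross-multiplied comparison. -/
def codeCross (i j : ℕ) : ℕ :=
  i.unpair.1 * (j.unpair.2.unpair.2 + 1) + j.unpair.2.unpair.1 * (i.unpair.2.unpair.2 + 1)

/-- After cross-multiplication the subtracted terms are moved to the other side, so the comparison
takes place in ℕ and is visibly primitive recursive. -/
theorem codeVal_lt (i j : ℕ) : codeVal i < codeVal j ↔ codeCross i j < codeCross j i := by
  rw [codeVal, codeVal, div_lt_div_iff₀ (by positivity) (by positivity), codeCross, codeCross,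
    ← Nat.cast_lt (α := ℚ)]
  push_cast
  constructor <;> intro h <;> linarith

theorem codeVal_eq (i j : ℕ) : codeVal i = codeVal j ↔ codeCross i j = codeCross j i := by
  rw [← not_iff_not, ← ne_eq, ← ne_eq, ← lt_or_lt_iff_ne, ← lt_or_lt_iff_ne, codeVal_lt, codeVal_lt]

theorem primrec_codeMul : Primrec₂ codeMul := by
  have h1 : Primrec fun j : ℕ => j.unpair.1 := Primrec.fst.comp Primrec.unpair
  have h2 : Primrec fun j : ℕ => j.unpair.2 := Primrec.snd.comp Primrec.unpair
  have h3 := h1.comp h2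
  have h4 := h2.comp h2
  exact Primrec₂.natPair.comp
    (Primrec.nat_add.comp (Primrec.nat_mul.comp (h1.comp Primrec.fst) (h1.comp Primrec.snd))
      (Primrec.nat_mul.comp (h3.comp Primrec.fst) (h3.comp Primrec.snd)))
    (Primrec₂.natPair.comp
      (Primrec.nat_add.comp (Primrec.nat_mul.comp (h1.comp Primrec.fst) (h3.comp Primrec.snd))
        (Primrec.nat_mul.comp (h3.comp Primrec.fst) (h1.comp Primrec.snd)))
      (Primrec.nat_add.comp (Primrec.nat_add.comp
        (Primrec.nat_mul.comp (h4.comp Primrec.fst) (h4.comp Primrec.snd))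
        (h4.comp Primrec.fst)) (h4.comp Primrec.snd)))

theorem primrec_codeCross : Primrec₂ codeCross := by
  have h1 : Primrec fun j : ℕ => j.unpair.1 := Primrec.fst.comp Primrec.unpair
  have h2 : Primrec fun j : ℕ => j.unpair.2 := Primrec.snd.comp Primrec.unpair
  have h3 := h1.comp h2
  have h4 := h2.comp h2
  exact Primrec.nat_add.comp
    (Primrec.nat_mul.comp (h1.comp Primrec.fst) (Primrec.succ.comp (h4.comp Primrec.snd)))
    (Primrec.nat_mul.comp (h3.comp Primrec.snd) (Primrec.succ.comp (h4.comp Primrec.fst)))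

/-- The height of the absolute value of a rational number. -/
def absHeight (x : ℚ) : ℕ := ratHeight (signedMul_rat.val (signedMul_rat.posAbs x))

theorem val_posAbs_rat (x : ℚ) :
    signedMul_rat.val (signedMul_rat.posAbs x) = if x = 0 then 1 else |x| := by
  rcases lt_trichotomy x 0 with hx | rfl | hx
  · rw [signedMul_rat.val_posAbs_of_neg hx, if_neg hx.ne, abs_of_neg hx, mul_neg_one]
  · rw [signedMul_rat.posAbs_zero, if_pos rfl]; rfl
  · rw [signedMul_rat.val_posAbs_of_pos hx, if_neg hx.ne', abs_of_pos hx]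

/-- Unpairing does not increase numbers, so |a − b| ≤ j and c + 1 ≤ j + 1. This bounds heights of a
tuple by its codes. -/
theorem absHeight_codeVal_le (j : ℕ) : absHeight (codeVal j) ≤ j + 1 := by
  rw [absHeight, val_posAbs_rat]
  split_ifs with h
  · simp [ratHeight]
  · have ha : j.unpair.1 ≤ j := Nat.unpair_left_le j
    have hb : j.unpair.2.unpair.1 ≤ j := (Nat.unpair_left_le _).trans (Nat.unpair_right_le j)
    have hc : j.unpair.2.unpair.2 ≤ j := (Nat.unpair_right_le _).trans (Nat.unpair_right_le j)
    set a := j.unpair.1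
    set b := j.unpair.2.unpair.1
    set c := j.unpair.2.unpair.2
    have hval : |codeVal j| = (((a : ℤ) - b).natAbs : ℚ) / ((c + 1 : ℕ) : ℚ) := by
      rw [codeVal, abs_div, Nat.cast_natAbs]
      push_cast
      rw [abs_of_pos (by positivity : (0 : ℚ) < (c : ℚ) + 1)]
    have hab : ((a : ℤ) - b).natAbs ≠ 0 := by
      intro h0
      rw [h0, Nat.cast_zero, zero_div, abs_eq_zero] at hval
      exact h hval
    rw [hval]
    refine (ratHeight_div_le _ _ hab (by omega)).trans (max_le ?_ ?_) <;> omega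

/-- The other direction: a height bound limits the codes to be searched. The bound is that for two
nested pairings of numbers at most `H`. -/
theorem exists_codeVal_eq {x : ℚ} {H : ℕ} (hx : absHeight x ≤ H) :
    ∃ j < ((H + 1) ^ 2 + 1) ^ 2, codeVal j = x := by
  have hpair : ∀ a b c, a ≤ H → b ≤ H → c ≤ H →
      Nat.pair a (Nat.pair b c) < ((H + 1) ^ 2 + 1) ^ 2 := by
    intro a b c ha hb hc
    have h1 : Nat.pair b c < (H + 1) ^ 2 :=
      (Nat.pair_lt_max_add_one_sq b c).trans_le (Nat.pow_le_pow_left (by omega) 2)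
    refine (Nat.pair_lt_max_add_one_sq _ _).trans_le (Nat.pow_le_pow_left ?_ 2)
    have : H ≤ (H + 1) ^ 2 := by nlinarith
    omega
  rw [absHeight, val_posAbs_rat] at hx
  split_ifs at hx with h
  · refine ⟨Nat.pair 0 (Nat.pair 0 0), hpair _ _ _ (by omega) (by omega) (by omega), ?_⟩
    simp [codeVal, h]
  · have hn := (le_max_left _ _).trans hx
    have hd := (le_max_right _ _).trans hx
    rw [Rat.num_abs_eq_abs_num, Int.natAbs_abs] at hn
    rw [Rat.den_abs_eq_den] at hd
    have hden : (((x.den - 1 : ℕ) : ℚ) + 1) = x.den := by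
      have := x.den_pos
      rw [Nat.cast_sub (by omega)]; simp
    refine ⟨Nat.pair x.num.toNat (Nat.pair (-x.num).toNat (x.den - 1)),
      hpair _ _ _ (by omega) (by omega) (by omega), ?_⟩
    simp only [codeVal, Nat.unpair_pair, hden]
    have : ((x.num.toNat : ℚ) - (-x.num).toNat) = x.num := by
      have := Int.toNat_sub_toNat_neg x.num
      exact_mod_cast this
    rw [this, Rat.num_div_den]

theorem absHeight_heightBound :
    HeightBound (Additive signedMul_rat.posUnits)
      (fun p => ratHeight (signedMul_rat.val p.toMul)) ratBound :=
  ratHeight_heightBound _ (fun _ => signedMul_rat.val_pos _) rfl (fun _ _ => rfl)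
    (fun _ _ => Iff.rfl) fun x hx => ⟨Additive.ofMul (signedMul_rat.ofPos x hx), rfl⟩

/-! ### Formulas with a given code number do not distinguish similar tuples -/

/-- The similarity that suffices for formulas with code number at most `k`. -/
def codeSim (k : ℕ) : ℕ := k.rec 2 fun _ => simStep

theorem codeSim_succ (k : ℕ) : codeSim (k + 1) = simStep (codeSim k) := rfl

theorem primrec_codeSim : Primrec codeSim :=
  Primrec.nat_rec₁ 2 (primrec_simStep.comp Primrec.snd)

theorem codeSim_mono : Monotone codeSim :=
  monotone_nat_of_le_succ fun k => le_simStep (codeSim k)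

/-- The value 2 of `codeSim` at 0 is chosen for this: an atomic formula compares two terms, whose
coefficients are bounded by their codes plus 1 each. -/
theorem add_two_le_codeSim (k : ℕ) : k + 2 ≤ codeSim k := by
  induction k with
  | zero => exact le_rfl
  | succ k ih =>
    have := two_mul_le_simStep (codeSim k)
    rw [codeSim_succ]; omega

/-- The code exceeds what is needed, since pairing dominates both components and the code of a
product doubles it: the bounds for the factors add up to at most the new one. -/
theorem termRel_termCode {n : ℕ} {a b : Fin n → ℚ}
    (hab : ∀ i, signedMul_rat.chart.sgn (a i) = signedMul_rat.chart.sgn (b i))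
    (t : langMul.Term (Empty ⊕ Fin n)) :
    Chart.TermRel signedMul_rat.chart signedMul_rat.chart (termCode t + 1) a b
      (t.realize (Sum.elim default a)) (t.realize (Sum.elim default b)) := by
  induction t with
  | var x =>
    rcases x with x | i
    · exact x.elim
    · exact (Chart.TermRel.var (hab i)).mono (by omega)
  | func f ts ih =>
    cases f
    refine ((ih 0).mul (ih 1)).mono ?_
    have h1 := Nat.left_le_pair (termCode (ts 0)) (termCode (ts 1))
    have h2 := Nat.right_le_pair (termCode (ts 0)) (termCode (ts 1))
    simp only [termCode]; omega

/-- An effective form of `Chart.Compatible.realize_iff`. The Gödel number serves at once as a bound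
for coefficients and for quantifier depth, because subformulas have smaller numbers. -/
theorem realize_iff_of_eSim {n : ℕ} (φ : langMul.BoundedFormula Empty n) {a b : Fin n → ℚ}
    (hab : Chart.ESim signedMul_rat.chart signedMul_rat.chart (codeSim (formulaCode φ)) a b) :
    φ.Realize default a ↔ φ.Realize default b := by
  induction φ with
  | falsum => exact Iff.rfl
  | equal t s =>
    refine (termRel_termCode hab.sgn t).eq_iff hab ?_ (termRel_termCode hab.sgn s)
    have h1 := Nat.left_le_pair (termCode t) (termCode s)
    have h2 := Nat.right_le_pair (termCode t) (termCode s)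
    refine le_trans ?_ (add_two_le_codeSim _)
    simp only [formulaCode]; omega
  | rel r ts =>
    cases r
    refine (termRel_termCode hab.sgn (ts 0)).lt_iff hab ?_ (termRel_termCode hab.sgn (ts 1))
    have h1 := Nat.left_le_pair (termCode (ts 0)) (termCode (ts 1))
    have h2 := Nat.right_le_pair (termCode (ts 0)) (termCode (ts 1))
    refine le_trans ?_ (add_two_le_codeSim _)
    simp only [formulaCode]; omega
  | imp φ ψ ih₁ ih₂ =>
    have h1 := Nat.left_le_pair (formulaCode φ) (formulaCode ψ)
    have h2 := Nat.right_le_pair (formulaCode φ) (formulaCode ψ)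
    rw [BoundedFormula.realize_imp, BoundedFormula.realize_imp,
      ih₁ (hab.mono (codeSim_mono (by simp only [formulaCode]; omega))),
      ih₂ (hab.mono (codeSim_mono (by simp only [formulaCode]; omega)))]
  | @all n φ ih =>
    have key : ∀ {a b : Fin n → ℚ}, Chart.ESim signedMul_rat.chart signedMul_rat.chart
        (codeSim (formulaCode φ.all)) a b → φ.all.Realize default b → φ.all.Realize default a := by
      intro a b hab hφ c
      have hab' := hab.mono (R := simStep (codeSim (formulaCode φ)))
        ((codeSim_succ _).symm.trans_le (codeSim_mono (by simp only [formulaCode]; omega)))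
      obtain ⟨c', -, hc⟩ := hab'.extend (signedMul_rat.sameSigns signedMul_rat)
        (by have := add_two_le_codeSim (formulaCode φ); omega) absHeight_heightBound
        (B := 1 + Finset.univ.sup fun i => absHeight (b i)) (by omega) (fun i =>
          (Finset.le_sup (f := fun i => absHeight (b i)) (Finset.mem_univ i)).trans
            (Nat.le_add_left _ _)) c
      exact (ih hc).2 (hφ c')
    exact ⟨key hab.symm, key hab⟩

/-! ### Evaluation of formulas -/

/-- The arguments of the recursive calls in the evaluation of a term. -/
def termCalls (b : ℕ × List ℕ) : List (ℕ × List ℕ) :=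
  if b.1 % 2 = 1 then [((b.1 / 2).unpair.1, b.2), ((b.1 / 2).unpair.2, b.2)] else []

/-- One step of the evaluation of a term. -/
def termStep (b : ℕ × List ℕ) (r : List ℕ) : ℕ :=
  if b.1 % 2 = 1 then codeMul (r.getD 0 0) (r.getD 1 0) else b.2.getD (b.1 / 2) 0

theorem termCalls_lt (b : ℕ × List ℕ) : ∀ b' ∈ termCalls b, b'.1 < b.1 := by
  intro b' hb'
  have h1 := Nat.unpair_left_le (b.1 / 2)
  have h2 := Nat.unpair_right_le (b.1 / 2)
  rw [termCalls] at hb'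
  split_ifs at hb' with h
  · rcases List.mem_pair.1 hb' with rfl | rfl <;> simp only <;> omega
  · exact absurd hb' List.not_mem_nil

/-- A code of the value of the term with code number `b.1` at the tuple with codes `b.2`. -/
def termEval : ℕ × List ℕ → ℕ := listRec Prod.fst termCalls termStep termCalls_lt

theorem termEval_even (i : ℕ) (e : List ℕ) : termEval (2 * i, e) = e.getD i 0 := by
  rw [termEval, listRec_eq, termStep, if_neg (by simp only; omega)]
  simp

theorem termEval_odd (p : ℕ) (e : List ℕ) : termEval (2 * p + 1, e) =
    codeMul (termEval (p.unpair.1, e)) (termEval (p.unpair.2, e)) := by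
  have h1 : (2 * p + 1) % 2 = 1 := by omega
  have h2 : (2 * p + 1) / 2 = p := by omega
  refine (listRec_eq _ _ _ _ _).trans ?_
  simp only [termStep, termCalls, h1, h2, if_true]
  rfl

theorem codeVal_termEval {n : ℕ} (t : langMul.Term (Empty ⊕ Fin n)) (e : List ℕ) :
    codeVal (termEval (termCode t, e)) =
      t.realize (Sum.elim default fun i : Fin n => codeVal (e.getD i 0)) := by
  induction t with
  | var x =>
    rcases x with x | i
    · exact x.elim
    · simp only [termCode, termEval_even]; rfl
  | func f ts ih =>
    cases f
    simp only [termCode, termEval_odd, Nat.unpair_pair, codeVal_mul, ih]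
    rfl

/-- The number of codes that have to be tested for a quantifier. -/
def quantBound (j : ℕ) (e : List ℕ) : ℕ :=
  -- The entries of `e` are at most its code, so their values have height at most `Encodable.encode
  -- e + 1`. The extension lemma bounds the height of the new point, and the two squares convert
  -- this into a bound on codes.
  ((simBound ratBound e.length (codeSim j) (Encodable.encode e + 1) + 1) ^ 2 + 1) ^ 2

/-- The arguments of the recursive calls in the evaluation of a formula. -/
def formulaCalls (b : ℕ × List ℕ) : List (ℕ × List ℕ) :=
  if b.1 % 4 = 3 then [((b.1 / 4).unpair.1, b.2), ((b.1 / 4).unpair.2, b.2)]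
  else if b.1 % 4 = 0 ∧ b.1 ≠ 0 then
    (List.range (quantBound (b.1 / 4 - 1) b.2)).map fun c => (b.1 / 4 - 1, b.2 ++ [c])
  else []

/-- One step of the evaluation of a formula. -/
def formulaStep (b : ℕ × List ℕ) (r : List Bool) : Bool :=
  let x := termEval ((b.1 / 4).unpair.1, b.2)
  let y := termEval ((b.1 / 4).unpair.2, b.2)
  if b.1 % 4 = 1 then decide (codeCross x y = codeCross y x)
  else if b.1 % 4 = 2 then decide (codeCross x y < codeCross y x)
  else if b.1 % 4 = 3 then !r.getD 0 true || r.getD 1 true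
  else if b.1 = 0 then false
  else decide (∀ v ∈ r, v = true)

theorem formulaCalls_lt (b : ℕ × List ℕ) : ∀ b' ∈ formulaCalls b, b'.1 < b.1 := by
  intro b' hb'
  have h1 := Nat.unpair_left_le (b.1 / 4)
  have h2 := Nat.unpair_right_le (b.1 / 4)
  rw [formulaCalls] at hb'
  split_ifs at hb' with h h'
  · rcases List.mem_pair.1 hb' with rfl | rfl <;> simp only <;> omega
  · obtain ⟨c, -, rfl⟩ := List.mem_map.1 hb'
    simp only; omega
  · exact absurd hb' List.not_mem_nil

/-- The truth value of the formula with code number `b.1` at the tuple with codes `b.2`. -/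
def formulaEval : ℕ × List ℕ → Bool :=
  listRec Prod.fst formulaCalls formulaStep formulaCalls_lt

theorem formulaEval_falsum (e : List ℕ) : formulaEval (0, e) = false := by
  rw [formulaEval, listRec_eq]
  rfl

theorem formulaEval_equal (p : ℕ) (e : List ℕ) : formulaEval (4 * p + 1, e) = true ↔
    codeVal (termEval (p.unpair.1, e)) = codeVal (termEval (p.unpair.2, e)) := by
  have h1 : (4 * p + 1) % 4 = 1 := by omega
  have h2 : (4 * p + 1) / 4 = p := by omega
  rw [formulaEval, listRec_eq, codeVal_eq]
  simp [formulaStep, h1, h2]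

theorem formulaEval_lt (p : ℕ) (e : List ℕ) : formulaEval (4 * p + 2, e) = true ↔
    codeVal (termEval (p.unpair.1, e)) < codeVal (termEval (p.unpair.2, e)) := by
  have h1 : (4 * p + 2) % 4 = 2 := by omega
  have h2 : (4 * p + 2) / 4 = p := by omega
  rw [formulaEval, listRec_eq, codeVal_lt]
  simp [formulaStep, h1, h2]

theorem formulaEval_imp (p : ℕ) (e : List ℕ) : formulaEval (4 * p + 3, e) = true ↔
    (formulaEval (p.unpair.1, e) = true → formulaEval (p.unpair.2, e) = true) := by
  have h1 : (4 * p + 3) % 4 = 3 := by omega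
  have h2 : (4 * p + 3) / 4 = p := by omega
  have h : formulaEval (4 * p + 3, e) =
      (!formulaEval (p.unpair.1, e) || formulaEval (p.unpair.2, e)) := by
    refine (listRec_eq _ _ _ _ _).trans ?_
    simp only [formulaStep, formulaCalls, h1, h2, if_true]
    rfl
  rw [h]
  cases formulaEval (p.unpair.1, e) <;> simp

theorem formulaEval_all (j : ℕ) (e : List ℕ) : formulaEval (4 * j + 4, e) = true ↔
    ∀ c < quantBound j e, formulaEval (j, e ++ [c]) = true := by
  have h1 : (4 * j + 4) % 4 = 0 := by omega
  have h2 : (4 * j + 4) / 4 - 1 = j := by omega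
  have h : formulaEval (4 * j + 4, e) = decide (∀ v ∈ (List.range (quantBound j e)).map
      fun c => formulaEval (j, e ++ [c]), v = true) := by
    refine (listRec_eq _ _ _ _ _).trans ?_
    simp only [formulaStep, formulaCalls, h1, h2]
    simp [formulaEval]
  rw [h]
  simp

theorem le_encode_of_mem {e : List ℕ} {x : ℕ} (hx : x ∈ e) : x ≤ Encodable.encode e := by
  induction e with
  | nil => exact absurd hx List.not_mem_nil
  | cons y e ih =>
    rw [Encodable.encode_list_cons, Encodable.encode_nat]
    rcases List.mem_cons.1 hx with rfl | hx
    · exact (Nat.left_le_pair _ _).trans (Nat.le_succ _)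
    · exact (ih hx).trans ((Nat.right_le_pair _ _).trans (Nat.le_succ _))

theorem snoc_codeVal {n : ℕ} {e : List ℕ} (he : e.length = n) (c : ℕ) :
    (Fin.snoc (fun i : Fin n => codeVal (e.getD i 0)) (codeVal c) : Fin (n + 1) → ℚ) =
      fun i : Fin (n + 1) => codeVal ((e ++ [c]).getD i 0) := by
  subst he
  funext i
  refine Fin.lastCases ?_ (fun j => ?_) i
  · simp
  · rw [Fin.snoc_castSucc, Fin.val_castSucc, List.getD_append _ _ _ _ j.2]

/-- The point is that a universal quantifier may be tested on finitely many codes: over the given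
tuple, every rational is similar to one of bounded height, and similar points satisfy the same
subformula. -/
theorem formulaEval_iff {n : ℕ} (φ : langMul.BoundedFormula Empty n) {e : List ℕ}
    (he : e.length = n) : formulaEval (formulaCode φ, e) = true ↔
      φ.Realize default fun i : Fin n => codeVal (e.getD i 0) := by
  induction φ generalizing e with
  | falsum =>
    rw [formulaCode, formulaEval_falsum]
    simp [BoundedFormula.Realize]
  | equal t s =>
    rw [formulaCode, formulaEval_equal, Nat.unpair_pair, codeVal_termEval, codeVal_termEval]
    rfl
  | rel r ts =>
    cases r
    rw [formulaCode, formulaEval_lt, Nat.unpair_pair, codeVal_termEval, codeVal_termEval]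
    rfl
  | imp φ ψ ih₁ ih₂ =>
    rw [formulaCode, formulaEval_imp, Nat.unpair_pair, ih₁ he, ih₂ he]
    rfl
  | @all n φ ih =>
    rw [formulaCode, formulaEval_all, BoundedFormula.realize_all]
    have hih : ∀ c, formulaEval (formulaCode φ, e ++ [c]) = true ↔ φ.Realize default
        (Fin.snoc (fun i : Fin n => codeVal (e.getD i 0)) (codeVal c) : Fin (n + 1) → ℚ) := by
      intro c
      rw [ih (by simp [he]), snoc_codeVal he]
    simp only [hih]
    refine ⟨fun h x => ?_, fun h c _ => h _⟩
    -- The tuple is extended against itself: `x` on one side, and on the other a point x' of bounded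
    -- height.
    obtain ⟨x', hx', hs⟩ := (Chart.ESim.refl signedMul_rat.chart
      (simStep (codeSim (formulaCode φ))) fun i : Fin n => codeVal (e.getD i 0)).extend
        (signedMul_rat.sameSigns signedMul_rat)
        (by have := add_two_le_codeSim (formulaCode φ); omega) absHeight_heightBound
        (B := Encodable.encode e + 1) (by omega) (fun i => by
          refine (absHeight_codeVal_le _).trans (Nat.succ_le_succ (le_encode_of_mem ?_))
          rw [List.getD_eq_getElem _ _ (he.symm ▸ i.2)]
          exact List.getElem_mem _) x
    obtain ⟨c, hc, rfl⟩ := exists_codeVal_eq hx'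
    exact (realize_iff_of_eSim φ hs).2 (h c (by rw [quantBound, he]; exact hc))

/-! ### Primitive recursiveness of the evaluation -/

theorem primrec_unpair_fst : Primrec fun j : ℕ => j.unpair.1 := Primrec.fst.comp Primrec.unpair

theorem primrec_unpair_snd : Primrec fun j : ℕ => j.unpair.2 := Primrec.snd.comp Primrec.unpair

theorem primrec_div (d : ℕ) : Primrec fun j : ℕ => j / d :=
  Primrec.nat_div.comp Primrec.id (Primrec.const d)

theorem primrecPred_mod_eq (d r : ℕ) : PrimrecPred fun j : ℕ => j % d = r :=
  Primrec.eq.comp (Primrec.nat_mod.comp Primrec.id (Primrec.const d)) (Primrec.const r)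

theorem primrec_termEval : Primrec termEval := by
  have hd : Primrec fun b : ℕ × List ℕ => b.1 / 2 := (primrec_div 2).comp Primrec.fst
  have hm : PrimrecPred fun b : ℕ × List ℕ => b.1 % 2 = 1 :=
    (primrecPred_mod_eq 2 1).comp Primrec.fst
  refine primrec_listRec _ Primrec.fst ?_ ?_
  · exact Primrec.ite hm
      (Primrec.list_cons.comp ((primrec_unpair_fst.comp hd).pair Primrec.snd)
        (Primrec.list_cons.comp ((primrec_unpair_snd.comp hd).pair Primrec.snd)
          (Primrec.const [])))
      (Primrec.const [])
  · exact Primrec.ite (hm.comp Primrec.fst)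
      (primrec_codeMul.comp ((Primrec.list_getD 0).comp Primrec.snd (Primrec.const 0))
        ((Primrec.list_getD 0).comp Primrec.snd (Primrec.const 1)))
      ((Primrec.list_getD 0).comp (Primrec.snd.comp Primrec.fst) (hd.comp Primrec.fst))

theorem primrec_quantBound : Primrec₂ quantBound := by
  have hs : Primrec fun n : ℕ => (n + 1) ^ 2 :=
    primrec_pow.comp Primrec.succ (Primrec.const 2)
  exact hs.comp (hs.comp (primrec_simBound.comp
    ((Primrec.list_length.comp Primrec.snd).pair ((primrec_codeSim.comp Primrec.fst).pair
      (Primrec.succ.comp (Primrec.encode.comp Primrec.snd))))))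

theorem primrec_formulaEval : Primrec formulaEval := by
  have hd : Primrec fun b : ℕ × List ℕ => b.1 / 4 := (primrec_div 4).comp Primrec.fst
  have hm : ∀ r, PrimrecPred fun b : ℕ × List ℕ => b.1 % 4 = r := fun r =>
    (primrecPred_mod_eq 4 r).comp Primrec.fst
  have h0 : PrimrecPred fun b : ℕ × List ℕ => b.1 = 0 :=
    Primrec.eq.comp Primrec.fst (Primrec.const 0)
  refine primrec_listRec _ Primrec.fst ?_ ?_
  · refine Primrec.ite (hm 3)
      (Primrec.list_cons.comp ((primrec_unpair_fst.comp hd).pair Primrec.snd)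
        (Primrec.list_cons.comp ((primrec_unpair_snd.comp hd).pair Primrec.snd)
          (Primrec.const [])))
      (Primrec.ite ((hm 0).and h0.not) ?_ (Primrec.const []))
    have hj : Primrec fun b : ℕ × List ℕ => b.1 / 4 - 1 :=
      Primrec.nat_sub.comp hd (Primrec.const 1)
    exact Primrec.list_map (Primrec.list_range.comp (primrec_quantBound.comp hj Primrec.snd))
      ((hj.comp Primrec.fst).pair
        (Primrec.list_concat.comp (Primrec.snd.comp Primrec.fst) Primrec.snd))
  · have hx : Primrec fun p : (ℕ × List ℕ) × List Bool =>
        termEval ((p.1.1 / 4).unpair.1, p.1.2) :=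
      primrec_termEval.comp (((primrec_unpair_fst.comp hd).comp Primrec.fst).pair
        (Primrec.snd.comp Primrec.fst))
    have hy : Primrec fun p : (ℕ × List ℕ) × List Bool =>
        termEval ((p.1.1 / 4).unpair.2, p.1.2) :=
      primrec_termEval.comp (((primrec_unpair_snd.comp hd).comp Primrec.fst).pair
        (Primrec.snd.comp Primrec.fst))
    have hxy := primrec_codeCross.comp hx hy
    have hyx := primrec_codeCross.comp hy hx
    exact Primrec.ite ((hm 1).comp Primrec.fst) (Primrec.eq.comp hxy hyx).decide
      (Primrec.ite ((hm 2).comp Primrec.fst) (Primrec.nat_lt.comp hxy hyx).decide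
        (Primrec.ite ((hm 3).comp Primrec.fst)
          (Primrec.or.comp
            (Primrec.not.comp ((Primrec.list_getD true).comp Primrec.snd (Primrec.const 0)))
            ((Primrec.list_getD true).comp Primrec.snd (Primrec.const 1)))
          (Primrec.ite (h0.comp Primrec.fst) (Primrec.const false)
            ((Primrec.eq.comp Primrec.id (Primrec.const true)).forall_mem_list.comp
              Primrec.snd).decide)))

/-! ### Code numbers of formulas -/

/-- The arguments of the recursive calls in the computation of the variables of a term. -/
def termVarsCalls (k : ℕ) : List ℕ :=
  if k % 2 = 1 then [(k / 2).unpair.1, (k / 2).unpair.2] else []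

/-- One step of the computation of the variables of a term. -/
def termVarsStep (k : ℕ) (r : List ℕ) : ℕ :=
  if k % 2 = 1 then max (r.getD 0 0) (r.getD 1 0) else k / 2 + 1

theorem termVarsCalls_lt (k : ℕ) : ∀ k' ∈ termVarsCalls k, k' < k := by
  intro k' hk'
  have h1 := Nat.unpair_left_le (k / 2)
  have h2 := Nat.unpair_right_le (k / 2)
  rw [termVarsCalls] at hk'
  split_ifs at hk' with h
  · rcases List.mem_pair.1 hk' with rfl | rfl <;> omega
  · exact absurd hk' List.not_mem_nil

/-- The least `n` such that `k` is the code number of a term in the first `n` variables. -/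
def termVars : ℕ → ℕ := listRec id termVarsCalls termVarsStep termVarsCalls_lt

theorem termVars_even (i : ℕ) : termVars (2 * i) = i + 1 := by
  rw [termVars, listRec_eq, termVarsStep, if_neg (by omega)]
  simp

theorem termVars_odd (p : ℕ) :
    termVars (2 * p + 1) = max (termVars p.unpair.1) (termVars p.unpair.2) := by
  have h1 : (2 * p + 1) % 2 = 1 := by omega
  have h2 : (2 * p + 1) / 2 = p := by omega
  refine (listRec_eq _ _ _ _ _).trans ?_
  simp only [termVarsStep, termVarsCalls, h1, h2, if_true]
  rfl

/-- Every number codes a term once enough variables are allowed, so recognizing codes reduces to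
computing how many are needed. -/
theorem exists_termCode_eq_iff {n k : ℕ} :
    (∃ t : langMul.Term (Empty ⊕ Fin n), termCode t = k) ↔ termVars k ≤ n := by
  constructor
  · rintro ⟨t, rfl⟩
    induction t with
    | var x =>
      rcases x with x | i
      · exact x.elim
      · rw [termCode, termVars_even]; exact i.2
    | func f ts ih =>
      cases f
      rw [termCode, termVars_odd, Nat.unpair_pair]
      exact max_le (ih 0) (ih 1)
  · induction k using Nat.strong_induction_on with
    | _ k ih =>
      obtain ⟨p, rfl | rfl⟩ := Nat.even_or_odd' k
      · rw [termVars_even]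
        exact fun h => ⟨.var (Sum.inr ⟨p, h⟩), rfl⟩
      · rw [termVars_odd, max_le_iff]
        rintro ⟨h1, h2⟩
        have l1 := Nat.unpair_left_le p
        have l2 := Nat.unpair_right_le p
        obtain ⟨t, ht⟩ := ih _ (by omega) h1
        obtain ⟨s, hs⟩ := ih _ (by omega) h2
        refine ⟨.func MulFunc.mul ![t, s], ?_⟩
        change 2 * Nat.pair (termCode t) (termCode s) + 1 = _
        rw [ht, hs, Nat.pair_unpair]

/-- The arguments of the recursive calls in the computation of the variables of a formula. -/
def formulaVarsCalls (k : ℕ) : List ℕ :=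
  if k % 4 = 3 then [(k / 4).unpair.1, (k / 4).unpair.2]
  else if k % 4 = 0 ∧ k ≠ 0 then [k / 4 - 1]
  else []

/-- One step of the computation of the variables of a formula. -/
def formulaVarsStep (k : ℕ) (r : List ℕ) : ℕ :=
  if k % 4 = 3 then max (r.getD 0 0) (r.getD 1 0)
  -- Truncated subtraction is right for a quantifier whose body has no free variables. It also
  -- covers k = 0, falsum, where the list is empty and the default is 0.
  else if k % 4 = 0 then r.getD 0 0 - 1
  else max (termVars (k / 4).unpair.1) (termVars (k / 4).unpair.2)

theorem formulaVarsCalls_lt (k : ℕ) : ∀ k' ∈ formulaVarsCalls k, k' < k := by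
  intro k' hk'
  have h1 := Nat.unpair_left_le (k / 4)
  have h2 := Nat.unpair_right_le (k / 4)
  rw [formulaVarsCalls] at hk'
  split_ifs at hk' with h h'
  · rcases List.mem_pair.1 hk' with rfl | rfl <;> omega
  · obtain rfl := List.mem_singleton.1 hk'
    omega
  · exact absurd hk' List.not_mem_nil

/-- The least `n` such that `k` is the code number of a formula in the first `n` variables. -/
def formulaVars : ℕ → ℕ := listRec id formulaVarsCalls formulaVarsStep formulaVarsCalls_lt

theorem formulaVars_zero : formulaVars 0 = 0 := by
  rw [formulaVars, listRec_eq]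
  rfl

theorem formulaVars_equal (p : ℕ) :
    formulaVars (4 * p + 1) = max (termVars p.unpair.1) (termVars p.unpair.2) := by
  have h1 : (4 * p + 1) % 4 = 1 := by omega
  have h2 : (4 * p + 1) / 4 = p := by omega
  rw [formulaVars, listRec_eq]
  simp [formulaVarsStep, h1, h2]

theorem formulaVars_lt (p : ℕ) :
    formulaVars (4 * p + 2) = max (termVars p.unpair.1) (termVars p.unpair.2) := by
  have h1 : (4 * p + 2) % 4 = 2 := by omega
  have h2 : (4 * p + 2) / 4 = p := by omega
  rw [formulaVars, listRec_eq]
  simp [formulaVarsStep, h1, h2]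

theorem formulaVars_imp (p : ℕ) :
    formulaVars (4 * p + 3) = max (formulaVars p.unpair.1) (formulaVars p.unpair.2) := by
  have h1 : (4 * p + 3) % 4 = 3 := by omega
  have h2 : (4 * p + 3) / 4 = p := by omega
  refine (listRec_eq _ _ _ _ _).trans ?_
  simp only [formulaVarsStep, formulaVarsCalls, h1, h2, if_true]
  rfl

theorem formulaVars_all (j : ℕ) : formulaVars (4 * j + 4) = formulaVars j - 1 := by
  have h1 : (4 * j + 4) % 4 = 0 := by omega
  have h2 : (4 * j + 4) / 4 - 1 = j := by omega
  refine (listRec_eq _ _ _ _ _).trans ?_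
  simp only [formulaVarsStep, formulaVarsCalls, h1, h2]
  simp [formulaVars]

/-- For a quantifier, the body must be a formula in n + 1 variables, and v ≤ n + 1 is equivalent to
v − 1 ≤ n. With n = 0 this recognizes the codes of sentences. -/
theorem exists_formulaCode_eq_iff {n k : ℕ} :
    (∃ φ : langMul.BoundedFormula Empty n, formulaCode φ = k) ↔ formulaVars k ≤ n := by
  constructor
  · rintro ⟨φ, rfl⟩
    induction φ with
    | falsum => rw [formulaCode, formulaVars_zero]; exact Nat.zero_le _
    | equal t s =>
      rw [formulaCode, formulaVars_equal, Nat.unpair_pair]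
      exact max_le (exists_termCode_eq_iff.1 ⟨t, rfl⟩) (exists_termCode_eq_iff.1 ⟨s, rfl⟩)
    | rel r ts =>
      cases r
      rw [formulaCode, formulaVars_lt, Nat.unpair_pair]
      exact max_le (exists_termCode_eq_iff.1 ⟨ts 0, rfl⟩) (exists_termCode_eq_iff.1 ⟨ts 1, rfl⟩)
    | imp φ ψ ih₁ ih₂ =>
      rw [formulaCode, formulaVars_imp, Nat.unpair_pair]
      exact max_le ih₁ ih₂
    | all φ ih =>
      rw [formulaCode, formulaVars_all]
      omega
  · induction k using Nat.strong_induction_on generalizing n with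
    | _ k ih =>
      have l1 := Nat.unpair_left_le (k / 4)
      have l2 := Nat.unpair_right_le (k / 4)
      obtain rfl | ⟨p, rfl | rfl | rfl | rfl⟩ : k = 0 ∨ ∃ p, k = 4 * p + 1 ∨ k = 4 * p + 2 ∨
          k = 4 * p + 3 ∨ k = 4 * p + 4 := by
        rcases Nat.eq_zero_or_pos k with h | h
        · exact Or.inl h
        · exact Or.inr ⟨(k - 1) / 4, by omega⟩
      · exact fun _ => ⟨.falsum, rfl⟩
      · rw [formulaVars_equal, max_le_iff, ← exists_termCode_eq_iff, ← exists_termCode_eq_iff]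
        rintro ⟨⟨t, ht⟩, s, hs⟩
        exact ⟨.equal t s, by rw [formulaCode, ht, hs, Nat.pair_unpair]⟩
      · rw [formulaVars_lt, max_le_iff, ← exists_termCode_eq_iff, ← exists_termCode_eq_iff]
        rintro ⟨⟨t, ht⟩, s, hs⟩
        refine ⟨.rel LtRel.lt ![t, s], ?_⟩
        change 4 * Nat.pair (termCode t) (termCode s) + 2 = _
        rw [ht, hs, Nat.pair_unpair]
      · rw [formulaVars_imp, max_le_iff]
        rintro ⟨h1, h2⟩
        rw [show (4 * p + 3) / 4 = p by omega] at l1 l2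
        obtain ⟨φ, hφ⟩ := ih _ (by omega) h1
        obtain ⟨ψ, hψ⟩ := ih _ (by omega) h2
        exact ⟨.imp φ ψ, by rw [formulaCode, hφ, hψ, Nat.pair_unpair]⟩
      · rw [formulaVars_all]
        intro h
        obtain ⟨φ, hφ⟩ := ih p (by omega) (n := n + 1) (by omega)
        exact ⟨.all φ, by rw [formulaCode, hφ]⟩

theorem primrec_termVars : Primrec termVars :=
  primrec_listRec _ Primrec.id
    (Primrec.ite (primrecPred_mod_eq 2 1)
      (Primrec.list_cons.comp (primrec_unpair_fst.comp (primrec_div 2))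
        (Primrec.list_cons.comp (primrec_unpair_snd.comp (primrec_div 2)) (Primrec.const [])))
      (Primrec.const []))
    (Primrec.ite ((primrecPred_mod_eq 2 1).comp Primrec.fst)
      (Primrec.nat_max.comp ((Primrec.list_getD 0).comp Primrec.snd (Primrec.const 0))
        ((Primrec.list_getD 0).comp Primrec.snd (Primrec.const 1)))
      (Primrec.succ.comp ((primrec_div 2).comp Primrec.fst)))

theorem primrec_formulaVars : Primrec formulaVars :=
  primrec_listRec _ Primrec.id
    (Primrec.ite (primrecPred_mod_eq 4 3)
      (Primrec.list_cons.comp (primrec_unpair_fst.comp (primrec_div 4))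
        (Primrec.list_cons.comp (primrec_unpair_snd.comp (primrec_div 4)) (Primrec.const [])))
      (Primrec.ite ((primrecPred_mod_eq 4 0).and
          (Primrec.eq.comp Primrec.id (Primrec.const 0)).not)
        (Primrec.list_cons.comp (Primrec.nat_sub.comp (primrec_div 4) (Primrec.const 1))
          (Primrec.const []))
        (Primrec.const [])))
    (Primrec.ite ((primrecPred_mod_eq 4 3).comp Primrec.fst)
      (Primrec.nat_max.comp ((Primrec.list_getD 0).comp Primrec.snd (Primrec.const 0))
        ((Primrec.list_getD 0).comp Primrec.snd (Primrec.const 1)))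
      (Primrec.ite ((primrecPred_mod_eq 4 0).comp Primrec.fst)
        (Primrec.nat_sub.comp ((Primrec.list_getD 0).comp Primrec.snd (Primrec.const 0))
          (Primrec.const 1))
        (Primrec.nat_max.comp
          (primrec_termVars.comp (primrec_unpair_fst.comp ((primrec_div 4).comp Primrec.fst)))
          (primrec_termVars.comp (primrec_unpair_snd.comp ((primrec_div 4).comp Primrec.fst))))))

/-! ### Decidability -/

/-- Two primitive recursive tests: that the number codes a sentence, and that its evaluation at the
empty tuple is true. The first is needed because the evaluation assigns a value to every number. -/
theorem theoryDecidable_rat : TheoryDecidable ℚ := by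
  have h : PrimrecPred fun k : ℕ => formulaVars k ≤ 0 ∧ formulaEval (k, []) = true :=
    (Primrec.nat_le.comp primrec_formulaVars (Primrec.const 0)).and
      (Primrec.eq.comp (primrec_formulaEval.comp (Primrec.id.pair (Primrec.const [])))
        (Primrec.const true))
  refine ComputablePred.of_eq ⟨inferInstance, h.decide.to_comp⟩ fun k => ?_
  rw [← exists_formulaCode_eq_iff]
  have key : ∀ φ : langMul.Sentence, formulaEval (formulaCode φ, []) = true ↔ ℚ ⊨ φ := by
    intro φ
    refine (formulaEval_iff φ (e := []) rfl).trans ?_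
    rw [Sentence.Realize, Formula.Realize]
    exact iff_of_eq (congrArg₂ (fun v w => BoundedFormula.Realize φ v w) (Subsingleton.elim _ _)
      (Subsingleton.elim _ _))
  constructor
  · rintro ⟨⟨φ, rfl⟩, h⟩
    exact ⟨φ, rfl, (key φ).1 h⟩
  · rintro ⟨φ, rfl, h⟩
    exact ⟨⟨φ, rfl⟩, (key φ).2 h⟩

end OrdMul

theorem mainTheorem1 :
    (OrdMul.CompletelyAxiomatizes OrdMul.TQ OrdMul.PosRat ∧
      OrdMul.CompletelyAxiomatizesVia OrdMul.toGroup OrdMul.TQ OrdMul.PosRat ∧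
      OrdMul.HasQE (OrdMul.langGroup.sum OrdMul.langPow) OrdMul.PosRat) ∧
    (OrdMul.CompletelyAxiomatizes OrdMul.TQSigned ℚ ∧
      OrdMul.CompletelyAxiomatizesVia OrdMul.toSigned OrdMul.TQSigned ℚ ∧
      OrdMul.HasQE (OrdMul.langSigned.sum OrdMul.langPow) ℚ) ∧
    OrdMul.TheoryDecidable ℚ :=
  ⟨⟨OrdMul.completelyAxiomatizes_TQ, OrdMul.completelyAxiomatizes_TQ.via OrdMul.toGroup,
    OrdMul.hasQE_posRat⟩,
  ⟨OrdMul.completelyAxiomatizes_TQSigned, OrdMul.completelyAxiomatizes_TQSigned.via OrdMul.toSigned,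
    OrdMul.hasQE_rat⟩, OrdMul.theoryDecidable_rat⟩
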